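/- Let $r\ge 1$ be an integer, let $S_0=\operatorname{Spec}\mathbb Z[r^{-1}](\mu_r)$, i.e. the spectrum of $\mathbb Z[r^{-1},\zeta_r]$ with $\zeta_r$ a primitive $r$-th root of unity, let $X$ be a noetherian scheme over $S_0$, $\mathcal L$ an invertible sheaf on $X$, and $s$ a global section of $\mathcal L$. Let $i:D\hookrightarrow X$ be the zero locus of $s$, the largest closed subscheme on which $s$ vanishes. Let $\mathfrak X=X_{(\mathcal L,s,r)}$ be the root stack. Its objects over an $S_0$-scheme $T$ are the quadruples $(f,\mathcal M,t,\phi)$ with $f:T\to X$ an $S_0$-morphism, $\mathcal M$ an invertible sheaf on $T$, $t\in\Gamma(T,\mathcal M)$, and $\phi:\mathcal M^{\otimes r}\simeq f^*\mathcal L$ an isomorphism with $\phi(t^{\otimes r})=f^*s$. The arrows from $(f,\mathcal M,t,\phi)$ over $T$ to $(g,\mathcal N,u,\psi)$ over $T'$ are the pairs $(h,\rho)$ with $h:T\to T'$, $g\circ h=f$, and $\rho:\mathcal M\simeq h^*\mathcal N$ an isomorphism such that $\rho(t)=h^*u$ and $h^*\psi\circ\rho^{\otimes r}=\phi$. Let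 $\mathfrak D=D_{(\mathcal L|_D,r)}$ be the gerbe of $r$-th roots of $\mathcal L|_D$ on $D$: its objects are the triples $(g,\mathcal M,\phi)$ with $g:T\to D$, $\mathcal M$ invertible on $T$ and $\phi:\mathcal M^{\otimes r}\simeq g^*(\mathcal L|_D)$, and its arrows are as above, without the condition on sections. The inertia stack $I_{\mathfrak X}$ has as objects over $T$ the pairs $(x,\nu)$ with $x$ an object of $\mathfrak X$ over $T$ and $\nu:x\to x$ an arrow over $\mathrm{id}_T$; the arrows $(x,\nu)\to(x',\nu')$ are the arrows $u:x\to x'$ with $\nu'\circ u=u\circ\nu$. Then $s|_D=0$, and there is a canonical equivalence of stacks over $S_0$ $$\mathfrak X\ \sqcup\ \coprod_{\zeta\in\mu_r(S_0)\setminus\{1\}}\mathfrak D\ \simeq\ I_{\mathfrak X}$$ (coproduct of stacks: an object of the left-hand side over $T$ is a decomposition of $T$ into disjoint open and closed pieces indexed by the members of the family, with an object of the corresponding member over each piece). It is the one whose restriction to $\mathfrak X$ is $x\mapsto(x,\mathrm{id}_x)$, and whose restriction to the copy of $\mathfrak D$ with index $\zeta$ is $(g,\mathcal M,\phi)\mapsto\big((i\circ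 g,\mathcal M,0,\phi),\zeta\big)$, where $\zeta$ acts on $\mathcal M$ by multiplication. -/

import Mathlib

open CategoryTheory AlgebraicGeometry TopologicalSpace Opposite

universe u

section TensorPowerMap

variable {A B M N : Type*} [CommRing A] [CommRing B] [AddCommGroup M] [AddCommGroup N]
  [Module A M] [Module B N]

/-- A map `f : M → N` semilinear along `σ : A → B` induces a map of `r`-th tensor powers
`m₁ ⊗ ⋯ ⊗ mᵣ ↦ f m₁ ⊗ ⋯ ⊗ f mᵣ`. -/
noncomputable def tensorPowerMap (σ : A →+* B) (f : M →ₛₗ[σ] N) (r : ℕ) :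
    (PiTensorProduct A fun _ : Fin r => M) →ₛₗ[σ] (PiTensorProduct B fun _ : Fin r => N) :=
  letI : Module A (PiTensorProduct B fun _ : Fin r => N) := Module.compHom _ σ
  let g : MultilinearMap A (fun _ : Fin r => M) (PiTensorProduct B fun _ : Fin r => N) :=
    { toFun := fun m => PiTensorProduct.tprod B fun i => f (m i)
      map_update_add' := by
        intro _ m i x y
        have key : ∀ z : M, (fun j => f (Function.update m i z j))
            = Function.update (fun j => f (m j)) i (f z) := by
          intro z; ext j; by_cases h : j = i
          · subst h; simp
          · simp [h]
        have inst : ‹DecidableEq (Fin r)› = instDecidableEqFin r := Subsingleton.elim _ _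
        subst inst
        simp only [key, map_add, MultilinearMap.map_update_add]
      map_update_smul' := by
        intro _ m i c x
        have key : ∀ z : M, (fun j => f (Function.update m i z j))
            = Function.update (fun j => f (m j)) i (f z) := by
          intro z; ext j; by_cases h : j = i
          · subst h; simp
          · simp [h]
        have inst : ‹DecidableEq (Fin r)› = instDecidableEqFin r := Subsingleton.elim _ _
        subst inst
        simp only [key, LinearMap.map_smulₛₗ, MultilinearMap.map_update_smul]
        rfl }
  { toFun := PiTensorProduct.lift g
    map_add' := map_add _
    map_smul' := fun a x => (PiTensorProduct.lift g).map_smul a x }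

theorem tensorPowerMap_tprod (σ : A →+* B) (f : M →ₛₗ[σ] N) (r : ℕ) (m : Fin r → M) :
    tensorPowerMap σ f r (PiTensorProduct.tprod A m) = PiTensorProduct.tprod B fun i => f (m i) := by
  let _ : Module A (PiTensorProduct B fun _ : Fin r => N) := Module.compHom _ σ
  exact PiTensorProduct.lift.tprod _

end TensorPowerMap

namespace AlgebraicGeometry.Scheme.Modules
variable {X : Scheme.{u}} (M : X.Modules)

/-- The restriction map `Γ(M, V)^{⊗ r} → Γ(M, U)^{⊗ r}`, the tensor powers being over `Γ(X, V)` and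
`Γ(X, U)`. -/
noncomputable def tensorPowerRes {U V : X.Opens} (i : U ⟶ V) (r : ℕ) :
    (PiTensorProduct Γ(X, V) fun _ : Fin r => Γ(M, V)) →ₛₗ[(X.presheaf.map i.op).hom]
      (PiTensorProduct Γ(X, U) fun _ : Fin r => Γ(M, U)) :=
  tensorPowerMap (X.presheaf.map i.op).hom
    { toFun := M.presheaf.map i.op
      map_add' := map_add _
      map_smul' := M.map_smul i } r

theorem tensorPowerRes_tprod {U V : X.Opens} (i : U ⟶ V) (r : ℕ) (m : Fin r → Γ(M, V)) :
    M.tensorPowerRes i r (PiTensorProduct.tprod _ m) =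
      PiTensorProduct.tprod Γ(X, U) fun k => M.presheaf.map i.op (m k) :=
  tensorPowerMap_tprod _ _ _ _

/-- The presheaf of abelian groups `U ↦ Γ(M, U) ⊗ ⋯ ⊗ Γ(M, U)` (`r` factors over `Γ(X, U)`). -/
noncomputable def tensorPowerAb (r : ℕ) : (X.Opens)ᵒᵖ ⥤ Ab.{u} where
  obj U := AddCommGrpCat.of (PiTensorProduct Γ(X, U.unop) fun _ : Fin r => Γ(M, U.unop))
  map {U V} i := AddCommGrpCat.ofHom (M.tensorPowerRes i.unop r).toAddMonoidHom
  map_id U := by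
    ext x
    change M.tensorPowerRes (𝟙 U.unop) r x = x
    induction x using PiTensorProduct.induction_on with
    | smul_tprod a m =>
      rw [LinearMap.map_smulₛₗ, tensorPowerRes_tprod]
      simp
    | add x y hx hy => rw [map_add, hx, hy]
  map_comp {U V W} i j := by
    ext x
    change M.tensorPowerRes (j.unop ≫ i.unop) r x =
      M.tensorPowerRes j.unop r (M.tensorPowerRes i.unop r x)
    induction x using PiTensorProduct.induction_on with
    | smul_tprod a m =>
      rw [LinearMap.map_smulₛₗ, LinearMap.map_smulₛₗ, LinearMap.map_smulₛₗ, tensorPowerRes_tprod,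
        tensorPowerRes_tprod, tensorPowerRes_tprod]
      simp
    | add x y hx hy => rw [map_add, map_add, map_add, hx, hy]

noncomputable instance (r : ℕ) (U : (X.Opens)ᵒᵖ) :
    Module (X.ringCatSheaf.obj.obj U) ((M.tensorPowerAb r).obj U) :=
  inferInstanceAs (Module Γ(X, U.unop) (PiTensorProduct Γ(X, U.unop) fun _ : Fin r => Γ(M, U.unop)))

/-- The presheaf of modules `U ↦ Γ(M, U)^{⊗ r}`. -/
noncomputable def tensorPowerPresheaf (r : ℕ) : X.PresheafOfModules :=
  PresheafOfModules.ofPresheaf (M.tensorPowerAb r) fun {_ _} i a x =>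
    (M.tensorPowerRes i.unop r).map_smulₛₗ a x

/-- The tensor power `M^{⊗ r}`: the sheaf associated with `U ↦ Γ(M, U)^{⊗ r}`. -/
noncomputable def tensorPower (r : ℕ) : X.Modules :=
  (PresheafOfModules.sheafification (𝟙 X.ringCatSheaf.obj)).obj (M.tensorPowerPresheaf r)

/-- The section `m₁ ⊗ ⋯ ⊗ mᵣ` of `M^{⊗ r}` over `U`, for sections `mᵢ` of `M` over `U`. -/
noncomputable def tprod (r : ℕ) (U : X.Opens) :
    MultilinearMap Γ(X, U) (fun _ : Fin r => Γ(M, U)) Γ(M.tensorPower r, U) :=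
  let η := (PresheafOfModules.sheafificationAdjunction (𝟙 X.ringCatSheaf.obj)).unit.app
    (M.tensorPowerPresheaf r)
  let l : (PiTensorProduct Γ(X, U) fun _ : Fin r => Γ(M, U)) →ₗ[Γ(X, U)] Γ(M.tensorPower r, U) :=
    { toFun := fun x => (η.app (op U)).hom x
      map_add' := fun x y => (η.app (op U)).hom.map_add x y
      map_smul' := fun a x => (η.app (op U)).hom.map_smul a x }
  l.compMultilinearMap (PiTensorProduct.tprod Γ(X, U))

/-- Multiplication by a global function `a`, as an endomorphism of `M`. -/
noncomputable def smulHom (a : Γ(X, ⊤)) : M ⟶ M :=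
  ⟨PresheafOfModules.homMk
    { app := fun U => AddCommGrpCat.ofHom (AddMonoidHom.mk'
        (fun m : Γ(M, U.unop) => X.presheaf.map (homOfLE (le_top : U.unop ≤ ⊤)).op a • m)
        (smul_add (A := Γ(M, U.unop)) (X.presheaf.map (homOfLE (le_top : U.unop ≤ ⊤)).op a)))
      naturality := by
        intro U V i
        ext (m : Γ(M, U.unop))
        change X.presheaf.map (homOfLE (le_top : V.unop ≤ ⊤)).op a • M.presheaf.map i.unop.op m =
          M.presheaf.map i.unop.op (X.presheaf.map (homOfLE (le_top : U.unop ≤ ⊤)).op a • m)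
        rw [M.map_smul, ← ConcreteCategory.comp_apply, ← Functor.map_comp]
        rfl }
    (fun U b m => smul_comm (M := Γ(X, U.unop)) (N := Γ(X, U.unop)) (α := Γ(M, U.unop)) _ b m)⟩

/-- `M` is an invertible sheaf: locally on `X`, it is isomorphic to the structure sheaf. -/
def IsInvertible : Prop :=
  ∀ x : X, ∃ U : X.Opens, x ∈ U ∧
    Nonempty (M.restrict U.ι ≅ SheafOfModules.unit U.toScheme.ringCatSheaf)

theorem smulHom_app (a : Γ(X, ⊤)) (U : X.Opens) (m : Γ(M, U)) :
    (M.smulHom a).app U m = X.presheaf.map (homOfLE (le_top : U ≤ ⊤)).op a • m := rfl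

theorem smulHom_mul (a b : Γ(X, ⊤)) : M.smulHom b ≫ M.smulHom a = M.smulHom (a * b) := by
  ext U m
  change X.presheaf.map (homOfLE (le_top : U ≤ ⊤)).op a •
      X.presheaf.map (homOfLE (le_top : U ≤ ⊤)).op b • m =
    X.presheaf.map (homOfLE (le_top : U ≤ ⊤)).op (a * b) • m
  rw [map_mul, mul_smul]

theorem smulHom_one : M.smulHom 1 = 𝟙 M := by
  ext U m
  change X.presheaf.map (homOfLE (le_top : U ≤ ⊤)).op 1 • m = m
  rw [map_one, one_smul]

/-- Multiplication by an invertible global function, as an automorphism of `M`. -/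
@[simps]
noncomputable def smulIso (a : Γ(X, ⊤)ˣ) : M ≅ M where
  hom := M.smulHom a
  inv := M.smulHom ↑a⁻¹
  hom_inv_id := by rw [smulHom_mul, Units.inv_mul, smulHom_one]
  inv_hom_id := by rw [smulHom_mul, Units.mul_inv, smulHom_one]

end AlgebraicGeometry.Scheme.Modules
namespace AlgebraicGeometry.Scheme.Modules

variable {S T W X : Scheme.{u}}

/-- The pull-back `f^* x` over `f⁻¹ U` of a section `x` of `L` over `U`. -/
noncomputable def pullbackSection (f : T ⟶ X) (L : X.Modules) (U : X.Opens) :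
    Γ(L, U) ⟶ Γ((pullback f).obj L, f ⁻¹ᵁ U) :=
  ((pullbackPushforwardAdjunction f).unit.app L).app U

/-- The canonical isomorphism `h^* g^* L ≅ f^* L` when `f = g ∘ h`. -/
noncomputable def pullbackTrans (h : S ⟶ T) (g : T ⟶ X) (f : S ⟶ X) (w : h ≫ g = f)
    (L : X.Modules) : (pullback h).obj ((pullback g).obj L) ≅ (pullback f).obj L :=
  (pullbackComp h g).app L ≪≫ (pullbackCongr w).app L

theorem pullback_hom_ext {f : T ⟶ X} {L : X.Modules} {K : T.Modules}
    {a b : (pullback f).obj L ⟶ K}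
    (H : ∀ U (x : Γ(L, U)), a.app (f ⁻¹ᵁ U) (pullbackSection f L U x) =
      b.app (f ⁻¹ᵁ U) (pullbackSection f L U x)) : a = b := by
  apply ((pullbackPushforwardAdjunction f).homEquiv _ _).injective
  rw [Adjunction.homEquiv_unit, Adjunction.homEquiv_unit]
  ext U x
  exact H U x

theorem pullbackSection_naturality (f : T ⟶ X) {L L' : X.Modules} (a : L ⟶ L') (U : X.Opens)
    (x : Γ(L, U)) : ((pullback f).map a).app (f ⁻¹ᵁ U) (pullbackSection f L U x) =
      pullbackSection f L' U (a.app U x) := by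
  have := (pullbackPushforwardAdjunction f).unit.naturality a
  exact congr(($this).app U x).symm

theorem pullbackComp_inv_section (h : S ⟶ T) (g : T ⟶ X) (L : X.Modules) (U : X.Opens)
    (x : Γ(L, U)) :
    ((pullbackComp h g).inv.app L).app (h ⁻¹ᵁ g ⁻¹ᵁ U) (pullbackSection (h ≫ g) L U x) =
      pullbackSection h _ _ (pullbackSection g L U x) := by
  have := unit_conjugateEquiv ((pullbackPushforwardAdjunction g).comp
    (pullbackPushforwardAdjunction h)) (pullbackPushforwardAdjunction (h ≫ g))
    (pullbackComp h g).inv L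
  rw [conjugateEquiv_pullbackComp_inv] at this
  exact congr(($this).app U x).symm

theorem pullbackComp_hom_section (h : S ⟶ T) (g : T ⟶ X) (L : X.Modules) (U : X.Opens)
    (x : Γ(L, U)) :
    ((pullbackComp h g).hom.app L).app (h ⁻¹ᵁ g ⁻¹ᵁ U)
      (pullbackSection h _ _ (pullbackSection g L U x)) = pullbackSection (h ≫ g) L U x := by
  rw [← pullbackComp_inv_section]
  exact congr(($((pullbackComp h g).inv_hom_id_app L)).app (h ⁻¹ᵁ g ⁻¹ᵁ U)
    (pullbackSection (h ≫ g) L U x))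

theorem pullbackId_inv_section (L : X.Modules) (U : X.Opens) (x : Γ(L, U)) :
    ((pullbackId X).inv.app L).app U x = pullbackSection (𝟙 X) L U x := by
  have := unit_conjugateEquiv Adjunction.id (pullbackPushforwardAdjunction (𝟙 X))
    (pullbackId X).hom L
  rw [conjugateEquiv_pullbackId_hom] at this
  have h2 := congr(($this).app U x)
  have h3 : x = ((pullbackId X).hom.app L).app U (pullbackSection (𝟙 X) L U x) := h2
  conv_lhs => rw [h3]
  exact congr(($((pullbackId X).hom_inv_id_app L)).app U (pullbackSection (𝟙 X) L U x))

theorem pullbackId_hom_section (L : X.Modules) (U : X.Opens) (x : Γ(L, U)) :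
    ((pullbackId X).hom.app L).app U (pullbackSection (𝟙 X) L U x) = x := by
  have := unit_conjugateEquiv Adjunction.id (pullbackPushforwardAdjunction (𝟙 X))
    (pullbackId X).hom L
  rw [conjugateEquiv_pullbackId_hom] at this
  exact congr(($this).app U x).symm

theorem pullbackTrans_rfl_hom (h : S ⟶ T) (g : T ⟶ X) (L : X.Modules) :
    (pullbackTrans h g (h ≫ g) rfl L).hom = (pullbackComp h g).hom.app L := by
  have : (pullbackCongr (rfl : h ≫ g = h ≫ g)).hom.app L = 𝟙 _ := by
    rw [pullbackCongr, eqToIso_refl]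
    rfl
  rw [pullbackTrans, Iso.trans_hom, Iso.app_hom, Iso.app_hom, this, Category.comp_id]

theorem pullbackTrans_section (h : S ⟶ T) (g : T ⟶ X) (f : S ⟶ X) (w : h ≫ g = f)
    (L : X.Modules) (U : X.Opens) (x : Γ(L, U)) :
    (pullbackTrans h g f w L).hom.app (h ⁻¹ᵁ g ⁻¹ᵁ U)
      (pullbackSection h _ _ (pullbackSection g L U x)) =
    ((pullback f).obj L).presheaf.map (eqToHom (by subst w; rfl : h ⁻¹ᵁ g ⁻¹ᵁ U = f ⁻¹ᵁ U)).op
      (pullbackSection f L U x) := by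
  subst w
  rw [pullbackTrans_rfl_hom, pullbackComp_hom_section]
  exact congr($(((pullback (h ≫ g)).obj L).presheaf.map_id _) _).symm

theorem hom_app_map {L L' : X.Modules} (a : L ⟶ L') {U V : X.Opens} (i : U ⟶ V) (x : Γ(L, V)) :
    a.app U (L.presheaf.map i.op x) = L'.presheaf.map i.op (a.app V x) :=
  congr($(a.mapPresheaf.naturality i.op) x)

theorem map_eqToHom_self {L : X.Modules} {U : X.Opens} (h : U = U) (x : Γ(L, U)) :
    L.presheaf.map (eqToHom h).op x = x :=
  congr($(L.presheaf.map_id (op U)) x)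

theorem pullbackTrans_id (f : T ⟶ X) (w : 𝟙 T ≫ f = f) (L : X.Modules) :
    (pullbackTrans (𝟙 T) f f w L).hom = (pullbackId T).hom.app ((pullback f).obj L) := by
  have key : ((pullbackPushforwardAdjunction (𝟙 T)).homEquiv _ _)
      (pullbackTrans (𝟙 T) f f w L).hom = ((pullbackPushforwardAdjunction (𝟙 T)).homEquiv _ _)
      ((pullbackId T).hom.app ((pullback f).obj L)) := by
    apply pullback_hom_ext
    intro U x
    rw [Adjunction.homEquiv_unit, Adjunction.homEquiv_unit]
    refine (pullbackTrans_section (𝟙 T) f f w L U x).trans ?_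
    refine Eq.trans ?_ (pullbackId_hom_section ((pullback f).obj L) (f ⁻¹ᵁ U)
      (pullbackSection f L U x)).symm
    exact congr($(((pullback f).obj L).presheaf.map_id _) (pullbackSection f L U x))
  exact ((pullbackPushforwardAdjunction (𝟙 T)).homEquiv _ _).injective key

theorem pullbackTrans_comp (h : S ⟶ T) (k : T ⟶ W) (e : W ⟶ X) (g : T ⟶ X) (f : S ⟶ X)
    (wg : k ≫ e = g) (wf : h ≫ g = f) (wf' : (h ≫ k) ≫ e = f) (L : X.Modules) :
    (pullbackComp h k).hom.app ((pullback e).obj L) ≫ (pullbackTrans (h ≫ k) e f wf' L).hom =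
      (pullback h).map (pullbackTrans k e g wg L).hom ≫ (pullbackTrans h g f wf L).hom := by
  subst wg wf
  apply ((pullbackPushforwardAdjunction h).homEquiv _ _).injective
  apply ((pullbackPushforwardAdjunction k).homEquiv _ _).injective
  apply pullback_hom_ext
  intro U x
  rw [Adjunction.homEquiv_unit, Adjunction.homEquiv_unit, Adjunction.homEquiv_unit,
    Adjunction.homEquiv_unit]
  change (pullbackTrans (h ≫ k) e (h ≫ k ≫ e) wf' L).hom.app (h ⁻¹ᵁ k ⁻¹ᵁ e ⁻¹ᵁ U)
      (((pullbackComp h k).hom.app ((pullback e).obj L)).app (h ⁻¹ᵁ k ⁻¹ᵁ e ⁻¹ᵁ U)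
        (pullbackSection h _ (k ⁻¹ᵁ e ⁻¹ᵁ U) (pullbackSection k _ (e ⁻¹ᵁ U)
          (pullbackSection e L U x)))) =
    (pullbackTrans h (k ≫ e) (h ≫ k ≫ e) rfl L).hom.app (h ⁻¹ᵁ k ⁻¹ᵁ e ⁻¹ᵁ U)
      (((pullback h).map (pullbackTrans k e (k ≫ e) rfl L).hom).app (h ⁻¹ᵁ k ⁻¹ᵁ e ⁻¹ᵁ U)
        (pullbackSection h _ (k ⁻¹ᵁ e ⁻¹ᵁ U) (pullbackSection k _ (e ⁻¹ᵁ U)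
          (pullbackSection e L U x))))
  rw [pullbackComp_hom_section, pullbackSection_naturality]
  refine (pullbackTrans_section (h ≫ k) e _ wf' L U x).trans ?_
  rw [pullbackTrans_section k e _ rfl L U x]
  refine Eq.trans ?_ (congr((pullbackTrans h (k ≫ e) (h ≫ k ≫ e) rfl L).hom.app
    (h ⁻¹ᵁ k ⁻¹ᵁ e ⁻¹ᵁ U) (pullbackSection h _ _
      $(congr($(((pullback (k ≫ e)).obj L).presheaf.map_id _) (pullbackSection (k ≫ e) L U x)))))).symm
  refine Eq.trans ?_ (pullbackTrans_section h (k ≫ e) _ rfl L U x).symm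
  rfl

theorem pullbackTrans_assoc (h : S ⟶ T) (k : T ⟶ W) (e : W ⟶ X) (l : S ⟶ W) (g : T ⟶ X)
    (f : S ⟶ X) (wl : h ≫ k = l) (wg : k ≫ e = g) (wf : h ≫ g = f) (wf' : l ≫ e = f)
    (L : X.Modules) :
    (pullbackTrans h k l wl ((pullback e).obj L)).hom ≫ (pullbackTrans l e f wf' L).hom =
      (pullback h).map (pullbackTrans k e g wg L).hom ≫ (pullbackTrans h g f wf L).hom := by
  subst wl
  rw [← pullbackTrans_comp h k e g f wg wf wf' L, pullbackTrans_rfl_hom]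

theorem tensor_id_aux₁ (M : T.Modules) (r : ℕ) (U : T.Opens) (n : Fin r → Γ(M, U)) :
    (fun i => ((pullbackId T).hom.app M).app U (pullbackSection (𝟙 T) M U (n i))) = n :=
  funext fun i => pullbackId_hom_section M U (n i)

theorem tensor_id_aux₂ {M K : T.Modules} {r : ℕ} (φ : M.tensorPower r ≅ K) (U : T.Opens)
    (n : Fin r → Γ(M, U)) :
    φ.hom.app (𝟙 T ⁻¹ᵁ U) (M.tprod r (𝟙 T ⁻¹ᵁ U) fun i =>
      ((pullbackId T).hom.app M).app (𝟙 T ⁻¹ᵁ U) (pullbackSection (𝟙 T) M U (n i))) =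
    φ.hom.app U (M.tprod r U n) :=
  congr(φ.hom.app U (M.tprod r U $(tensor_id_aux₁ M r U n)))

theorem tensor_id_aux₃ {M K : T.Modules} {r : ℕ} (φ : M.tensorPower r ≅ K) (U : T.Opens)
    (n : Fin r → Γ(M, U)) :
    φ.hom.app U (M.tprod r U n) = ((pullbackId T).hom.app K).app (𝟙 T ⁻¹ᵁ U)
      (pullbackSection (𝟙 T) K U (φ.hom.app U (M.tprod r U n))) :=
  (pullbackId_hom_section K U (φ.hom.app U (M.tprod r U n))).symm

theorem tensor_id_aux₄ {M : T.Modules} {r : ℕ} (f : T ⟶ X) (w : 𝟙 T ≫ f = f) (L : X.Modules)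
    (φ : M.tensorPower r ≅ (pullback f).obj L) (U : T.Opens) (n : Fin r → Γ(M, U)) :
    φ.hom.app (𝟙 T ⁻¹ᵁ U) (M.tprod r (𝟙 T ⁻¹ᵁ U) fun i =>
      ((pullbackId T).hom.app M).app (𝟙 T ⁻¹ᵁ U) (pullbackSection (𝟙 T) M U (n i))) =
    (pullbackTrans (𝟙 T) f f w L).hom.app (𝟙 T ⁻¹ᵁ U)
      (pullbackSection (𝟙 T) _ U (φ.hom.app U (M.tprod r U n))) := by
  rw [pullbackTrans_id]
  exact (tensor_id_aux₂ φ U n).trans (tensor_id_aux₃ φ U n)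

theorem tensor_id {M : T.Modules} {r : ℕ} (f : T ⟶ X) (w : 𝟙 T ≫ f = f) (L : X.Modules)
    (φ : M.tensorPower r ≅ (pullback f).obj L) (U : T.Opens) (n : Fin r → Γ(M, U)) :
    φ.hom.app (𝟙 T ⁻¹ᵁ U) (M.tprod r (𝟙 T ⁻¹ᵁ U) fun i =>
      ((pullbackId T).symm.app M).inv.app (𝟙 T ⁻¹ᵁ U) (pullbackSection (𝟙 T) M U (n i))) =
    (pullbackTrans (𝟙 T) f f w L).hom.app (𝟙 T ⁻¹ᵁ U)
      (pullbackSection (𝟙 T) _ U (φ.hom.app U (M.tprod r U n))) := by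
  rw [Iso.app_inv, Iso.symm_inv]
  exact tensor_id_aux₄ f w L φ U n

theorem comp_inv_app {h : S ⟶ T} {k : T ⟶ W} (F : W.Modules ⥤ S.Modules)
    (α : pullback k ⋙ pullback h ≅ F)
    {M : S.Modules} {N : T.Modules} {P : W.Modules} (ρ : M ≅ (pullback h).obj N)
    (σ : N ≅ (pullback k).obj P) (U : S.Opens) (x : Γ(F.obj P, U)) :
    (ρ ≪≫ (pullback h).mapIso σ ≪≫ α.app P).inv.app U x =
      ρ.inv.app U (((pullback h).map σ.inv).app U ((α.inv.app P).app U x)) := rfl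

theorem comp_inv_section {h : S ⟶ T} {k : T ⟶ W} {M : S.Modules} {N : T.Modules}
    {P : W.Modules} (ρ : M ≅ (pullback h).obj N) (σ : N ≅ (pullback k).obj P) (U : W.Opens)
    (n : Γ(P, U)) :
    (ρ ≪≫ (pullback h).mapIso σ ≪≫ (pullbackComp h k).app P).inv.app (h ⁻¹ᵁ k ⁻¹ᵁ U)
        (pullbackSection (h ≫ k) P U n) =
      ρ.inv.app (h ⁻¹ᵁ k ⁻¹ᵁ U) (pullbackSection h N (k ⁻¹ᵁ U)
        (σ.inv.app (k ⁻¹ᵁ U) (pullbackSection k P U n))) := by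
  have h0 := comp_inv_app _ (pullbackComp h k) ρ σ (h ⁻¹ᵁ k ⁻¹ᵁ U) (pullbackSection (h ≫ k) P U n)
  have h1 := congr(ρ.inv.app (h ⁻¹ᵁ k ⁻¹ᵁ U) (((pullback h).map σ.inv).app (h ⁻¹ᵁ k ⁻¹ᵁ U)
    $(pullbackComp_inv_section h k P U n)))
  have h2 := congr(ρ.inv.app (h ⁻¹ᵁ k ⁻¹ᵁ U)
    $(pullbackSection_naturality h σ.inv (k ⁻¹ᵁ U) (pullbackSection k P U n)))
  exact h0.trans (h1.trans h2)

theorem comp_app_apply {K M N : T.Modules} (a : K ⟶ M) (b : M ⟶ N)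
    (U : T.Opens) (x : Γ(K, U)) : (a ≫ b).app U x = b.app U (a.app U x) := rfl

theorem pullbackTrans_comp_section (h : S ⟶ T) (k : T ⟶ W) (e : W ⟶ X) (g : T ⟶ X) (f : S ⟶ X)
    (wg : k ≫ e = g) (wf : h ≫ g = f) (wf' : (h ≫ k) ≫ e = f) (L : X.Modules) (U : W.Opens)
    (x : Γ((pullback e).obj L, U)) :
    (pullbackTrans (h ≫ k) e f wf' L).hom.app (h ⁻¹ᵁ k ⁻¹ᵁ U) (pullbackSection (h ≫ k) _ U x) =
      (pullbackTrans h g f wf L).hom.app (h ⁻¹ᵁ k ⁻¹ᵁ U) (pullbackSection h _ (k ⁻¹ᵁ U)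
        ((pullbackTrans k e g wg L).hom.app (k ⁻¹ᵁ U) (pullbackSection k _ U x))) := by
  have h0 := congr(($(pullbackTrans_comp h k e g f wg wf wf' L)).app
      (h ⁻¹ᵁ k ⁻¹ᵁ U) (pullbackSection h _ (k ⁻¹ᵁ U) (pullbackSection k _ U x)))
  rw [comp_app_apply, comp_app_apply] at h0
  have h1 := congr((pullbackTrans (h ≫ k) e f wf' L).hom.app (h ⁻¹ᵁ k ⁻¹ᵁ U)
    $(pullbackComp_hom_section h k ((pullback e).obj L) U x))
  have h2 := congr((pullbackTrans h g f wf L).hom.app (h ⁻¹ᵁ k ⁻¹ᵁ U)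
    $(pullbackSection_naturality h (pullbackTrans k e g wg L).hom (k ⁻¹ᵁ U)
      (pullbackSection k _ U x)))
  exact h1.symm.trans (h0.trans h2)

theorem pullbackTrans_assoc_section (h : S ⟶ T) (k : T ⟶ W) (e : W ⟶ X) (l : S ⟶ W) (g : T ⟶ X)
    (f : S ⟶ X) (wl : h ≫ k = l) (wg : k ≫ e = g) (wf : h ≫ g = f) (wf' : l ≫ e = f)
    (L : X.Modules) (U : T.Opens) (x : Γ((pullback k).obj ((pullback e).obj L), U)) :
    (pullbackTrans l e f wf' L).hom.app (h ⁻¹ᵁ U)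
        ((pullbackTrans h k l wl ((pullback e).obj L)).hom.app (h ⁻¹ᵁ U)
          (pullbackSection h _ U x)) =
      (pullbackTrans h g f wf L).hom.app (h ⁻¹ᵁ U) (pullbackSection h _ U
        ((pullbackTrans k e g wg L).hom.app U x)) := by
  have h0 := congr(($(pullbackTrans_assoc h k e l g f wl wg wf wf' L)).app (h ⁻¹ᵁ U)
    (pullbackSection h _ U x))
  rw [comp_app_apply, comp_app_apply] at h0
  have h2 := congr((pullbackTrans h g f wf L).hom.app (h ⁻¹ᵁ U)
    $(pullbackSection_naturality h (pullbackTrans k e g wg L).hom U x))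
  exact h0.trans h2

end AlgebraicGeometry.Scheme.Modules

namespace AlgebraicGeometry

open Scheme.Modules

variable {X : Scheme.{u}} {L : X.Modules} {r : ℕ}

/-- An `r`-th root of `L` over an `X`-scheme `f : T ⟶ X`: a triple `(f, M, φ)` with `M` an invertible
sheaf on `T` and `φ` an isomorphism `M^{⊗ r} ≅ f^* L`. -/
structure RootObj (L : X.Modules) (r : ℕ) : Type (u + 1) where
  /-- The scheme over which the root is defined. -/
  T : Scheme.{u}
  f : T ⟶ X
  M : T.Modules
  isInvertible : M.IsInvertible
  φ : M.tensorPower r ≅ (pullback f).obj L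

/-- Let `φ : M^{⊗ r} ≅ f^* L` and `ψ : N^{⊗ r} ≅ g^* L` with `f = g ∘ h`. An isomorphism
`ρ : M ≅ h^* N` is compatible with `φ` and `ψ` if the composite `h^* N^{⊗ r} → M^{⊗ r} → f^* L`
of `ρ^{-1}` and `φ` is `h^* N^{⊗ r} → h^* g^* L = f^* L`, induced by `ψ`. As `h^* N^{⊗ r}` is
generated by the pull-backs of the local sections `n₁ ⊗ ⋯ ⊗ nᵣ` of `N^{⊗ r}`, this is
an identity between the images of these. -/
def RootCompat {S T X : Scheme.{u}} {L : X.Modules} {r : ℕ} {f : S ⟶ X} {M : S.Modules}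
    (φ : M.tensorPower r ≅ (pullback f).obj L) {g : T ⟶ X} {N : T.Modules}
    (ψ : N.tensorPower r ≅ (pullback g).obj L) (h : S ⟶ T) (w : h ≫ g = f)
    (ρ : M ≅ (pullback h).obj N) : Prop :=
  ∀ (U : T.Opens) (n : Fin r → Γ(N, U)),
    φ.hom.app (h ⁻¹ᵁ U)
        (M.tprod r (h ⁻¹ᵁ U) fun i => ρ.inv.app (h ⁻¹ᵁ U) (pullbackSection h N U (n i))) =
      (pullbackTrans h g f w L).hom.app (h ⁻¹ᵁ U)
        (pullbackSection h _ U (ψ.hom.app U (N.tprod r U n)))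

theorem RootCompat.id {T X : Scheme.{u}} {L : X.Modules} {r : ℕ} {f : T ⟶ X} {M : T.Modules}
    (φ : M.tensorPower r ≅ (pullback f).obj L) (w : 𝟙 T ≫ f = f) :
    RootCompat φ φ (𝟙 T) w ((pullbackId T).symm.app M) :=
  fun U n => tensor_id f w L φ U n

theorem RootCompat.comp {S T W X : Scheme.{u}} {L : X.Modules} {r : ℕ} {f : S ⟶ X} {M : S.Modules}
    {φ : M.tensorPower r ≅ (pullback f).obj L} {g : T ⟶ X} {N : T.Modules}
    {ψ : N.tensorPower r ≅ (pullback g).obj L} {e : W ⟶ X} {P : W.Modules}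
    {χ : P.tensorPower r ≅ (pullback e).obj L} {h : S ⟶ T} {w : h ≫ g = f}
    {ρ : M ≅ (pullback h).obj N} {k : T ⟶ W} {w' : k ≫ e = g} {σ : N ≅ (pullback k).obj P}
    (a : RootCompat φ ψ h w ρ) (b : RootCompat ψ χ k w' σ) (w'' : (h ≫ k) ≫ e = f) :
    RootCompat φ χ (h ≫ k) w'' (ρ ≪≫ (pullback h).mapIso σ ≪≫ (pullbackComp h k).app P) := by
  intro U n
  have h3 := congr(φ.hom.app (h ⁻¹ᵁ k ⁻¹ᵁ U)
      (M.tprod r (h ⁻¹ᵁ k ⁻¹ᵁ U) $(funext fun i => comp_inv_section ρ σ U (n i))))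
  have h1 := a (k ⁻¹ᵁ U) fun i => σ.inv.app (k ⁻¹ᵁ U) (pullbackSection k P U (n i))
  have h4 := congr((pullbackTrans h g f w L).hom.app (h ⁻¹ᵁ k ⁻¹ᵁ U)
    (pullbackSection h _ (k ⁻¹ᵁ U) $(b U n)))
  have h2 := pullbackTrans_comp_section h k e g f w' w w'' L U (χ.hom.app U (P.tprod r U n))
  exact h3.trans (h1.trans (h4.trans h2.symm))

/-- An arrow from `(f, M, φ)` to `(g, N, ψ)`: a morphism `h` with `f = g ∘ h` and an isomorphism
`ρ : M ≅ h^* N` compatible with `φ` and `ψ`. -/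
structure RootHom (A B : RootObj L r) : Type u where
  h : A.T ⟶ B.T
  w : h ≫ B.f = A.f
  ρ : A.M ≅ (pullback h).obj B.M
  comm : RootCompat A.φ B.φ h w ρ

/-- The map `N → h_* M` adjoint to the inverse of `ρ : M ≅ h^* N`. -/
noncomputable def pullInv {S T : Scheme.{u}} {h : S ⟶ T} {M : S.Modules} {N : T.Modules}
    (ρ : M ≅ (pullback h).obj N) (U : T.Opens) (n : Γ(N, U)) : Γ(M, h ⁻¹ᵁ U) :=
  ρ.inv.app (h ⁻¹ᵁ U) (pullbackSection h N U n)

theorem pullInv_ext {S T : Scheme.{u}} {h : S ⟶ T} {M : S.Modules} {N : T.Modules}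
    {ρ ρ' : M ≅ (pullback h).obj N}
    (H : ∀ U n, M.presheaf.map (eqToHom (rfl : h ⁻¹ᵁ U = h ⁻¹ᵁ U)).op (pullInv ρ U n) =
      pullInv ρ' U n) : ρ = ρ' := by
  apply Iso.ext_inv
  apply pullback_hom_ext
  intro U n
  have := H U n
  rw [map_eqToHom_self] at this
  exact this

theorem pullInv_id {T : Scheme.{u}} (M : T.Modules) (U : T.Opens) (n : Γ(M, U)) :
    pullInv ((pullbackId T).symm.app M) U n = n := by
  rw [pullInv, Iso.app_inv, Iso.symm_inv]
  exact pullbackId_hom_section M U n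

theorem pullInv_comp {S T W : Scheme.{u}} {h : S ⟶ T} {k : T ⟶ W} {M : S.Modules} {N : T.Modules}
    {P : W.Modules} (ρ : M ≅ (pullback h).obj N) (σ : N ≅ (pullback k).obj P) (U : W.Opens)
    (n : Γ(P, U)) :
    pullInv (ρ ≪≫ (pullback h).mapIso σ ≪≫ (pullbackComp h k).app P) U n =
      pullInv ρ (k ⁻¹ᵁ U) (pullInv σ U n) :=
  comp_inv_section ρ σ U n

theorem pullInv_smul {S T : Scheme.{u}} {h : S ⟶ T} {M : S.Modules} {N : T.Modules}
    (ρ : M ≅ (pullback h).obj N) (U : T.Opens) (c : Γ(T, U)) (n : Γ(N, U)) :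
    pullInv ρ U (c • n) = h.app U c • pullInv ρ U n :=
  Hom.app_smul ((pullbackPushforwardAdjunction h).unit.app N ≫
    (pushforward h).map ρ.inv) c n

theorem hom_app_eq_iff {S : Scheme.{u}} {M K : S.Modules} (ρ : M ≅ K) (U : S.Opens)
    (m : Γ(M, U)) (k : Γ(K, U)) : ρ.hom.app U m = k ↔ ρ.inv.app U k = m := by
  have h1 := congr(($(ρ.hom_inv_id)).app U m)
  have h2 := congr(($(ρ.inv_hom_id)).app U k)
  rw [comp_app_apply] at h1 h2
  constructor
  · rintro rfl
    exact h1
  · rintro rfl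
    exact h2

theorem pullInv_eq_iff {S T : Scheme.{u}} {h : S ⟶ T} {M : S.Modules} {N : T.Modules}
    (ρ : M ≅ (pullback h).obj N) (t : Γ(M, ⊤)) (u : Γ(N, ⊤)) :
    ρ.hom.app ⊤ t = pullbackSection h N ⊤ u ↔ pullInv ρ ⊤ u = t :=
  hom_app_eq_iff ρ ⊤ t (pullbackSection h N ⊤ u)

namespace RootHom

theorem ext_pull {A B : RootObj L r} {a b : RootHom A B} (hh : a.h = b.h)
    (H : ∀ U n, A.M.presheaf.map (eqToHom (by rw [hh] : b.h ⁻¹ᵁ U = a.h ⁻¹ᵁ U)).op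
      (pullInv a.ρ U n) = pullInv b.ρ U n) : a = b := by
  obtain ⟨h, w, ρ, comm⟩ := a
  obtain ⟨h', w', ρ', comm'⟩ := b
  obtain rfl : h = h' := hh
  obtain rfl : ρ = ρ' := pullInv_ext H
  rfl

/-- The identity arrow. -/
noncomputable def id (A : RootObj L r) : RootHom A A where
  h := 𝟙 A.T
  w := Category.id_comp _
  ρ := (pullbackId A.T).symm.app A.M
  comm := RootCompat.id A.φ (Category.id_comp _)

/-- The composite of `(h, ρ)` and `(k, σ)` is `(k ∘ h, h^* σ ∘ ρ)`. -/
noncomputable def comp {A B C : RootObj L r} (a : RootHom A B) (b : RootHom B C) : RootHom A C where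
  h := a.h ≫ b.h
  w := by rw [Category.assoc, b.w, a.w]
  ρ := a.ρ ≪≫ (pullback a.h).mapIso b.ρ ≪≫ (pullbackComp a.h b.h).app C.M
  comm := RootCompat.comp a.comm b.comm (by rw [Category.assoc, b.w, a.w])

theorem id_pull (A : RootObj L r) (U : A.T.Opens) (n : Γ(A.M, U)) : pullInv (id A).ρ U n = n :=
  pullInv_id A.M U n

theorem comp_pull {A B C : RootObj L r} (a : RootHom A B) (b : RootHom B C) (U : C.T.Opens)
    (n : Γ(C.M, U)) :
    pullInv (a.comp b).ρ U n = pullInv a.ρ (b.h ⁻¹ᵁ U) (pullInv b.ρ U n) :=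
  pullInv_comp a.ρ b.ρ U n

end RootHom

noncomputable instance : Category (RootObj L r) where
  Hom := RootHom
  id := RootHom.id
  comp := RootHom.comp
  id_comp a := RootHom.ext_pull (Category.id_comp _) fun U n => by
    rw [RootHom.comp_pull, RootHom.id_pull]
    exact map_eqToHom_self rfl _
  comp_id a := RootHom.ext_pull (Category.comp_id _) fun U n => by
    rw [RootHom.comp_pull, RootHom.id_pull]
    exact map_eqToHom_self rfl _
  assoc a b c := RootHom.ext_pull (Category.assoc _ _ _) fun U n => by
    rw [RootHom.comp_pull, RootHom.comp_pull, RootHom.comp_pull, RootHom.comp_pull]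
    exact map_eqToHom_self rfl _

end AlgebraicGeometry

namespace AlgebraicGeometry

open Scheme.Modules

variable {X D S₀ : Scheme.{u}}

/-- The gerbe of `r`-th roots of `L` on `X`, as a category over the category of `S₀`-schemes. -/
noncomputable def rootGerbe (π : X ⟶ S₀) (L : X.Modules) (r : ℕ) :
    BasedCategory.{u, u + 1} (Over S₀) where
  obj := RootObj L r
  p :=
    { obj := fun A => Over.mk (A.f ≫ π)
      map := fun {A B} a => Over.homMk (RootHom.h a) (by
        change a.h ≫ B.f ≫ π = A.f ≫ π
        rw [← Category.assoc, a.w])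
      map_id := fun _ => rfl
      map_comp := fun _ _ => rfl }

/-- The section `t` of `M` is an `r`-th root of `s`: `φ (t^{⊗ r}) = f^* s`. -/
def IsRootSection {T : Scheme.{u}} {f : T ⟶ X} {L : X.Modules} {r : ℕ} {M : T.Modules}
    (φ : M.tensorPower r ≅ (pullback f).obj L) (s : Γ(L, ⊤)) (t : Γ(M, ⊤)) : Prop :=
  φ.hom.app ⊤ (M.tprod r ⊤ fun _ => t) = pullbackSection f L ⊤ s

/-- The isomorphism `ρ : M ≅ h^* N` maps the section `t` of `M` to the pull-back of the section `u`
of `N`. -/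
def MapsSection {S T : Scheme.{u}} {h : S ⟶ T} {M : S.Modules} {N : T.Modules}
    (ρ : M ≅ (pullback h).obj N) (t : Γ(M, ⊤)) (u : Γ(N, ⊤)) : Prop :=
  ρ.hom.app ⊤ t = pullbackSection h N ⊤ u

theorem mapsSection_iff {S T : Scheme.{u}} {h : S ⟶ T} {M : S.Modules} {N : T.Modules}
    (ρ : M ≅ (pullback h).obj N) (t : Γ(M, ⊤)) (u : Γ(N, ⊤)) :
    MapsSection ρ t u ↔ pullInv ρ ⊤ u = t :=
  pullInv_eq_iff ρ t u

theorem MapsSection.id {T : Scheme.{u}} (M : T.Modules) (t : Γ(M, ⊤)) :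
    MapsSection ((pullbackId T).symm.app M) t t :=
  (mapsSection_iff _ _ _).2 (pullInv_id M ⊤ t)

theorem MapsSection.comp {S T W : Scheme.{u}} {h : S ⟶ T} {k : T ⟶ W} {M : S.Modules}
    {N : T.Modules} {P : W.Modules} {ρ : M ≅ (pullback h).obj N} {σ : N ≅ (pullback k).obj P}
    {t : Γ(M, ⊤)} {u : Γ(N, ⊤)} {v : Γ(P, ⊤)} (a : MapsSection ρ t u) (b : MapsSection σ u v) :
    MapsSection (ρ ≪≫ (pullback h).mapIso σ ≪≫ (pullbackComp h k).app P) t v := by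
  rw [mapsSection_iff] at a b ⊢
  subst a b
  exact pullInv_comp ρ σ ⊤ v

/-- An object `(f, M, t, φ)` of the root stack: an `r`-th root `(f, M, φ)` of `L` and a global section
`t` of `M` with `φ (t^{⊗ r}) = f^* s`. -/
structure RootStackObj (L : X.Modules) (s : Γ(L, ⊤)) (r : ℕ) extends RootObj L r where
  t : Γ(M, ⊤)
  isRootSection : IsRootSection φ s t

/-- An arrow `(h, ρ)` from `(f, M, t, φ)` to `(g, N, u, ψ)`: an arrow of `r`-th roots of `L` with
`ρ t = h^* u`. -/
structure RootStackHom {L : X.Modules} {s : Γ(L, ⊤)} {r : ℕ} (A B : RootStackObj L s r) where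
  hom : RootHom A.toRootObj B.toRootObj
  mapsSection : MapsSection hom.ρ A.t B.t

theorem RootStackHom.ext {L : X.Modules} {s : Γ(L, ⊤)} {r : ℕ} {A B : RootStackObj L s r}
    {a b : RootStackHom A B} (h : a.hom = b.hom) : a = b := by
  obtain ⟨a, _⟩ := a
  obtain ⟨b, _⟩ := b
  obtain rfl : a = b := h
  rfl

/-- The identity arrow. -/
noncomputable def RootStackHom.id {L : X.Modules} {s : Γ(L, ⊤)} {r : ℕ} (A : RootStackObj L s r) :
    RootStackHom A A where
  hom := RootHom.id A.toRootObj
  mapsSection := MapsSection.id A.M A.t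

/-- The composition of arrows. -/
noncomputable def RootStackHom.comp {L : X.Modules} {s : Γ(L, ⊤)} {r : ℕ}
    {A B C : RootStackObj L s r} (a : RootStackHom A B) (b : RootStackHom B C) :
    RootStackHom A C where
  hom := RootHom.comp a.hom b.hom
  mapsSection := MapsSection.comp a.mapsSection b.mapsSection

noncomputable instance {L : X.Modules} {s : Γ(L, ⊤)} {r : ℕ} : Category (RootStackObj L s r) where
  Hom := RootStackHom
  id := RootStackHom.id
  comp := RootStackHom.comp
  id_comp {A B} a := RootStackHom.ext
    (Category.id_comp (X := A.toRootObj) (Y := B.toRootObj) a.hom)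
  comp_id {A B} a := RootStackHom.ext
    (Category.comp_id (X := A.toRootObj) (Y := B.toRootObj) a.hom)
  assoc {A B C D} a b c := RootStackHom.ext (Category.assoc (W := A.toRootObj) (X := B.toRootObj)
    (Y := C.toRootObj) (Z := D.toRootObj) a.hom b.hom c.hom)

/-- The stack of `r`-th roots of `(L, s)`, as a category over the category of `S₀`-schemes. -/
noncomputable def rootStack (π : X ⟶ S₀) (L : X.Modules) (s : Γ(L, ⊤)) (r : ℕ) :
    BasedCategory.{u, u + 1} (Over S₀) where
  obj := RootStackObj L s r
  p :=
    { obj := fun A => Over.mk (A.f ≫ π)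
      map := fun {A B} a => Over.homMk (RootStackHom.hom a).h (by
        change (RootStackHom.hom a).h ≫ B.f ≫ π = A.f ≫ π
        rw [← Category.assoc, (RootStackHom.hom a).w])
      map_id := fun _ => rfl
      map_comp := fun _ _ => rfl }

/-- The ideal of the zero locus of `s`: the smallest ideal sheaf `I` such that `s` vanishes on the
closed subscheme defined by `I`. -/
noncomputable def zeroLocusIdeal (L : X.Modules) (s : Γ(L, ⊤)) : X.IdealSheafData :=
  sInf {I | pullbackSection I.subschemeι L ⊤ s = 0}

/-- The zero locus of `s`, the largest closed subscheme of `X` on which `s` vanishes. -/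
noncomputable def zeroLocus (L : X.Modules) (s : Γ(L, ⊤)) : Scheme.{u} :=
  (zeroLocusIdeal L s).subscheme

/-- The closed immersion of the zero locus. -/
noncomputable def zeroLocusι (L : X.Modules) (s : Γ(L, ⊤)) : zeroLocus L s ⟶ X :=
  (zeroLocusIdeal L s).subschemeι

section Inclusion

variable (π : X ⟶ S₀) (i : D ⟶ X) {L : X.Modules} {s : Γ(L, ⊤)} {r : ℕ}

theorem tprod_zero [NeZero r] {T : Scheme.{u}} (M : T.Modules) (U : T.Opens) :
    (M.tprod r U fun _ => (0 : Γ(M, U))) = 0 :=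
  (M.tprod r U).map_coord_zero (0 : Fin r) rfl

theorem pullbackSection_comp_zero {T : Scheme.{u}} (f : T ⟶ D)
    (hs : pullbackSection i L ⊤ s = 0) : pullbackSection (f ≫ i) L ⊤ s = 0 := by
  have h := pullbackComp_hom_section f i L ⊤ s
  rw [hs] at h
  refine h.symm.trans ?_
  have h2 : pullbackSection f ((pullback i).obj L) ⊤ 0 = 0 := map_zero _
  exact congr(((pullbackComp f i).hom.app L).app ⊤ $h2).trans (map_zero _)

theorem isRootSection_zero [NeZero r] {T : Scheme.{u}} {f : T ⟶ X} {M : T.Modules}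
    (φ : M.tensorPower r ≅ (pullback f).obj L) (hs : pullbackSection f L ⊤ s = 0) :
    IsRootSection φ s 0 :=
  (congr(φ.hom.app ⊤ $(tprod_zero M ⊤)).trans (map_zero _)).trans hs.symm

theorem mapsSection_zero {S T : Scheme.{u}} {h : S ⟶ T} {M : S.Modules} {N : T.Modules}
    (ρ : M ≅ (pullback h).obj N) : MapsSection ρ 0 0 :=
  (map_zero _).trans (map_zero (pullbackSection h N ⊤).hom).symm

theorem trans_app_apply {S : Scheme.{u}} {M K N : S.Modules} (a : M ≅ K) (b : K ≅ N) (U : S.Opens)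
    (m : Γ(M, U)) : (a ≪≫ b).hom.app U m = b.hom.app U (a.hom.app U m) := rfl

theorem RootCompat.trans {S T : Scheme.{u}} {f : S ⟶ D} {M : S.Modules}
    {φ : M.tensorPower r ≅ (pullback f).obj ((pullback i).obj L)} {g : T ⟶ D} {N : T.Modules}
    {ψ : N.tensorPower r ≅ (pullback g).obj ((pullback i).obj L)} {h : S ⟶ T} {w : h ≫ g = f}
    {ρ : M ≅ (pullback h).obj N} (a : RootCompat φ ψ h w ρ) (w' : h ≫ g ≫ i = f ≫ i) :
    RootCompat (φ ≪≫ pullbackTrans f i (f ≫ i) rfl L) (ψ ≪≫ pullbackTrans g i (g ≫ i) rfl L)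
      h w' ρ := by
  intro U n
  have h1 := congr((pullbackTrans f i (f ≫ i) rfl L).hom.app (h ⁻¹ᵁ U) $(a U n))
  rw [trans_app_apply, trans_app_apply]
  have h2 := pullbackTrans_assoc_section h g i f (g ≫ i) (f ≫ i) w rfl w' rfl L U
    (ψ.hom.app U (N.tprod r U n))
  exact h1.trans h2

variable [NeZero r]

/-- If `s` vanishes on `i : D ⟶ X`, an `r`-th root `(g, M, φ)` of `L|_D` gives the object
`(i ∘ g, M, 0, φ)` of the root stack. -/
noncomputable def gerbeInclusionObj (hs : pullbackSection i L ⊤ s = 0)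
    (A : RootObj ((pullback i).obj L) r) : RootStackObj L s r where
  T := A.T
  f := A.f ≫ i
  M := A.M
  isInvertible := A.isInvertible
  φ := A.φ ≪≫ pullbackTrans A.f i (A.f ≫ i) rfl L
  t := 0
  isRootSection := isRootSection_zero _ (pullbackSection_comp_zero i A.f hs)

/-- The arrow `(h, ρ)` between the images of two `r`-th roots of `L|_D`. -/
noncomputable def gerbeInclusionHom (hs : pullbackSection i L ⊤ s = 0)
    {A B : RootObj ((pullback i).obj L) r} (a : RootHom A B) :
    RootStackHom (gerbeInclusionObj i hs A) (gerbeInclusionObj i hs B) where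
  hom :=
    { h := a.h
      w := by
        change a.h ≫ B.f ≫ i = A.f ≫ i
        rw [← Category.assoc, a.w]
      ρ := a.ρ
      comm := RootCompat.trans i a.comm (by rw [← Category.assoc, a.w]) }
  mapsSection := mapsSection_zero a.ρ

theorem gerbeInclusionHom_id (hs : pullbackSection i L ⊤ s = 0)
    (A : RootObj ((pullback i).obj L) r) :
    gerbeInclusionHom i hs (RootHom.id A) = RootStackHom.id (gerbeInclusionObj i hs A) := by
  obtain ⟨T, f, M, inv, φ⟩ := A
  rfl

theorem gerbeInclusionHom_comp (hs : pullbackSection i L ⊤ s = 0)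
    {A B C : RootObj ((pullback i).obj L) r} (a : RootHom A B) (b : RootHom B C) :
    gerbeInclusionHom i hs (a.comp b) =
      (gerbeInclusionHom i hs a).comp (gerbeInclusionHom i hs b) := by
  obtain ⟨T, f, M, inv, φ⟩ := A
  obtain ⟨T', f', M', inv', φ'⟩ := B
  obtain ⟨T'', f'', M'', inv'', φ''⟩ := C
  obtain ⟨h, w, ρ, comm⟩ := a
  obtain ⟨h', w', ρ', comm'⟩ := b
  rfl

theorem overMk_congr {T : Scheme.{u}} {a b : T ⟶ S₀} (h : a = b) : Over.mk a = Over.mk b := by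
  rw [h]

theorem overHomMk_congr {T T' : Scheme.{u}} {a b : T ⟶ S₀} {a' b' : T' ⟶ S₀} (h : a = b)
    (h' : a' = b') (k : T ⟶ T') (w : k ≫ a' = a) (w' : k ≫ b' = b) :
    (Over.homMk k w : Over.mk a ⟶ Over.mk a') =
      eqToHom (overMk_congr h) ≫ (Over.homMk k w' : Over.mk b ⟶ Over.mk b') ≫
        eqToHom (overMk_congr h').symm := by
  subst h h'
  rw [eqToHom_refl, eqToHom_refl, Category.comp_id, Category.id_comp]

theorem gerbeInclusion_aux (hs : pullbackSection i L ⊤ s = 0)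
    {A B : RootObj ((pullback i).obj L) r} (a : RootHom A B) :
    (rootStack π L s r).p.map (gerbeInclusionHom i hs a : gerbeInclusionObj i hs A ⟶
        gerbeInclusionObj i hs B) =
      eqToHom (overMk_congr (Category.assoc A.f i π)) ≫
        (rootGerbe (i ≫ π) ((pullback i).obj L) r).p.map (a : A ⟶ B) ≫
        eqToHom (overMk_congr (Category.assoc B.f i π)).symm := by
  have w : a.h ≫ B.f ≫ i ≫ π = A.f ≫ i ≫ π := by rw [← Category.assoc, a.w]
  have w' : a.h ≫ (B.f ≫ i) ≫ π = (A.f ≫ i) ≫ π := by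
    rw [Category.assoc, w, Category.assoc]
  exact overHomMk_congr (Category.assoc A.f i π) (Category.assoc B.f i π) a.h w' w

/-- The functor `(g, M, φ) ↦ (i ∘ g, M, 0, φ)`. -/
noncomputable def gerbeInclusion (hs : pullbackSection i L ⊤ s = 0) :
    rootGerbe (i ≫ π) ((pullback i).obj L) r ⥤ᵇ rootStack π L s r where
  obj A := gerbeInclusionObj i hs A
  map a := gerbeInclusionHom i hs a
  map_id A := gerbeInclusionHom_id i hs A
  map_comp a b := gerbeInclusionHom_comp i hs a b
  w := by
    refine CategoryTheory.Functor.ext (fun A => overMk_congr (Category.assoc A.f i π)) ?_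
    intro A B a
    exact gerbeInclusion_aux π i hs a

end Inclusion

end AlgebraicGeometry

namespace CategoryTheory

variable {𝒮 : Type (u + 1)} [Category.{u} 𝒮]

/-- An object of the inertia stack of `𝒳` over `S`: an object `x` of `𝒳` over `S` and an arrow `ν` from
`x` to `x` over the identity of `S`. -/
structure InertiaObj (𝒳 : BasedCategory.{u, u + 1} 𝒮) : Type (u + 1) where
  x : 𝒳.obj
  ν : x ⟶ x
  map_ν : 𝒳.p.map ν = 𝟙 (𝒳.p.obj x)

/-- An arrow from `(x, ν)` to `(x₁, ν₁)`: an arrow `u` from `x` to `x₁` with `ν₁ ∘ u = u ∘ ν`. -/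
structure InertiaHom {𝒳 : BasedCategory.{u, u + 1} 𝒮} (A B : InertiaObj 𝒳) : Type u where
  u : A.x ⟶ B.x
  comm : u ≫ B.ν = A.ν ≫ u

theorem InertiaHom.ext {𝒳 : BasedCategory.{u, u + 1} 𝒮} {A B : InertiaObj 𝒳}
    {a b : InertiaHom A B} (h : a.u = b.u) : a = b := by
  obtain ⟨a, _⟩ := a
  obtain ⟨b, _⟩ := b
  obtain rfl : a = b := h
  rfl

instance (𝒳 : BasedCategory.{u, u + 1} 𝒮) : Category (InertiaObj 𝒳) where
  Hom := InertiaHom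
  id A := ⟨𝟙 A.x, by rw [Category.id_comp, Category.comp_id]⟩
  comp a b := ⟨InertiaHom.u a ≫ InertiaHom.u b, by
    rw [Category.assoc, InertiaHom.comm b, ← Category.assoc, InertiaHom.comm a, Category.assoc]⟩
  id_comp a := InertiaHom.ext (Category.id_comp _)
  comp_id a := InertiaHom.ext (Category.comp_id _)
  assoc a b c := InertiaHom.ext (Category.assoc _ _ _)

/-- The inertia stack of `𝒳`. -/
def inertia (𝒳 : BasedCategory.{u, u + 1} 𝒮) : BasedCategory.{u, u + 1} 𝒮 where
  obj := InertiaObj 𝒳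
  p :=
    { obj := fun A => 𝒳.p.obj A.x
      map := fun a => 𝒳.p.map (InertiaHom.u a)
      map_id := fun A => 𝒳.p.map_id A.x
      map_comp := fun a b => 𝒳.p.map_comp (InertiaHom.u a) (InertiaHom.u b) }

/-- The canonical section `x ↦ (x, id)`. -/
def inertiaUnit (𝒳 : BasedCategory.{u, u + 1} 𝒮) : 𝒳 ⥤ᵇ inertia 𝒳 where
  obj x := ⟨x, 𝟙 x, 𝒳.p.map_id x⟩
  map a := ⟨a, by rw [Category.id_comp, Category.comp_id]⟩
  map_id _ := rfl
  map_comp _ _ := rfl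
  w := rfl

/-- An object over `S` of the coproduct of the stacks `F i`: a decomposition of `S` as the disjoint
union of objects `S i` of the base category, and for each `i` an object of `F i` over `S i`. -/
structure StackCoprodObj {ι : Type u} (F : ι → BasedCategory.{u, u + 1} 𝒮) : Type (u + 1) where
  base : 𝒮
  x : ∀ i, (F i).obj
  j : ∀ i, (F i).p.obj (x i) ⟶ base
  isColimit : Nonempty (Limits.IsColimit (Limits.Cofan.mk base j))

/-- An arrow of the coproduct over `h : S ⟶ S₁`: for each `i`, an arrow of `F i` over a morphism from
the `i`-th piece of `S` to the `i`-th piece of `S₁` which is the restriction of `h`. -/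
structure StackCoprodHom {ι : Type u} {F : ι → BasedCategory.{u, u + 1} 𝒮} (A B : StackCoprodObj F) :
    Type u where
  h : A.base ⟶ B.base
  φ : ∀ i, A.x i ⟶ B.x i
  comm : ∀ i, (F i).p.map (φ i) ≫ B.j i = A.j i ≫ h

theorem StackCoprodHom.ext {ι : Type u} {F : ι → BasedCategory.{u, u + 1} 𝒮} {A B : StackCoprodObj F}
    {a b : StackCoprodHom A B} (h : a.h = b.h) (h' : a.φ = b.φ) : a = b := by
  obtain ⟨a, a', _⟩ := a
  obtain ⟨b, b', _⟩ := b
  obtain rfl : a = b := h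
  obtain rfl : a' = b' := h'
  rfl

instance {ι : Type u} (F : ι → BasedCategory.{u, u + 1} 𝒮) : Category (StackCoprodObj F) where
  Hom := StackCoprodHom
  id A := ⟨𝟙 A.base, fun i => 𝟙 (A.x i), fun i => by
    rw [CategoryTheory.Functor.map_id, Category.id_comp, Category.comp_id]⟩
  comp a b := ⟨StackCoprodHom.h a ≫ StackCoprodHom.h b, fun i => StackCoprodHom.φ a i ≫ StackCoprodHom.φ b i,
    fun i => by
      rw [Functor.map_comp, Category.assoc, StackCoprodHom.comm b i, ← Category.assoc,
        StackCoprodHom.comm a i, Category.assoc]⟩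
  id_comp a := StackCoprodHom.ext (Category.id_comp _) (funext fun _ => Category.id_comp _)
  comp_id a := StackCoprodHom.ext (Category.comp_id _) (funext fun _ => Category.comp_id _)
  assoc a b c := StackCoprodHom.ext (Category.assoc _ _ _) (funext fun _ => Category.assoc _ _ _)

/-- The coproduct of a family of stacks, in the sense of stacks: for `S` disconnected, different
pieces of `S` may map to different members of the family. -/
def stackCoprod {ι : Type u} (F : ι → BasedCategory.{u, u + 1} 𝒮) : BasedCategory.{u, u + 1} 𝒮 where
  obj := StackCoprodObj F
  p :=
    { obj := fun A => A.base
      map := fun a => StackCoprodHom.h a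
      map_id := fun _ => rfl
      map_comp := fun _ _ => rfl }

/-- The functor taking an object of the coproduct to its `i`-th piece. -/
def stackCoprodPiece {ι : Type u} (F : ι → BasedCategory.{u, u + 1} 𝒮) (i : ι) :
    (stackCoprod F).obj ⥤ (F i).obj where
  obj A := A.x i
  map a := StackCoprodHom.φ a i
  map_id _ := rfl
  map_comp _ _ := rfl

/-- `E` is an equivalence of categories over `𝒮`. -/
def IsEquivalenceOver {𝒳 𝒴 : BasedCategory.{u, u + 1} 𝒮} (E : 𝒳 ⥤ᵇ 𝒴) : Prop :=
  ∃ G : 𝒴 ⥤ᵇ 𝒳, Nonempty (BasedFunctor.comp E G ≅ BasedFunctor.id 𝒳) ∧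
    Nonempty (BasedFunctor.comp G E ≅ BasedFunctor.id 𝒴)

/-- The functor `E` on the coproduct is given by `c i` on the `i`-th member of the family: for an object
`A` over `S` with pieces `A.x i` over `S i`, the restriction of `E A` to `S i` is `c i (A.x i)`,
naturally in `A`. -/
def RestrictsTo {ι : Type u} {F : ι → BasedCategory.{u, u + 1} 𝒮} {𝒴 : BasedCategory.{u, u + 1} 𝒮}
    (E : stackCoprod F ⥤ᵇ 𝒴) (c : ∀ i, F i ⥤ᵇ 𝒴) : Prop :=
  ∀ i, ∃ α : stackCoprodPiece F i ⋙ (c i).toFunctor ⟶ E.toFunctor,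
    ∀ A : StackCoprodObj F, 𝒴.p.IsHomLift (A.j i) (α.app A)

end CategoryTheory

namespace AlgebraicGeometry

open Scheme.Modules

variable {X D S₀ : Scheme.{u}}

theorem pullInv_smulIso {T : Scheme.{u}} (M : T.Modules) (z : Γ(T, ⊤)ˣ) (U : T.Opens)
    (n : Γ(M, U)) :
    pullInv (M.smulIso z ≪≫ (pullbackId T).symm.app M) U n =
      T.presheaf.map (homOfLE (le_top : U ≤ ⊤)).op (↑z⁻¹ : Γ(T, ⊤)) • n := by
  have h := smulHom_app M (↑z⁻¹ : Γ(T, ⊤)) U n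
  have h2 := congr((M.smulHom ↑z⁻¹).app U $(pullInv_id M U n))
  exact h2.trans h

theorem tprod_smul {T : Scheme.{u}} {r : ℕ} (M : T.Modules) (U : T.Opens) (c : Γ(T, U))
    (n : Fin r → Γ(M, U)) :
    M.tprod r U (fun i => c • n i) = c ^ r • M.tprod r U n := by
  rw [(M.tprod r U).map_smul_univ (fun _ => c) n]
  simp

theorem RootCompat.scalar {T : Scheme.{u}} {L : X.Modules} {r : ℕ} {f : T ⟶ X} {M : T.Modules}
    (φ : M.tensorPower r ≅ (pullback f).obj L) (w : 𝟙 T ≫ f = f) (z : Γ(T, ⊤)ˣ)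
    (hz : z ^ r = 1) :
    RootCompat φ φ (𝟙 T) w (M.smulIso z ≪≫ (pullbackId T).symm.app M) := by
  intro U n
  have h0 := congr(φ.hom.app U (M.tprod r U $(funext fun i => pullInv_smulIso M z U (n i))))
  have h1 : (T.presheaf.map (homOfLE (le_top : U ≤ ⊤)).op (↑z⁻¹ : Γ(T, ⊤))) ^ r = 1 := by
    rw [← map_pow, ← Units.val_pow_eq_pow_val, inv_pow, hz, inv_one, Units.val_one, map_one]
  have h2 := congr(φ.hom.app U $(tprod_smul M U
    (T.presheaf.map (homOfLE (le_top : U ≤ ⊤)).op (↑z⁻¹ : Γ(T, ⊤))) n))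
  rw [h1, one_smul] at h2
  have h3 := congr(φ.hom.app U (M.tprod r U $(funext fun i => pullInv_id M U (n i))))
  exact h0.trans (h2.trans (h3.symm.trans (RootCompat.id φ w U n)))

/-- Multiplication by an `r`-th root of unity `z` on `M`, as an automorphism of `(f, M, φ)`. -/
noncomputable def RootHom.scalar {L : X.Modules} {r : ℕ} (A : RootObj L r) (z : Γ(A.T, ⊤)ˣ)
    (hz : z ^ r = 1) : RootHom A A where
  h := 𝟙 A.T
  w := Category.id_comp A.f
  ρ := A.M.smulIso z ≪≫ (pullbackId A.T).symm.app A.M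
  comm := RootCompat.scalar A.φ (Category.id_comp A.f) z hz

/-- The pull-back to `T` of an `r`-th root of unity on `S₀`. -/
noncomputable def pullbackRoot {T : Scheme.{u}} {r : ℕ} (q : T ⟶ S₀)
    (ζ : rootsOfUnity r Γ(S₀, ⊤)) : Γ(T, ⊤)ˣ :=
  Units.map q.appTop.hom.toMonoidHom (ζ : Γ(S₀, ⊤)ˣ)

theorem pullbackRoot_pow {T : Scheme.{u}} {r : ℕ} (q : T ⟶ S₀) (ζ : rootsOfUnity r Γ(S₀, ⊤)) :
    pullbackRoot q ζ ^ r = 1 := by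
  have h : (ζ : Γ(S₀, ⊤)ˣ) ^ r = 1 := ζ.2
  rw [pullbackRoot, ← map_pow, h, map_one]

theorem pullbackRoot_comp {S T : Scheme.{u}} {r : ℕ} (h : S ⟶ T) (q : T ⟶ S₀) (q' : S ⟶ S₀)
    (w : h ≫ q = q') (ζ : rootsOfUnity r Γ(S₀, ⊤)) (U : T.Opens) :
    h.app U (T.presheaf.map (homOfLE (le_top : U ≤ ⊤)).op
      (↑(pullbackRoot q ζ)⁻¹ : Γ(T, ⊤))) =
    S.presheaf.map (homOfLE (le_top : h ⁻¹ᵁ U ≤ ⊤)).op (↑(pullbackRoot q' ζ)⁻¹ : Γ(S, ⊤)) := by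
  subst w
  have h1 : (↑(pullbackRoot q ζ)⁻¹ : Γ(T, ⊤)) = q.appTop (↑(ζ : Γ(S₀, ⊤)ˣ)⁻¹ : Γ(S₀, ⊤)) := by
    rw [pullbackRoot, ← map_inv]
    rfl
  have h2 : (↑(pullbackRoot (h ≫ q) ζ)⁻¹ : Γ(S, ⊤)) =
      h.appTop (q.appTop (↑(ζ : Γ(S₀, ⊤)ˣ)⁻¹ : Γ(S₀, ⊤))) := by
    rw [pullbackRoot, ← map_inv]
    change (h ≫ q).appTop _ = _
    rw [Scheme.Hom.comp_appTop]
    rfl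
  rw [h1, h2]
  exact congr($(h.naturality (homOfLE (le_top : U ≤ ⊤)).op) _)

theorem pullInv_scalar_comm {S T : Scheme.{u}} {M : S.Modules} {N : T.Modules} {h : S ⟶ T}
    (ρ : M ≅ (pullback h).obj N) (z : Γ(S, ⊤)ˣ) (z' : Γ(T, ⊤)ˣ)
    (hz : ∀ U : T.Opens, h.app U (T.presheaf.map (homOfLE (le_top : U ≤ ⊤)).op
      (↑z'⁻¹ : Γ(T, ⊤))) =
    S.presheaf.map (homOfLE (le_top : h ⁻¹ᵁ U ≤ ⊤)).op (↑z⁻¹ : Γ(S, ⊤))) (U : T.Opens)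
    (n : Γ(N, U)) :
    pullInv ρ U (pullInv (N.smulIso z' ≪≫ (pullbackId T).symm.app N) U n) =
      pullInv (M.smulIso z ≪≫ (pullbackId S).symm.app M) (h ⁻¹ᵁ U) (pullInv ρ U n) := by
  have h1 := congr(pullInv ρ U $(pullInv_smulIso N z' U n))
  rw [pullInv_smul, hz] at h1
  exact h1.trans (pullInv_smulIso M z (h ⁻¹ᵁ U) (pullInv ρ U n)).symm

theorem RootHom.scalar_comm {L : X.Modules} {r : ℕ} {A B : RootObj L r} (a : RootHom A B)
    (z : Γ(A.T, ⊤)ˣ) (z' : Γ(B.T, ⊤)ˣ) (hz : z ^ r = 1) (hz' : z' ^ r = 1)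
    (hzz : ∀ U : B.T.Opens, a.h.app U (B.T.presheaf.map (homOfLE (le_top : U ≤ ⊤)).op
      (↑z'⁻¹ : Γ(B.T, ⊤))) =
    A.T.presheaf.map (homOfLE (le_top : a.h ⁻¹ᵁ U ≤ ⊤)).op (↑z⁻¹ : Γ(A.T, ⊤))) :
    a.comp (RootHom.scalar B z' hz') = (RootHom.scalar A z hz).comp a := by
  refine RootHom.ext_pull ((Category.comp_id a.h).trans (Category.id_comp a.h).symm) fun U n => ?_
  rw [RootHom.comp_pull, RootHom.comp_pull]
  refine (map_eqToHom_self rfl _).trans ?_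
  exact pullInv_scalar_comm a.ρ z z' hzz U n

section Inclusion

variable (π : X ⟶ S₀) (i : D ⟶ X) {L : X.Modules} {s : Γ(L, ⊤)} {r : ℕ} [NeZero r]

/-- Multiplication by `ζ ∈ μ_r(S₀)` on `M`, as an automorphism of `(i ∘ g, M, 0, φ)`. -/
noncomputable def gerbeInclusionScalar (hs : pullbackSection i L ⊤ s = 0)
    (ζ : rootsOfUnity r Γ(S₀, ⊤)) (A : RootObj ((pullback i).obj L) r) :
    RootStackHom (gerbeInclusionObj i hs A) (gerbeInclusionObj i hs A) where
  hom := RootHom.scalar (gerbeInclusionObj i hs A).toRootObj (pullbackRoot (A.f ≫ i ≫ π) ζ)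
    (pullbackRoot_pow (A.f ≫ i ≫ π) ζ)
  mapsSection := mapsSection_zero (A.M.smulIso _ ≪≫ (pullbackId A.T).symm.app A.M)

theorem gerbeInclusionScalar_comm (hs : pullbackSection i L ⊤ s = 0)
    (ζ : rootsOfUnity r Γ(S₀, ⊤)) {A B : RootObj ((pullback i).obj L) r} (a : RootHom A B) :
    (gerbeInclusionHom i hs a).comp (gerbeInclusionScalar π i hs ζ B) =
      (gerbeInclusionScalar π i hs ζ A).comp (gerbeInclusionHom i hs a) :=
  RootStackHom.ext (RootHom.scalar_comm (gerbeInclusionHom i hs a).hom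
    (pullbackRoot (A.f ≫ i ≫ π) ζ) (pullbackRoot (B.f ≫ i ≫ π) ζ) (pullbackRoot_pow _ ζ)
    (pullbackRoot_pow _ ζ) fun U =>
    pullbackRoot_comp a.h (B.f ≫ i ≫ π) (A.f ≫ i ≫ π) (by rw [← Category.assoc, a.w]) ζ U)

/-- The functor `(g, M, φ) ↦ ((i ∘ g, M, 0, φ), ζ)`. -/
noncomputable def gerbeToInertia (hs : pullbackSection i L ⊤ s = 0)
    (ζ : rootsOfUnity r Γ(S₀, ⊤)) :
    rootGerbe (i ≫ π) ((pullback i).obj L) r ⥤ᵇ inertia (rootStack π L s r) where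
  obj A := ⟨gerbeInclusionObj i hs A, gerbeInclusionScalar π i hs ζ A, rfl⟩
  map a := ⟨gerbeInclusionHom i hs a, gerbeInclusionScalar_comm π i hs ζ a⟩
  map_id A := InertiaHom.ext (gerbeInclusionHom_id i hs A)
  map_comp a b := InertiaHom.ext (gerbeInclusionHom_comp i hs a b)
  w := (gerbeInclusion π i hs).w

end Inclusion

/-- The scheme `Spec ℤ[r⁻¹](μ_r)`: the ring is `ℤ[ζ]` with `r` inverted, for `ζ` a primitive `r`-th root
of unity in the `r`-th cyclotomic field. -/
noncomputable def baseScheme (r : ℕ) [NeZero r] : Scheme.{u} :=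
  Spec (.of (ULift.{u} (Localization.Away (r : CyclotomicRing r ℤ ℚ))))

variable {r : ℕ} [NeZero r]

/-- The index set: `none` stands for the root stack itself, the other elements are the `ζ ≠ 1` in
`μ_r(S₀)`. -/
abbrev PieceIndex (r : ℕ) [NeZero r] : Type u :=
  Option {ζ : rootsOfUnity r Γ(baseScheme.{u} r, ⊤) // ζ ≠ 1}

/-- The family consisting of one copy of the root stack and, for each `ζ ≠ 1` in `μ_r(S₀)`, a copy of
the gerbe of `r`-th roots of the restriction of `L` to the zero locus of `s`. -/
noncomputable def piece (π : X ⟶ baseScheme r) (L : X.Modules) (s : Γ(L, ⊤)) :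
    PieceIndex.{u} r → BasedCategory.{u, u + 1} (Over (baseScheme.{u} r))
  | none => rootStack π L s r
  | some _ => rootGerbe (zeroLocusι L s ≫ π) ((pullback (zeroLocusι L s)).obj L) r

/-- The canonical functors to the inertia stack: `x ↦ (x, id)` on the root stack, and
`(g, M, φ) ↦ ((i ∘ g, M, 0, φ), ζ)` on the copy of the gerbe with index `ζ`. -/
noncomputable def pieceToInertia (π : X ⟶ baseScheme r) (L : X.Modules) (s : Γ(L, ⊤))
    (hD : pullbackSection (zeroLocusι L s) L ⊤ s = 0) :
    ∀ k : PieceIndex.{u} r, piece π L s k ⥤ᵇ inertia (rootStack π L s r)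
  | none => inertiaUnit (rootStack π L s r)
  | some ζ => gerbeToInertia π (zeroLocusι L s) hD ζ.1

end AlgebraicGeometry

/-!
An arrow between roots is determined by its effect on local generators of the invertible sheaves,
so the argument is carried out with sections: `Scheme.Modules.IsGenerator` replaces
trivializations.

Let `(f, M, t, φ)` be an object of the root stack over `T` and `ν` an automorphism of it over the
identity. On a local generator of `M` it is multiplication by a function `c`, and the
compatibility with `φ` gives `c ^ r = 1` (`RootObj.exists_scalar`). As `r` is invertible and
`X ^ r - 1` splits over `S₀`, such a `c` is locally one of the finitely many roots of unity of `S₀`,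
and the difference of two of these is a unit. Hence `T` is the disjoint union of open subschemes
`T_ζ` on which `ν` is multiplication by `ζ` (`RootObj.exists_decomposition`).

On `T_1` the automorphism is the identity, so this piece comes from the root stack. On `T_ζ` with
`ζ ≠ 1`, the condition `ν t = t` reads `(1 - ζ) t = 0`, and `1 - ζ` is a unit, so `t = 0`
(`eq_zero_of_scalar`). Then `f^* s = φ (t ^ r) = 0` and `f` factors through the zero locus of `s`
(`exists_zeroLocus_lift`), so this piece comes from the gerbe. On a noetherian scheme the zero
locus is well behaved because it can be cut out by a finite intersection of kernels of
quasi-compact morphisms (`exists_zeroLocus_ideal`).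

Arrows of the inertia stack commute with the automorphisms and therefore respect the `T_ζ`
(`inertia_existsUnique_piece`). Conversely, objects and arrows over the pieces of a disjoint union
can be glued (`RootStackObj.exists_glue`, `RootStackHom.exists_glue`); the glued invertible sheaf
is the product of the direct images. These facts form `isStackDecomposition_pieceToInertia`, and
`IsStackDecomposition.exists_equivalence` deduces the equivalence from them formally.
-/

/-! ### Sections of sheaves of modules -/

namespace AlgebraicGeometry.Scheme

variable {X Y : Scheme.{u}}

/-- Restriction of functions from `U` to `V ≤ U`. -/
noncomputable def res (X : Scheme.{u}) {V U : X.Opens} (h : V ≤ U) : Γ(X, U) →+* Γ(X, V) :=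
  (X.presheaf.map (homOfLE h).op).hom

theorem res_res {W V U : X.Opens} (h : V ≤ U) (h' : W ≤ V) (a : Γ(X, U)) :
    X.res h' (X.res h a) = X.res (h'.trans h) a :=
  congr($(X.presheaf.map_comp (homOfLE h).op (homOfLE h').op) a).symm

theorem res_self {U : X.Opens} (h : U ≤ U) (a : Γ(X, U)) : X.res h a = a :=
  congr($(X.presheaf.map_id (op U)) a)

theorem Hom.app_res (f : X ⟶ Y) {V U : Y.Opens} (h : V ≤ U) (a : Γ(Y, U)) :
    f.app V (Y.res h a) = X.res (f.preimage_mono h) (f.app U a) :=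
  congr($(f.naturality (homOfLE h).op) a)

theorem eq_of_locally_eq {U : X.Opens} {a b : Γ(X, U)}
    (H : ∀ p ∈ U, ∃ (V : X.Opens) (h : V ≤ U), p ∈ V ∧ X.res h a = X.res h b) : a = b := by
  choose! V h hp e using H
  exact X.sheaf.eq_of_locally_eq' (fun p : U => V p) U (fun p => homOfLE (h p p.2))
    (fun p hpU => Opens.mem_iSup.2 ⟨⟨p, hpU⟩, hp p hpU⟩) _ _ fun p => e p p.2

/-- Sections with a given property can be glued if the property is stable under restriction,
determines the section, and is satisfied by some section locally. -/
theorem exists_of_locally_unique {U : X.Opens} (P : ∀ V : X.Opens, Γ(X, V) → Prop)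
    (hres : ∀ V W (h : W ≤ V) a, P V a → P W (X.res h a))
    (huniq : ∀ V, V ≤ U → ∀ a b, P V a → P V b → a = b)
    (hex : ∀ p ∈ U, ∃ V ≤ U, p ∈ V ∧ ∃ a, P V a) :
    ∃ a : Γ(X, U), ∀ p ∈ U, ∃ (V : X.Opens) (h : V ≤ U), p ∈ V ∧ P V (X.res h a) := by
  choose! V h hp a ha using hex
  obtain ⟨b, hb, -⟩ := X.sheaf.existsUnique_gluing' (fun p : U => V p) U
    (fun p => homOfLE (h p p.2)) (fun p hpU => Opens.mem_iSup.2 ⟨⟨p, hpU⟩, hp p hpU⟩)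
    (fun p => a p) (fun p q => huniq _ (inf_le_left.trans (h p p.2)) _ _
      (hres _ _ inf_le_left _ (ha p p.2)) (hres _ _ inf_le_right _ (ha q q.2)))
  refine ⟨b, fun p hpU => ⟨V p, h p hpU, hp p hpU, ?_⟩⟩
  have : X.res (h p hpU) b = a p := hb ⟨p, hpU⟩
  rw [this]
  exact ha p hpU

namespace Modules

variable (M : X.Modules) {N : X.Modules}

/-- Restriction of sections of `M` from `U` to `V ≤ U`. -/
noncomputable def res {V U : X.Opens} (h : V ≤ U) : Γ(M, U) →+ Γ(M, V) :=
  (M.presheaf.map (homOfLE h).op).hom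

theorem map_eq_res {V U : X.Opens} (i : V ⟶ U) (m : Γ(M, U)) :
    M.presheaf.map i.op m = M.res i.le m := rfl

theorem res_smul {V U : X.Opens} (h : V ≤ U) (a : Γ(X, U)) (m : Γ(M, U)) :
    M.res h (a • m) = X.res h a • M.res h m :=
  M.map_smul (homOfLE h) a m

theorem res_res {W V U : X.Opens} (h : V ≤ U) (h' : W ≤ V) (m : Γ(M, U)) :
    M.res h' (M.res h m) = M.res (h'.trans h) m :=
  congr($(M.presheaf.map_comp (homOfLE h).op (homOfLE h').op) m).symm

theorem res_self {U : X.Opens} (h : U ≤ U) (m : Γ(M, U)) : M.res h m = m :=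
  congr($(M.presheaf.map_id (op U)) m)

variable {M}

theorem app_res (a : M ⟶ N) {V U : X.Opens} (h : V ≤ U) (m : Γ(M, U)) :
    a.app V (M.res h m) = N.res h (a.app U m) :=
  hom_app_map a (homOfLE h) m

theorem eq_of_locally_eq {U : X.Opens} {a b : Γ(M, U)}
    (H : ∀ p ∈ U, ∃ (V : X.Opens) (h : V ≤ U), p ∈ V ∧ M.res h a = M.res h b) : a = b := by
  choose! V h hp e using H
  exact TopCat.Sheaf.eq_of_locally_eq' ⟨M.presheaf, M.isSheaf⟩ (fun p : U => V p) U
    (fun p => homOfLE (h p p.2))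
    (fun p hpU => Opens.mem_iSup.2 ⟨⟨p, hpU⟩, hp p hpU⟩) _ _ fun p => e p p.2

/-- Sections with a given property can be glued if the property is stable under restriction,
determines the section, and is satisfied by some section locally. -/
theorem exists_of_locally_unique {U : X.Opens} (P : ∀ V : X.Opens, Γ(M, V) → Prop)
    (hres : ∀ V W (h : W ≤ V) a, P V a → P W (M.res h a))
    (huniq : ∀ V, V ≤ U → ∀ a b, P V a → P V b → a = b)
    (hex : ∀ p ∈ U, ∃ V ≤ U, p ∈ V ∧ ∃ a, P V a) :
    ∃ a : Γ(M, U), ∀ p ∈ U, ∃ (V : X.Opens) (h : V ≤ U), p ∈ V ∧ P V (M.res h a) := by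
  choose! V h hp a ha using hex
  obtain ⟨b, hb, -⟩ := TopCat.Sheaf.existsUnique_gluing' ⟨M.presheaf, M.isSheaf⟩
    (fun p : U => V p) U
    (fun p => homOfLE (h p p.2)) (fun p hpU => Opens.mem_iSup.2 ⟨⟨p, hpU⟩, hp p hpU⟩)
    (fun p => a p) (fun p q => huniq _ (inf_le_left.trans (h p p.2)) _ _
      (hres _ _ inf_le_left _ (ha p p.2)) (hres _ _ inf_le_right _ (ha q q.2)))
  refine ⟨b, fun p hpU => ⟨V p, h p hpU, hp p hpU, ?_⟩⟩
  have : M.res (h p hpU) b = a p := hb ⟨p, hpU⟩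
  rw [this]
  exact ha p hpU

theorem isIso_of_bijective (a : M ⟶ N) (H : ∀ U, Function.Bijective (a.app U)) : IsIso a := by
  rw [Hom.isIso_iff_isIso_app]
  intro U
  rw [ConcreteCategory.isIso_iff_bijective]
  exact H U

/-- A morphism of sheaves of modules which is bijective on the sections over all small enough open
sets is an isomorphism. -/
theorem isIso_of_locally_bijective (a : M ⟶ N)
    (H : ∀ p : X, ∃ U : X.Opens, p ∈ U ∧ ∀ V ≤ U, Function.Bijective (a.app V)) : IsIso a := by
  have inj : ∀ W, Function.Injective (a.app W) := by
    intro W x y hxy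
    refine eq_of_locally_eq fun p hp => ?_
    obtain ⟨U, hpU, hU⟩ := H p
    refine ⟨W ⊓ U, inf_le_left, ⟨hp, hpU⟩, (hU _ inf_le_right).1 ?_⟩
    rw [app_res, app_res, hxy]
  refine isIso_of_bijective a fun W => ⟨inj W, fun y => ?_⟩
  obtain ⟨x, hx⟩ := exists_of_locally_unique (M := M) (U := W)
    (fun V x => ∃ h : V ≤ W, a.app V x = N.res h y)
    (fun V V' h x ⟨h1, h2⟩ => ⟨h.trans h1, by rw [app_res, h2, res_res]⟩)
    (fun V _ x x' ⟨h1, h2⟩ ⟨_, h2'⟩ => inj V (h2.trans h2'.symm))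
    (fun p hp => by
      obtain ⟨U, hpU, hU⟩ := H p
      obtain ⟨x, hx⟩ := (hU (W ⊓ U) inf_le_right).2 (N.res inf_le_left y)
      exact ⟨W ⊓ U, inf_le_left, ⟨hp, hpU⟩, x, inf_le_left, hx⟩)
  refine ⟨x, eq_of_locally_eq fun p hp => ?_⟩
  obtain ⟨V, h, hpV, h', e⟩ := hx p hp
  exact ⟨V, h, hpV, by rw [← app_res, e]⟩

/-! ### Generators of invertible sheaves -/

variable (M) in
/-- The section `m` of `M` over `U` is a basis of `M` over `U`: multiplication by `m` is an
isomorphism from the structure sheaf of `U` to the restriction of `M` to `U`. -/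
def IsGenerator {U : X.Opens} (m : Γ(M, U)) : Prop :=
  ∀ (V : X.Opens) (h : V ≤ U), Function.Bijective fun c : Γ(X, V) => c • M.res h m

namespace IsGenerator

variable {U : X.Opens} {m : Γ(M, U)}

theorem res (hm : M.IsGenerator m) {V : X.Opens} (h : V ≤ U) : M.IsGenerator (M.res h m) := by
  intro W h'
  simp_rw [res_res]
  exact hm W (h'.trans h)

theorem exists_eq_smul (hm : M.IsGenerator m) (x : Γ(M, U)) : ∃ c : Γ(X, U), x = c • m := by
  obtain ⟨c, hc⟩ := (hm U le_rfl).2 x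
  rw [← hc]
  exact ⟨c, by simp only [res_self]⟩

theorem smul_injective (hm : M.IsGenerator m) {c d : Γ(X, U)} (h : c • m = d • m) : c = d := by
  apply (hm U le_rfl).1
  simpa only [res_self] using h

theorem map_of_bijective (hm : M.IsGenerator m) (a : M ⟶ N)
    (ha : ∀ V ≤ U, Function.Bijective (a.app V)) : N.IsGenerator (a.app U m) := by
  intro V h
  have : (fun c : Γ(X, V) => c • N.res h (a.app U m)) = a.app V ∘ fun c => c • M.res h m := by
    funext c
    rw [Function.comp_apply, Hom.app_smul, app_res]
  rw [this]
  exact (ha V h).comp (hm V h)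

theorem map_iso (hm : M.IsGenerator m) (a : M ≅ N) : N.IsGenerator (a.hom.app U m) :=
  hm.map_of_bijective a.hom fun V _ =>
    (ConcreteCategory.isIso_iff_bijective (a.hom.app V)).1 inferInstance

theorem bijective_of_map (hm : M.IsGenerator m) (a : M ⟶ N) (h : N.IsGenerator (a.app U m))
    (V : X.Opens) (hV : V ≤ U) : Function.Bijective (a.app V) := by
  have h2 : (fun c : Γ(X, V) => c • N.res hV (a.app U m)) = a.app V ∘ fun c => c • M.res hV m := by
    funext c
    rw [Function.comp_apply, Hom.app_smul, app_res]
  have h3 := h V hV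
  rw [h2] at h3
  exact (Function.Bijective.of_comp_iff _ (hm V hV)).1 h3

end IsGenerator

/-- A morphism mapping local generators to generators is an isomorphism. -/
theorem isIso_of_isGenerator (a : M ⟶ N)
    (H : ∀ p : X, ∃ (U : X.Opens) (m : Γ(M, U)), p ∈ U ∧ M.IsGenerator m ∧
      N.IsGenerator (a.app U m)) : IsIso a :=
  isIso_of_locally_bijective a fun p => by
    obtain ⟨U, m, hp, h1, h2⟩ := H p
    exact ⟨U, hp, fun V hV => h1.bijective_of_map a h2 V hV⟩

end Modules

end AlgebraicGeometry.Scheme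

namespace AlgebraicGeometry.Scheme.Modules

variable {X Y : Scheme.{u}} {M N : X.Modules}

/-- A morphism of sheaves of modules from its values on sections. -/
noncomputable def homOfSections (f : ∀ U : X.Opens, Γ(M, U) → Γ(N, U))
    (hadd : ∀ U m m', f U (m + m') = f U m + f U m')
    (hsmul : ∀ U (c : Γ(X, U)) m, f U (c • m) = c • f U m)
    (hres : ∀ U V (h : V ≤ U) m, f V (M.res h m) = N.res h (f U m)) : M ⟶ N :=
  ⟨PresheafOfModules.homMk
    { app := fun U => AddCommGrpCat.ofHom (AddMonoidHom.mk' (f U.unop) (hadd U.unop))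
      naturality := by
        intro U V i
        ext (m : Γ(M, U.unop))
        exact hres _ _ i.unop.le m }
    (fun U c m => hsmul U.unop c m)⟩

theorem hom_ext_sections {a b : M ⟶ N} (H : ∀ (U : X.Opens) (m : Γ(M, U)), a.app U m = b.app U m) :
    a = b := by
  ext U m
  exact H U m

theorem homOfSections_app (f : ∀ U : X.Opens, Γ(M, U) → Γ(N, U)) (hadd hsmul hres) (U : X.Opens)
    (m : Γ(M, U)) :
    (homOfSections f hadd hsmul hres).app U m = f U m := rfl

variable (X) in
/-- The structure sheaf, as a sheaf of modules. -/
noncomputable abbrev structureSheaf : X.Modules := SheafOfModules.unit X.ringCatSheaf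

/-- The morphism from the structure sheaf given by a global section. -/
noncomputable def homOfSection (m : Γ(M, ⊤)) : structureSheaf X ⟶ M :=
  homOfSections (fun U (c : Γ(X, U)) => c • M.res le_top m)
    (fun U (c d : Γ(X, U)) => add_smul c d (M.res le_top m))
    (fun U (c d : Γ(X, U)) => mul_smul c d (M.res le_top m))
    (fun U V h (c : Γ(X, U)) => by
      rw [res_smul, res_res]
      rfl)

theorem homOfSection_app (m : Γ(M, ⊤)) (U : X.Opens) (c : Γ(X, U)) :
    (homOfSection m).app U c = c • M.res le_top m := rfl

theorem isGenerator_one (U : X.Opens) : (structureSheaf X).IsGenerator (U := U) (1 : Γ(X, U)) := by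
  intro V h
  have : ∀ c : Γ(X, V), c • (structureSheaf X).res h (1 : Γ(X, U)) = c := fun c =>
    (congr(c * $(map_one (X.res h)))).trans (mul_one c)
  have h2 : (fun c : Γ(X, V) => c • (structureSheaf X).res h (1 : Γ(X, U))) = fun c => c :=
    funext this
  rw [h2]
  exact Function.bijective_id

theorem IsGenerator.isIso_homOfSection {m : Γ(M, ⊤)} (hm : M.IsGenerator m) :
    IsIso (homOfSection m) :=
  isIso_of_bijective _ fun U => hm U le_top

theorem IsGenerator.of_res {U V : X.Opens} (h : V ≤ U) (h' : U ≤ V) {m : Γ(M, U)}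
    (hm : M.IsGenerator (M.res h m)) : M.IsGenerator m := by
  obtain rfl := le_antisymm h h'
  rwa [res_self] at hm

/-! ### Pull-back of generators -/

theorem pullbackSection_add (f : X ⟶ Y) (L : Y.Modules) {U : Y.Opens} (x y : Γ(L, U)) :
    pullbackSection f L U (x + y) = pullbackSection f L U x + pullbackSection f L U y :=
  map_add _ x y

theorem pullbackSection_smul (f : X ⟶ Y) (L : Y.Modules) {U : Y.Opens} (c : Γ(Y, U))
    (x : Γ(L, U)) :
    pullbackSection f L U (c • x) = f.app U c • pullbackSection f L U x :=
  Hom.app_smul ((pullbackPushforwardAdjunction f).unit.app L) c x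

theorem pullbackSection_res (f : X ⟶ Y) (L : Y.Modules) {U V : Y.Opens} (h : V ≤ U)
    (x : Γ(L, U)) :
    pullbackSection f L V (L.res h x) =
      ((pullback f).obj L).res (f.preimage_mono h) (pullbackSection f L U x) :=
  app_res ((pullbackPushforwardAdjunction f).unit.app L) h x

/-- The morphism `f^* L → K` adjoint to `L → f_* K`. -/
noncomputable def adjointHom (f : X ⟶ Y) {L : Y.Modules} {K : X.Modules}
    (θ : L ⟶ (pushforward f).obj K) : (pullback f).obj L ⟶ K :=
  ((pullbackPushforwardAdjunction f).homEquiv _ _).symm θ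

theorem adjointHom_section (f : X ⟶ Y) {L : Y.Modules} {K : X.Modules}
    (θ : L ⟶ (pushforward f).obj K) (U : Y.Opens) (x : Γ(L, U)) :
    (adjointHom f θ).app (f ⁻¹ᵁ U) (pullbackSection f L U x) = θ.app U x := by
  have h : (pullbackPushforwardAdjunction f).unit.app L ≫ (pushforward f).map (adjointHom f θ) =
      θ :=
    (Adjunction.homEquiv_unit ..).symm.trans (Equiv.apply_symm_apply _ _)
  exact congr(($h).app U x)

/-- Multiplication by `f^* n` is the pull-back of the isomorphism `𝒪 ≅ L` given by `n`. -/
theorem IsGenerator.pullback_top (f : X ⟶ Y) {L : Y.Modules} {n : Γ(L, ⊤)}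
    (hn : L.IsGenerator n) :
    ((pullback f).obj L).IsGenerator (U := ⊤) (pullbackSection f L ⊤ n) := by
  have := hn.isIso_homOfSection
  -- the candidate inverse of `c ↦ c • f^* n` is adjoint to `c • n ↦ f^# c`
  let η : structureSheaf Y ⟶ (pushforward f).obj (structureSheaf X) :=
    homOfSections (fun U (c : Γ(Y, U)) => f.app U c) (fun U (c d : Γ(Y, U)) => map_add _ c d)
      (fun U (c d : Γ(Y, U)) => map_mul (f.app U).hom c d)
      (fun U V h (c : Γ(Y, U)) => f.app_res h c)
  let b := adjointHom f (inv (homOfSection n) ≫ η)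
  let a := homOfSection (M := (pullback f).obj L) (pullbackSection f L ⊤ n)
  have hb : ∀ (U : Y.Opens) (c : Γ(Y, U)),
      b.app (f ⁻¹ᵁ U) (pullbackSection f L U (c • L.res le_top n)) = f.app U c := by
    intro U c
    refine (adjointHom_section f _ U _).trans ?_
    rw [comp_app_apply]
    refine congr(η.app U $(?_)).trans (homOfSections_app _ _ _ _ U _)
    exact congr(($(IsIso.hom_inv_id (homOfSection n))).app U c)
  have hba : b ≫ a = 𝟙 _ := by
    apply pullback_hom_ext
    intro U x
    obtain ⟨c, rfl⟩ := (hn U le_top).2 x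
    rw [comp_app_apply]
    dsimp only
    rw [hb]
    refine (homOfSection_app _ _ _).trans ?_
    rw [pullbackSection_smul, pullbackSection_res]
    rfl
  have hab : a ≫ b = 𝟙 _ := by
    have key : ∀ U : X.Opens, b.app U (((pullback f).obj L).res le_top (pullbackSection f L ⊤ n)) =
        (1 : Γ(X, U)) := by
      intro U
      refine (app_res b (le_top : U ≤ ⊤) (pullbackSection f L ⊤ n)).trans ?_
      have h1 := hb ⊤ 1
      rw [one_smul, res_self] at h1
      refine congr((structureSheaf X).res (le_top : U ≤ ⊤) $h1).trans ?_
      exact (congr(X.res (le_top : U ≤ ⊤) $(map_one (f.app ⊤).hom))).trans (map_one _)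
    refine hom_ext_sections fun U (c : Γ(X, U)) => ?_
    refine congr(b.app U $(homOfSection_app (pullbackSection f L ⊤ n) U c)).trans ?_
    refine (Hom.app_smul b c _).trans ?_
    exact congr(c • $(key U)).trans (mul_one c)
  have hiso : IsIso a := ⟨b, hab, hba⟩
  intro U h
  exact (ConcreteCategory.isIso_iff_bijective (a.app U)).1 inferInstance

section OpenImmersion

variable (j : X ⟶ Y) [IsOpenImmersion j] (K : Y.Modules)

theorem pullbackSection_eq_restrict (V : Y.Opens) (k : Γ(K, V)) :
    pullbackSection j K V k = ((restrictFunctorIsoPullback j).hom.app K).app (j ⁻¹ᵁ V)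
      (K.res (j.image_preimage_le V) k) := by
  have := (restrictAdjunction j).unit_leftAdjointUniq_hom_app (pullbackPushforwardAdjunction j) K
  exact congr(($this).app V k).symm

theorem exists_image_eq {V : Y.Opens} (h : V ≤ j.opensRange) : ∃ W : X.Opens, V = j ''ᵁ W :=
  ⟨j ⁻¹ᵁ V, by rw [Scheme.Hom.image_preimage_eq_opensRange_inf, inf_eq_right.2 h]⟩

theorem isGenerator_restrict_iff (W : X.Opens) (k : Γ(K, j ''ᵁ W)) :
    (K.restrict j).IsGenerator (U := W) k ↔ K.IsGenerator k := by
  have key : ∀ (V : X.Opens) (h : V ≤ W),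
      (Function.Bijective fun c : Γ(X, V) => (c • (K.restrict j).res h k : Γ(K.restrict j, V))) ↔
      (Function.Bijective fun c : Γ(Y, j ''ᵁ V) => c • K.res (j.image_mono h) k) := by
    intro V h
    have : (fun c : Γ(X, V) => (c • (K.restrict j).res h k : Γ(K.restrict j, V))) =
      (fun c : Γ(Y, j ''ᵁ V) => c • K.res (j.image_mono h) k) ∘ (j.appIso V).inv := rfl
    rw [this]
    exact Function.Bijective.of_comp_iff _
      ((ConcreteCategory.isIso_iff_bijective (j.appIso V).inv).1 inferInstance)
  constructor
  · intro H V h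
    obtain ⟨V', rfl⟩ := exists_image_eq j (h.trans (j.image_le_opensRange W))
    have h' : V' ≤ W := (j.image_le_image_iff _ _).1 h
    exact (key V' h').1 (H V' h')
  · intro H V h
    exact (key V h).2 (H _ _)

/-- Along an open immersion, pull-back identifies the sections over open subsets of the image. -/
theorem bijective_pullbackSection {V : Y.Opens} (h : V ≤ j.opensRange) :
    Function.Bijective (pullbackSection j K V) := by
  have h1 : ⇑(pullbackSection j K V) = ((restrictFunctorIsoPullback j).hom.app K).app (j ⁻¹ᵁ V) ∘
      K.res (j.image_preimage_le V) := by
    funext k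
    exact pullbackSection_eq_restrict j K V k
  rw [h1]
  refine Function.Bijective.comp ((ConcreteCategory.isIso_iff_bijective
    (((restrictFunctorIsoPullback j).hom.app K).app (j ⁻¹ᵁ V))).1 inferInstance) ?_
  have h2 : V = j ''ᵁ j ⁻¹ᵁ V := by
    rw [Scheme.Hom.image_preimage_eq_opensRange_inf, inf_eq_right.2 h]
  have : ∀ (W : Y.Opens) (e : V = W), Function.Bijective (K.res e.ge) := by
    rintro _ rfl
    have h3 : ⇑(K.res (le_refl V)) = id := funext fun c => res_self _ _ c
    rw [h3]
    exact Function.bijective_id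
  exact this _ h2

theorem isGenerator_pullback_iff {V : Y.Opens} (h : V ≤ j.opensRange) (k : Γ(K, V)) :
    ((pullback j).obj K).IsGenerator (pullbackSection j K V k) ↔ K.IsGenerator k := by
  have h2 : V = j ''ᵁ j ⁻¹ᵁ V := by
    rw [Scheme.Hom.image_preimage_eq_opensRange_inf, inf_eq_right.2 h]
  rw [pullbackSection_eq_restrict]
  have h3 := isGenerator_restrict_iff j K (j ⁻¹ᵁ V) (K.res (j.image_preimage_le V) k)
  constructor
  · intro H
    have h4 := H.map_iso ((restrictFunctorIsoPullback j).symm.app K)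
    have h5 := congr(($((restrictFunctorIsoPullback j).hom_inv_id_app K)).app (j ⁻¹ᵁ V)
      (K.res (j.image_preimage_le V) k))
    refine IsGenerator.of_res (j.image_preimage_le V) h2.le (h3.1 ?_)
    have h6 := h5.symm
    exact h6 ▸ h4
  · intro H
    exact (h3.2 (H.res _)).map_iso ((restrictFunctorIsoPullback j).app K)

end OpenImmersion

/-- The pull-back of a generator is a generator. -/
theorem IsGenerator.pullback (f : X ⟶ Y) {L : Y.Modules} {U : Y.Opens} {n : Γ(L, U)}
    (hn : L.IsGenerator n) :
    ((Modules.pullback f).obj L).IsGenerator (pullbackSection f L U n) := by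
  -- reduce to a global generator by restricting to `U`
  rw [← isGenerator_pullback_iff (f ⁻¹ᵁ U).ι _ (by simp)]
  have h1 := (isGenerator_pullback_iff U.ι L (by simp) n).2 hn
  have htop : (⊤ : U.toScheme.Opens) ≤ U.ι ⁻¹ᵁ U := by simp
  have h2 := (h1.res htop).pullback_top (f ∣_ U)
  have h3 : ((Modules.pullback (f ∣_ U)).obj ((Modules.pullback U.ι).obj L)).IsGenerator
      (pullbackSection (f ∣_ U) _ (U.ι ⁻¹ᵁ U) (pullbackSection U.ι L U n)) := by
    refine IsGenerator.of_res ((f ∣_ U).preimage_mono htop) (by simp) ?_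
    rw [← pullbackSection_res]
    exact h2
  have h4 := h3.map_iso ((pullbackComp (f ∣_ U) U.ι).app L)
  have h5 := pullbackComp_hom_section (f ∣_ U) U.ι L U n
  have h6 : ((Modules.pullback (f ∣_ U ≫ U.ι)).obj L).IsGenerator
      (pullbackSection (f ∣_ U ≫ U.ι) L U n) := h5 ▸ h4
  rw [morphismRestrict_ι] at h6
  have h7 := h6.map_iso ((pullbackComp (f ⁻¹ᵁ U).ι f).symm.app L)
  have h8 := pullbackComp_inv_section (f ⁻¹ᵁ U).ι f L U n
  exact h8 ▸ h7

/-! ### Invertible sheaves -/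

/-- A sheaf of modules is invertible if and only if it has generators locally. Generators replace
trivializations throughout. -/
theorem isInvertible_iff (M : X.Modules) :
    M.IsInvertible ↔ ∀ x : X, ∃ (U : X.Opens) (m : Γ(M, U)), x ∈ U ∧ M.IsGenerator m := by
  constructor
  · intro H x
    obtain ⟨U, hx, ⟨e⟩⟩ := H x
    have h1 := (isGenerator_restrict_iff U.ι M ⊤ _).1 ((isGenerator_one ⊤).map_iso e.symm)
    exact ⟨_, _, by simpa using hx, h1⟩
  · intro H x
    obtain ⟨U, m, hx, hm⟩ := H x
    refine ⟨U, hx, ?_⟩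
    have hU : U.ι ''ᵁ ⊤ ≤ U := by simp
    have h1 := (isGenerator_restrict_iff U.ι M ⊤ (M.res hU m)).2 (hm.res hU)
    have := h1.isIso_homOfSection
    exact ⟨(asIso (homOfSection (M := M.restrict U.ι) (M.res hU m))).symm⟩

end AlgebraicGeometry.Scheme.Modules

/-! ### Tensor powers -/

namespace AlgebraicGeometry.Scheme.Modules

variable {X : Scheme.{u}} {M K : X.Modules} {r : ℕ}

variable (M r) in
/-- The unit of the sheafification defining the tensor power, on sections. -/
noncomputable def toTensorPower (U : X.Opens) :
    (PiTensorProduct Γ(X, U) fun _ : Fin r => Γ(M, U)) →ₗ[Γ(X, U)] Γ(M.tensorPower r, U) :=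
  let η := (PresheafOfModules.sheafificationAdjunction (𝟙 X.ringCatSheaf.obj)).unit.app
    (M.tensorPowerPresheaf r)
  { toFun := fun x => (η.app (op U)).hom x
    map_add' := fun x y => (η.app (op U)).hom.map_add x y
    map_smul' := fun a x => (η.app (op U)).hom.map_smul a x }

theorem toTensorPower_tprod (U : X.Opens) (m : Fin r → Γ(M, U)) :
    toTensorPower M r U (PiTensorProduct.tprod Γ(X, U) m) = M.tprod r U m := rfl

theorem toTensorPower_res {U V : X.Opens} (h : V ≤ U)
    (x : PiTensorProduct Γ(X, U) fun _ : Fin r => Γ(M, U)) :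
    toTensorPower M r V (M.tensorPowerRes (homOfLE h) r x) =
      (M.tensorPower r).res h (toTensorPower M r U x) := by
  let η := (PresheafOfModules.sheafificationAdjunction (𝟙 X.ringCatSheaf.obj)).unit.app
    (M.tensorPowerPresheaf r)
  exact PresheafOfModules.naturality_apply η (homOfLE h).op x

theorem res_tprod {U V : X.Opens} (h : V ≤ U) (m : Fin r → Γ(M, U)) :
    (M.tensorPower r).res h (M.tprod r U m) = M.tprod r V fun i => M.res h (m i) := by
  rw [← toTensorPower_tprod, ← toTensorPower_res, tensorPowerRes_tprod, toTensorPower_tprod]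
  rfl

/-- A family of multilinear maps compatible with restriction induces a morphism from the tensor
power. -/
theorem exists_tensorPower_desc
    (μ : ∀ U, MultilinearMap Γ(X, U) (fun _ : Fin r => Γ(M, U)) Γ(K, U))
    (hμ : ∀ U V (h : V ≤ U) m, K.res h (μ U m) = μ V fun i => M.res h (m i)) :
    ∃ a : M.tensorPower r ⟶ K, ∀ U m, a.app U (M.tprod r U m) = μ U m := by
  let f : (M.tensorPowerPresheaf r).presheaf ⟶ K.presheaf :=
    { app := fun U => AddCommGrpCat.ofHom (PiTensorProduct.lift (μ U.unop)).toAddMonoidHom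
      naturality := by
        intro U V i
        ext (x : PiTensorProduct Γ(X, U.unop) fun _ : Fin r => Γ(M, U.unop))
        change PiTensorProduct.lift (μ V.unop) (M.tensorPowerRes i.unop r x) =
          K.res i.unop.le (PiTensorProduct.lift (μ U.unop) x)
        induction x using PiTensorProduct.induction_on with
        | smul_tprod c m =>
          rw [LinearMap.map_smulₛₗ, tensorPowerRes_tprod, LinearMap.map_smul, LinearMap.map_smul,
            PiTensorProduct.lift.tprod, PiTensorProduct.lift.tprod, res_smul, hμ]
          rfl
        | add x y hx hy => rw [map_add, map_add, map_add, map_add, hx, hy] }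
  let θ : M.tensorPowerPresheaf r ⟶ (SheafOfModules.forget _ ⋙
      PresheafOfModules.restrictScalars (𝟙 X.ringCatSheaf.obj)).obj K :=
    PresheafOfModules.homMk f fun U c x => (PiTensorProduct.lift (μ U.unop)).map_smul c x
  let adj := PresheafOfModules.sheafificationAdjunction (𝟙 X.ringCatSheaf.obj)
  refine ⟨(adj.homEquiv _ _).symm θ, fun U m => ?_⟩
  have h := (Adjunction.homEquiv_unit ..).symm.trans (Equiv.apply_symm_apply (adj.homEquiv _ _) θ)
  have h2 : PiTensorProduct.lift (μ U) (PiTensorProduct.tprod Γ(X, U) m) = μ U m :=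
    PiTensorProduct.lift.tprod m
  exact congr((($h).app (op U)).hom (PiTensorProduct.tprod Γ(X, U) m)).trans h2

theorem exists_res_eq_of_mem {U : X.Opens} (S : Sieve U)
    (hS : S ∈ Opens.grothendieckTopology X U) (p : X) (hp : p ∈ U) :
    ∃ (V : X.Opens) (h : V ≤ U), p ∈ V ∧ S (homOfLE h) := by
  obtain ⟨V, f, hf, hpV⟩ := hS p hp
  exact ⟨V, f.le, hpV, hf⟩

/-- Sections of the tensor power are locally sums of pure tensors. -/
theorem exists_toTensorPower_eq {U : X.Opens} (x : Γ(M.tensorPower r, U)) (p : X) (hp : p ∈ U) :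
    ∃ (V : X.Opens) (h : V ≤ U), p ∈ V ∧ ∃ y, toTensorPower M r V y = (M.tensorPower r).res h
        x := by
  obtain ⟨V, h, hpV, y, hy⟩ := exists_res_eq_of_mem _ (Presheaf.imageSieve_mem
    (Opens.grothendieckTopology X)
    (CategoryTheory.toSheafify (Opens.grothendieckTopology X) (M.tensorPowerAb r)) x) p hp
  exact ⟨V, h, hpV, y, hy⟩

/-- Elements of the presheaf tensor power with the same image in the sheaf are locally equal. -/
theorem locally_eq_of_toTensorPower_eq {U : X.Opens}
    (y z : PiTensorProduct Γ(X, U) fun _ : Fin r => Γ(M, U))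
    (hy : toTensorPower M r U y = toTensorPower M r U z) (p : X) (hp : p ∈ U) :
    ∃ (V : X.Opens) (h : V ≤ U), p ∈ V ∧
      M.tensorPowerRes (homOfLE h) r y = M.tensorPowerRes (homOfLE h) r z := by
  obtain ⟨V, h, hpV, e⟩ := exists_res_eq_of_mem _ (Presheaf.equalizerSieve_mem
    (Opens.grothendieckTopology X)
    (CategoryTheory.toSheafify (Opens.grothendieckTopology X) (M.tensorPowerAb r))
    (X := op U) y z hy) p hp
  exact ⟨V, h, hpV, e⟩

/-- If `m` is a basis of a module, then `m ⊗ ⋯ ⊗ m` is a basis of its tensor power. -/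
theorem bijective_smul_tprod {A E : Type*} [CommRing A] [AddCommGroup E] [Module A E] (m : E)
    (hm : Function.Bijective fun c : A => c • m) (r : ℕ) :
    Function.Bijective fun c : A => c • PiTensorProduct.tprod A fun _ : Fin r => m := by
  let e : A ≃ₗ[A] E := LinearEquiv.ofBijective (LinearMap.toSpanSingleton A E m) hm
  have he : ∀ x, e.symm x • m = x := fun x => e.apply_symm_apply x
  let μ : MultilinearMap A (fun _ : Fin r => E) A :=
    (MultilinearMap.mkPiAlgebra A (Fin r) A).compLinearMap fun _ => e.symm.toLinearMap
  have hμ : ∀ x, μ x = ∏ i, e.symm (x i) := fun x => rfl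
  have hem : e.symm m = 1 := hm.1 ((he m).trans (one_smul A m).symm)
  refine Function.bijective_iff_has_inverse.2 ⟨PiTensorProduct.lift μ, fun c => ?_, fun x => ?_⟩
  · dsimp only
    rw [LinearMap.map_smul, PiTensorProduct.lift.tprod, hμ]
    simp only [hem, Finset.prod_const_one, smul_eq_mul, mul_one]
  · dsimp only
    induction x using PiTensorProduct.induction_on with
    | smul_tprod c x =>
      rw [LinearMap.map_smul, PiTensorProduct.lift.tprod, hμ, smul_eq_mul, mul_smul,
        ← MultilinearMap.map_smul_univ]
      simp only [he]
    | add x y hx hy => rw [map_add, add_smul, hx, hy]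

/-- If `m` generates `M`, then `m ⊗ ⋯ ⊗ m` generates the tensor power: the presheaf tensor power
is free of rank one on the open sets in question, hence is already a sheaf there. -/
theorem IsGenerator.tprod {U : X.Opens} {m : Γ(M, U)} (hm : M.IsGenerator m) :
    (M.tensorPower r).IsGenerator (M.tprod r U fun _ => m) := by
  have hb : ∀ V (h : V ≤ U), Function.Bijective fun c : Γ(X, V) =>
      c • PiTensorProduct.tprod Γ(X, V) fun _ : Fin r => M.res h m :=
    fun V h => bijective_smul_tprod _ (hm V h) r
  have key : ∀ V (h : V ≤ U) (c : Γ(X, V)),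
      c • (M.tensorPower r).res h (M.tprod r U fun _ => m) =
        toTensorPower M r V (c • PiTensorProduct.tprod Γ(X, V) fun _ : Fin r => M.res h m) := by
    intro V h c
    rw [res_tprod, LinearMap.map_smul, toTensorPower_tprod]
  have inj : ∀ V (h : V ≤ U), Function.Injective fun c : Γ(X, V) =>
      c • (M.tensorPower r).res h (M.tprod r U fun _ => m) := by
    intro V h c d hcd
    dsimp only at hcd
    rw [key, key] at hcd
    refine Scheme.eq_of_locally_eq fun p hp => ?_
    obtain ⟨W, h', hpW, e⟩ := locally_eq_of_toTensorPower_eq _ _ hcd p hp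
    refine ⟨W, h', hpW, (hb W (h'.trans h)).1 ?_⟩
    rw [LinearMap.map_smulₛₗ, LinearMap.map_smulₛₗ, tensorPowerRes_tprod] at e
    simp only [map_eq_res, res_res] at e
    exact e
  refine fun V h => ⟨inj V h, fun x => ?_⟩
  obtain ⟨c, hc⟩ := Scheme.exists_of_locally_unique (X := X) (U := V)
    (fun W c => ∃ h' : W ≤ V, c • (M.tensorPower r).res (h'.trans h) (M.tprod r U fun _ => m) =
      (M.tensorPower r).res h' x)
    (fun W W' h' c ⟨h1, h2⟩ => ⟨h'.trans h1, by
      have := congr((M.tensorPower r).res h' $h2)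
      rwa [res_smul, res_res, res_res] at this⟩)
    (fun W _ c d ⟨h1, h2⟩ ⟨_, h2'⟩ => inj W (h1.trans h) (h2.trans h2'.symm))
    (fun p hp => by
      obtain ⟨W, h', hpW, y, hy⟩ := exists_toTensorPower_eq x p hp
      obtain ⟨c, rfl⟩ := (hb W (h'.trans h)).2 y
      refine ⟨W, h', hpW, c, h', ?_⟩
      rw [key]
      exact hy)
  refine ⟨c, eq_of_locally_eq fun p hp => ?_⟩
  obtain ⟨W, h', hpW, _, e⟩ := hc p hp
  refine ⟨W, h', hpW, ?_⟩
  dsimp only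
  rw [res_smul, res_res]
  exact e

end AlgebraicGeometry.Scheme.Modules

/-! ### Arrows between roots, in terms of sections -/

namespace AlgebraicGeometry.Scheme.Modules

variable {S T W X : Scheme.{u}} {h : S ⟶ T} {M : S.Modules} {N : T.Modules}

theorem pullInv_add (ρ : M ≅ (pullback h).obj N) (U : T.Opens) (n n' : Γ(N, U)) :
    pullInv ρ U (n + n') = pullInv ρ U n + pullInv ρ U n' := by
  rw [pullInv, pullbackSection_add]
  exact map_add _ _ _

theorem pullInv_res (ρ : M ≅ (pullback h).obj N) {U V : T.Opens} (hV : V ≤ U) (n : Γ(N, U)) :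
    pullInv ρ V (N.res hV n) = M.res (h.preimage_mono hV) (pullInv ρ U n) := by
  rw [pullInv, pullbackSection_res, app_res]
  rfl

theorem IsGenerator.pullInv {U : T.Opens} {n : Γ(N, U)} (hn : N.IsGenerator n)
    (ρ : M ≅ (Modules.pullback h).obj N) : M.IsGenerator (pullInv ρ U n) :=
  (hn.pullback h).map_iso ρ.symm

/-- A morphism `N → h_* M` mapping local generators to generators is adjoint to the inverse of an
isomorphism `M ≅ h^* N`. -/
theorem exists_iso_of_isGenerator (θ : N ⟶ (pushforward h).obj M)
    (H : ∀ x : S, ∃ (U : T.Opens) (n : Γ(N, U)) (V : S.Opens) (hV : V ≤ h ⁻¹ᵁ U), x ∈ V ∧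
      N.IsGenerator n ∧ M.IsGenerator (M.res hV (θ.app U n))) :
    ∃ ρ : M ≅ (pullback h).obj N, ∀ U n, pullInv ρ U n = θ.app U n := by
  have : IsIso (adjointHom h θ) := isIso_of_isGenerator _ fun x => by
    obtain ⟨U, n, V, hV, hx, hn, hθ⟩ := H x
    refine ⟨V, _, hx, (hn.pullback h).res hV, ?_⟩
    rw [app_res, adjointHom_section]
    exact hθ
  exact ⟨(asIso (adjointHom h θ)).symm, fun U n => adjointHom_section h θ U n⟩

/-- Isomorphisms `M ≅ h^* N` are equal if their inverses agree on local generators of `N`. -/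
theorem pullInv_ext_of_isGenerator {ρ ρ' : M ≅ (pullback h).obj N}
    (H : ∀ x : S, ∃ (U : T.Opens) (n : Γ(N, U)), h x ∈ U ∧ N.IsGenerator n ∧
      pullInv ρ U n = pullInv ρ' U n) : ρ = ρ' := by
  refine pullInv_ext fun U n => (map_eqToHom_self rfl _).trans ?_
  refine eq_of_locally_eq fun x hx => ?_
  obtain ⟨V, g, hV, hg, e⟩ := H x
  refine ⟨h ⁻¹ᵁ (U ⊓ V), h.preimage_mono inf_le_left, ⟨hx, hV⟩, ?_⟩
  obtain ⟨c, hc⟩ := (hg.res inf_le_right).exists_eq_smul (N.res inf_le_left n)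
  have hU : U ⊓ V ≤ U := inf_le_left
  rw [← pullInv_res ρ hU, ← pullInv_res ρ' hU, hc, pullInv_smul, pullInv_smul, pullInv_res,
    pullInv_res, e]

variable {L : X.Modules} {r : ℕ} {f : S ⟶ X} {g : T ⟶ X}

/-- The compatibility of `ρ` with `φ` and `ψ` may be checked on local generators. -/
theorem rootCompat_of_isGenerator (φ : M.tensorPower r ≅ (pullback f).obj L)
    (ψ : N.tensorPower r ≅ (pullback g).obj L) (w : h ≫ g = f) (ρ : M ≅ (pullback h).obj N)
    (H : ∀ x : S, ∃ (U : T.Opens) (n : Γ(N, U)), h x ∈ U ∧ N.IsGenerator n ∧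
      φ.hom.app (h ⁻¹ᵁ U) (M.tprod r (h ⁻¹ᵁ U) fun _ => pullInv ρ U n) =
        (pullbackTrans h g f w L).hom.app (h ⁻¹ᵁ U)
          (pullbackSection h _ U (ψ.hom.app U (N.tprod r U fun _ => n)))) :
    RootCompat φ ψ h w ρ := by
  intro U n
  refine eq_of_locally_eq fun x hx => ?_
  obtain ⟨V, m, hV, hm, e⟩ := H x
  refine ⟨h ⁻¹ᵁ (U ⊓ V), h.preimage_mono inf_le_left, ⟨hx, hV⟩, ?_⟩
  choose c hc using fun i => (hm.res inf_le_right).exists_eq_smul (N.res inf_le_left (n i) :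
    Γ(N, U ⊓ V))
  have hU : U ⊓ V ≤ U := inf_le_left
  have hV' : U ⊓ V ≤ V := inf_le_right
  have h0 : ∀ i, M.res (h.preimage_mono hU) (pullInv ρ U (n i)) =
      h.app (U ⊓ V) (c i) • M.res (h.preimage_mono hV') (pullInv ρ V m) := fun i => by
    rw [← pullInv_res ρ hU, hc, pullInv_smul, pullInv_res]
  -- both sides are multilinear and compatible with restriction
  have h1 : ((pullback f).obj L).res (h.preimage_mono inf_le_left) (φ.hom.app (h ⁻¹ᵁ U)
      (M.tprod r (h ⁻¹ᵁ U) fun i => pullInv ρ U (n i))) =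
      (∏ i, h.app (U ⊓ V) (c i)) • ((pullback f).obj L).res (h.preimage_mono inf_le_right)
        (φ.hom.app (h ⁻¹ᵁ V) (M.tprod r (h ⁻¹ᵁ V) fun _ => pullInv ρ V m)) := by
    rw [← app_res, ← app_res, res_tprod, res_tprod, ← Hom.app_smul,
      ← MultilinearMap.map_smul_univ]
    simp only [h0]
  have h2 : ((pullback f).obj L).res (h.preimage_mono inf_le_left)
      ((pullbackTrans h g f w L).hom.app (h ⁻¹ᵁ U)
          (pullbackSection h _ U (ψ.hom.app U (N.tprod r U n)))) =
      (∏ i, h.app (U ⊓ V) (c i)) • ((pullback f).obj L).res (h.preimage_mono inf_le_right)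
        ((pullbackTrans h g f w L).hom.app (h ⁻¹ᵁ V)
          (pullbackSection h _ V (ψ.hom.app V (N.tprod r V fun _ => m)))) := by
    rw [← app_res, ← app_res, ← pullbackSection_res _ _ hU, ← pullbackSection_res _ _ hV',
      ← app_res, ← app_res,
      res_tprod, res_tprod, ← Hom.app_smul, ← map_prod, ← pullbackSection_smul, ← Hom.app_smul,
      ← MultilinearMap.map_smul_univ]
    simp only [hc]
  exact h1.trans ((congrArg _ (congrArg _ e)).trans h2.symm)

end AlgebraicGeometry.Scheme.Modules

namespace AlgebraicGeometry

open Scheme.Modules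

variable {X : Scheme.{u}} {L : X.Modules} {s : Γ(L, ⊤)} {r : ℕ}

theorem RootObj.exists_isGenerator (A : RootObj L r) (x : A.T) :
    ∃ (U : A.T.Opens) (n : Γ(A.M, U)), x ∈ U ∧ A.M.IsGenerator n :=
  (isInvertible_iff A.M).1 A.isInvertible x

namespace RootHom

variable {A B C : RootObj L r}

/-- An arrow is determined by its components over any morphism equal to its base; this avoids
rewriting along equations between morphisms of schemes. -/
theorem exists_eq_mk (a : RootHom A B) {k : A.T ⟶ B.T} (e : a.h = k) :
    ∃ w ρ comm, a = ⟨k, w, ρ, comm⟩ := by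
  subst e
  exact ⟨_, _, _, rfl⟩

/-- Equal arrows have the same effect on sections, up to the identification of the open sets over
which the results live. -/
theorem pullInv_congr {a b : RootHom A B} (e : a = b) (U : B.T.Opens) (n : Γ(B.M, U)) :
    A.M.presheaf.map (eqToHom (by rw [e] : b.h ⁻¹ᵁ U = a.h ⁻¹ᵁ U)).op (pullInv a.ρ U n) =
      pullInv b.ρ U n := by
  subst e
  exact map_eqToHom_self rfl _

/-- Every arrow of roots is cartesian: existence of lifts. -/
theorem exists_lift (a : RootHom A C) (b : RootHom B C) (h : A.T ⟶ B.T) (e : h ≫ b.h = a.h) :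
    ∃ c : RootHom A B, c.h = h ∧ c.comp b = a := by
  obtain ⟨w, ρ, comm, rfl⟩ := a.exists_eq_mk e.symm
  have w' : h ≫ B.f = A.f := by rw [← b.w, ← Category.assoc, w]
  let τ : A.M ≅ (pullback h).obj B.M :=
    ρ ≪≫ (pullbackComp h b.h).symm.app C.M ≪≫ (pullback h).mapIso b.ρ.symm
  have hτ : ∀ U n, pullInv τ (b.h ⁻¹ᵁ U) (pullInv b.ρ U n) = pullInv ρ U n := by
    intro U n
    have h1 : pullInv (τ ≪≫ (pullback h).mapIso b.ρ ≪≫ (pullbackComp h b.h).app C.M) U n =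
      pullInv τ (b.h ⁻¹ᵁ U) (pullInv b.ρ U n) := pullInv_comp τ b.ρ U n
    have h2 : τ ≪≫ (pullback h).mapIso b.ρ ≪≫ (pullbackComp h b.h).app C.M = ρ := by
      ext1
      simp [τ]
    rw [← h1, h2]
  refine ⟨⟨h, w', τ, rootCompat_of_isGenerator _ _ _ _ fun x => ?_⟩, rfl, ?_⟩
  · obtain ⟨U, n, hx, hn⟩ := C.exists_isGenerator (b.h (h x))
    refine ⟨b.h ⁻¹ᵁ U, _, hx, hn.pullInv b.ρ, ?_⟩
    rw [hτ]
    refine (comm U fun _ => n).trans ?_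
    refine (pullbackTrans_comp_section h b.h C.f B.f A.f b.w w' w L U _).trans ?_
    exact congr((pullbackTrans h B.f A.f w' L).hom.app (h ⁻¹ᵁ b.h ⁻¹ᵁ U)
      (pullbackSection h _ (b.h ⁻¹ᵁ U) $((b.comm U fun _ => n).symm)))
  · refine ext_pull rfl fun U n => (map_eqToHom_self rfl _).trans ?_
    rw [comp_pull]
    exact hτ U n

/-- Every arrow of roots is cartesian: uniqueness of lifts. -/
theorem eq_of_comp_eq {c c' : RootHom A B} (b : RootHom B C) (hh : c.h = c'.h)
    (e : c.comp b = c'.comp b) : c = c' := by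
  obtain ⟨w, ρ, comm, rfl⟩ := c.exists_eq_mk hh
  have : ρ = c'.ρ := pullInv_ext_of_isGenerator fun x => by
    obtain ⟨U, n, hx, hn⟩ := C.exists_isGenerator (b.h (c'.h x))
    refine ⟨b.h ⁻¹ᵁ U, _, hx, hn.pullInv b.ρ, ?_⟩
    have h1 := pullInv_congr e U n
    rw [comp_pull, comp_pull] at h1
    exact (map_eqToHom_self rfl _).symm.trans h1
  subst this
  rfl

end RootHom

namespace RootStackHom

variable {A B C : RootStackObj L s r}

/-- Every arrow of the root stack is cartesian: the lift of the underlying arrow of roots respects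
the sections. -/
theorem exists_lift (a : RootStackHom A C) (b : RootStackHom B C) (h : A.T ⟶ B.T)
    (e : h ≫ b.hom.h = a.hom.h) : ∃ c : RootStackHom A B, c.hom.h = h ∧ c.comp b = a := by
  obtain ⟨c, hc, e'⟩ := RootHom.exists_lift a.hom b.hom h e
  refine ⟨⟨c, ?_⟩, hc, RootStackHom.ext e'⟩
  have ha := (mapsSection_iff _ _ _).1 a.mapsSection
  have hb := (mapsSection_iff _ _ _).1 b.mapsSection
  rw [mapsSection_iff, ← hb, ← ha]
  have h1 := RootHom.pullInv_congr e' ⊤ C.t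
  rw [RootHom.comp_pull] at h1
  exact (map_eqToHom_self rfl _).symm.trans h1

theorem eq_of_comp_eq {c c' : RootStackHom A B} (b : RootStackHom B C)
    (hh : c.hom.h = c'.hom.h) (e : c.comp b = c'.comp b) : c = c' :=
  RootStackHom.ext (RootHom.eq_of_comp_eq b.hom hh congr(($e).hom))

end RootStackHom

end AlgebraicGeometry

/-! ### Disjoint open covers -/

namespace AlgebraicGeometry

open Scheme.Modules

/-- The morphisms `j i : T i ⟶ T` are open immersions identifying `T` with the disjoint union of
the `T i`. -/
structure IsDisjointCover {ι : Type u} {T : Scheme.{u}} {T' : ι → Scheme.{u}}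
    (j : ∀ i, T' i ⟶ T) : Prop where
  isOpenImmersion : ∀ i, IsOpenImmersion (j i)
  covers : ∀ x : T, ∃ i y, j i y = x
  disjoint : ∀ i k y z, j i y = j k z → i = k

namespace IsDisjointCover

variable {ι : Type u} {T : Scheme.{u}} {T' : ι → Scheme.{u}} {j : ∀ i, T' i ⟶ T}

theorem hom_ext (H : IsDisjointCover j) {Z : Scheme.{u}} {a b : T ⟶ Z}
    (hab : ∀ i, j i ≫ a = j i ≫ b) : a = b := by
  have := H.isOpenImmersion
  let 𝒰 : T.OpenCover := Scheme.Cover.mkOfCovers ι T' j (fun x => H.covers x)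
      (fun i => H.isOpenImmersion i)
  exact Scheme.Cover.hom_ext 𝒰 _ _ hab

theorem nonempty_isColimit (H : IsDisjointCover j) :
    Nonempty (Limits.IsColimit (Limits.Cofan.mk T j)) := by
  have := H.isOpenImmersion
  refine nonempty_isColimit_cofanMk_of j ?_ ?_
  · refine top_le_iff.1 fun x _ => ?_
    obtain ⟨i, y, rfl⟩ := H.covers x
    exact Opens.mem_iSup.2 ⟨i, y, rfl⟩
  · intro i k hik
    refine disjoint_iff.2 (le_bot_iff.1 ?_)
    rintro _ ⟨⟨y, rfl⟩, z, hz⟩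
    exact hik (H.disjoint i k y z hz.symm)

/-- Coproducts of schemes are disjoint unions of open subschemes. -/
theorem of_isColimit (H : Limits.IsColimit (Limits.Cofan.mk T j)) : IsDisjointCover j := by
  let e : ∐ T' ≅ T := Limits.IsColimit.coconePointUniqueUpToIso (Limits.colimit.isColimit _) H
  have he : ∀ i, Limits.Sigma.ι T' i ≫ e.hom = j i := fun i =>
    Limits.IsColimit.comp_coconePointUniqueUpToIso_hom (Limits.colimit.isColimit _) H ⟨i⟩
  have he' : ∀ i y, e.hom (Limits.Sigma.ι T' i y) = j i y := fun i y => by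
    rw [← he, Scheme.Hom.comp_apply]
  refine ⟨fun i => by rw [← he]; infer_instance, fun x => ?_, fun i k y z hyz => ?_⟩
  · obtain ⟨⟨i, y⟩, hy⟩ := (sigmaMk T').surjective (e.inv x)
    rw [sigmaMk_mk] at hy
    exact ⟨i, y, by rw [← he', hy, ← Scheme.Hom.comp_apply, e.inv_hom_id]; rfl⟩
  · by_contra hik
    have h1 := disjoint_opensRange_sigmaι T' i k hik
    rw [← he', ← he'] at hyz
    have h2 : Limits.Sigma.ι T' i y = Limits.Sigma.ι T' k z := by
      have := congr(e.inv $hyz)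
      simpa only [← Scheme.Hom.comp_apply, Category.assoc, e.hom_inv_id, Category.comp_id] using
          this
    exact (disjoint_iff_inf_le.1 h1 (show _ ∈ _ from ⟨⟨y, rfl⟩, ⟨z, h2.symm⟩⟩) : _)

/-- A sheaf on one piece has no nonzero sections over an open set contained in another piece. -/
theorem subsingleton (H : IsDisjointCover j) {i k : ι} (hik : i ≠ k) {V : T.Opens}
    (hV : ∀ x ∈ V, ∃ y, j i y = x) (K : (T' k).Modules) : Subsingleton Γ(K, j k ⁻¹ᵁ V) := by
  refine ⟨fun a b => eq_of_locally_eq fun z hz => ?_⟩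
  obtain ⟨y, hy⟩ := hV _ hz
  exact (hik (H.disjoint i k y z hy)).elim

end IsDisjointCover

theorem bijective_pullInv {T T' : Scheme.{u}} (j : T' ⟶ T) [IsOpenImmersion j] {M : T.Modules}
    {M' : T'.Modules} (σ : M' ≅ (pullback j).obj M) {V : T.Opens} (hV : V ≤ j.opensRange) :
    Function.Bijective (pullInv σ V) :=
  ((ConcreteCategory.isIso_iff_bijective (σ.inv.app (j ⁻¹ᵁ V))).1 inferInstance).comp
    (bijective_pullbackSection j M hV)

theorem isGenerator_pullInv_iff {T T' : Scheme.{u}} (j : T' ⟶ T) [IsOpenImmersion j] {M : T.Modules}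
    {M' : T'.Modules} (σ : M' ≅ (pullback j).obj M) {V : T.Opens} (hV : V ≤ j.opensRange)
    (m : Γ(M, V)) : M'.IsGenerator (pullInv σ V m) ↔ M.IsGenerator m := by
  rw [← isGenerator_pullback_iff j M hV]
  refine ⟨fun h => ?_, fun h => h.map_iso σ.symm⟩
  have h1 := h.map_iso σ
  have h2 := congr(($(σ.inv_hom_id)).app (j ⁻¹ᵁ V) (pullbackSection j M V m))
  exact h2 ▸ h1

namespace IsDisjointCover

variable {ι : Type u} {T : Scheme.{u}} {T' : ι → Scheme.{u}} {j : ∀ i, T' i ⟶ T}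

section Sections

variable (H : IsDisjointCover j) {M : T.Modules} {M' : ∀ i, (T' i).Modules}
  (σ : ∀ i, M' i ≅ (pullback (j i)).obj M)

include H

/-- Sections of a sheaf on a disjoint union are determined by their restrictions to the pieces. -/
theorem section_ext {V : T.Opens} {m m' : Γ(M, V)}
    (h : ∀ i, pullInv (σ i) V m = pullInv (σ i) V m') : m = m' := by
  refine eq_of_locally_eq fun x hx => ?_
  obtain ⟨i, y, rfl⟩ := H.covers x
  have := H.isOpenImmersion i
  have hle : V ⊓ (j i).opensRange ≤ V := inf_le_left
  refine ⟨V ⊓ (j i).opensRange, hle, ⟨hx, y, rfl⟩,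
    (bijective_pullInv (j i) (σ i) (V := V ⊓ (j i).opensRange) inf_le_right).1 ?_⟩
  rw [pullInv_res, pullInv_res, h]

/-- A sheaf on a disjoint union is given by the sheaves on the pieces. -/
theorem exists_section {V : T.Opens} (k : ∀ i, Γ(M' i, j i ⁻¹ᵁ V)) :
    ∃ m : Γ(M, V), ∀ i, pullInv (σ i) V m = k i := by
  obtain ⟨m, hm⟩ := exists_of_locally_unique (M := M) (U := V)
    (fun W m => ∃ h : W ≤ V, ∀ i, pullInv (σ i) W m = (M' i).res ((j i).preimage_mono h) (k i))
    (fun W W' h m ⟨h1, h2⟩ => ⟨h.trans h1, fun i => by rw [pullInv_res, h2, res_res]⟩)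
    (fun W _ m m' ⟨h1, h2⟩ ⟨_, h2'⟩ => H.section_ext σ fun i => (h2 i).trans (h2' i).symm)
    (fun x hx => by
      obtain ⟨i, y, rfl⟩ := H.covers x
      have := H.isOpenImmersion i
      have hle : V ⊓ (j i).opensRange ≤ V := inf_le_left
      obtain ⟨m, hm⟩ := (bijective_pullInv (j i) (σ i) (V := V ⊓ (j i).opensRange) inf_le_right).2
        ((M' i).res ((j i).preimage_mono hle) (k i))
      refine ⟨V ⊓ (j i).opensRange, hle, ⟨hx, y, rfl⟩, m, hle, fun i' => ?_⟩
      by_cases hi : i = i'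
      · subst hi
        exact hm
      · have := H.subsingleton hi (V := V ⊓ (j i).opensRange) (fun x hx => hx.2) (M' i')
        exact Subsingleton.elim _ _)
  refine ⟨m, fun i => eq_of_locally_eq fun y hy => ?_⟩
  obtain ⟨W, h, hW, _, e⟩ := hm _ hy
  exact ⟨j i ⁻¹ᵁ W, (j i).preimage_mono h, hW, by rw [← pullInv_res (σ i) h, e]⟩

end Sections

/-- Products of sheaves of modules are computed on sections. -/
theorem exists_product {ι : Type u} (F : ι → T.Modules) : ∃ (M : T.Modules) (θ : ∀ i, M ⟶ F i),
    ∀ V, Function.Bijective fun (m : Γ(M, V)) i => (θ i).app V m := by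
  refine ⟨∏ᶜ F, fun i => Limits.Pi.π F i, fun V => ?_⟩
  let E : TopCat.Presheaf Ab.{u} T ⥤ Type u :=
    (evaluation (Opens T)ᵒᵖ Ab.{u}).obj (op V) ⋙ forget Ab.{u}
  have : Limits.PreservesLimitsOfSize.{u, u} E :=
    inferInstanceAs (Limits.PreservesLimitsOfSize.{u, u}
      ((evaluation (Opens T)ᵒᵖ Ab.{u}).obj (op V) ⋙ forget Ab.{u}))
  let G : T.Modules ⥤ Type u := toPresheaf T ⋙ E
  have h := Limits.isLimitOfPreserves G (Limits.limit.isLimit (Discrete.functor F))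
  have h2 := (Limits.Types.isLimit_iff _).1 ⟨h⟩
  constructor
  · intro m m' hmm
    obtain ⟨x, -, hx⟩ := h2 (fun i => (Limits.Pi.π F i.as).app V m) (by
      rintro ⟨i⟩ ⟨k⟩ ⟨⟨f⟩⟩
      obtain rfl : i = k := f
      rfl)
    rw [hx m fun i => rfl, hx m' fun i => congr_fun hmm.symm i.as]
  · intro k
    obtain ⟨x, hx, -⟩ := h2 (fun i => k i.as) (by
      rintro ⟨i⟩ ⟨k⟩ ⟨⟨f⟩⟩
      obtain rfl : i = k := f
      rfl)
    exact ⟨x, funext fun i => hx ⟨i⟩⟩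

variable (H : IsDisjointCover j)

include H

/-- Invertible sheaves on the pieces of a disjoint union glue to an invertible sheaf, namely to
the product of the direct images. -/
theorem exists_glue_modules (M' : ∀ i, (T' i).Modules) (hM' : ∀ i, (M' i).IsInvertible) :
    ∃ M : T.Modules, M.IsInvertible ∧ Nonempty (∀ i, M' i ≅ (pullback (j i)).obj M) := by
  obtain ⟨M, θ, hθ⟩ := exists_product fun i => (pushforward (j i)).obj (M' i)
  have bij : ∀ i V, (∀ x ∈ V, ∃ y, j i y = x) → Function.Bijective ((θ i).app V) := by
    intro i V hV
    have hs : ∀ k, k ≠ i → Subsingleton Γ((pushforward (j k)).obj (M' k), V) :=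
      fun k hk => H.subsingleton hk.symm hV (M' k)
    constructor
    · intro m m' hmm
      refine (hθ V).1 (funext fun k => ?_)
      by_cases hk : k = i
      · subst hk
        exact hmm
      · have := hs k hk
        exact Subsingleton.elim _ _
    · intro x
      classical
      obtain ⟨m, hm⟩ := (hθ V).2 (Function.update 0 i x)
      refine ⟨m, ?_⟩
      have := congr_fun hm i
      rwa [Function.update_self] at this
  have iso : ∀ i, IsIso (adjointHom (j i) (θ i)) := by
    intro i
    have := H.isOpenImmersion i
    refine isIso_of_bijective _ fun W => ?_
    obtain ⟨V, hV, rfl⟩ : ∃ V : T.Opens, V ≤ (j i).opensRange ∧ W = j i ⁻¹ᵁ V :=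
      ⟨j i ''ᵁ W, (j i).image_le_opensRange W, ((j i).preimage_image_eq W).symm⟩
    refine (Function.Bijective.of_comp_iff _ (bijective_pullbackSection (j i) M hV)).1 ?_
    have h1 : (adjointHom (j i) (θ i)).app (j i ⁻¹ᵁ V) ∘ pullbackSection (j i) M V =
        (θ i).app V := funext fun m => adjointHom_section (j i) (θ i) V m
    rw [h1]
    exact bij i V fun x hx => hV hx
  refine ⟨M, ?_, ⟨fun i => (asIso (adjointHom (j i) (θ i))).symm⟩⟩
  rw [isInvertible_iff]
  intro x
  obtain ⟨i, y, rfl⟩ := H.covers x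
  have := H.isOpenImmersion i
  obtain ⟨W, n, hy, hn⟩ := (isInvertible_iff _).1 (hM' i) y
  obtain ⟨V, hV, rfl⟩ : ∃ V : T.Opens, V ≤ (j i).opensRange ∧ W = j i ⁻¹ᵁ V :=
    ⟨j i ''ᵁ W, (j i).image_le_opensRange W, ((j i).preimage_image_eq W).symm⟩
  let σ := (asIso (adjointHom (j i) (θ i))).symm
  obtain ⟨m, rfl⟩ := (bijective_pullInv (j i) σ hV).2 n
  exact ⟨V, m, hy, (isGenerator_pullInv_iff (j i) σ hV m).1 hn⟩

/-- Isomorphisms of invertible sheaves on the pieces of a disjoint union glue. -/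
theorem exists_glue_iso {W : Scheme.{u}} {h : T ⟶ W} {M : T.Modules} {M' : ∀ i, (T' i).Modules}
    {N : W.Modules} (hN : N.IsInvertible) (σ : ∀ i, M' i ≅ (pullback (j i)).obj M)
    (ρ : ∀ i, M' i ≅ (pullback (j i ≫ h)).obj N) :
    ∃ ρ' : M ≅ (pullback h).obj N, ∀ i U n,
      pullInv (σ i) (h ⁻¹ᵁ U) (pullInv ρ' U n) = pullInv (ρ i) U n := by
  choose f hf using fun (U : W.Opens) (n : Γ(N, U)) =>
    H.exists_section σ (V := h ⁻¹ᵁ U) fun i => pullInv (ρ i) U n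
  let θ : N ⟶ (pushforward h).obj M := homOfSections f
    (fun U n n' => H.section_ext σ fun i => by
      refine Eq.trans ?_ (pullInv_add (σ i) (h ⁻¹ᵁ U) (f U n) (f U n')).symm
      rw [hf, hf, hf, pullInv_add]
      rfl)
    (fun U c n => H.section_ext σ fun i => by
      refine (hf U (c • n) i).trans ?_
      refine Eq.trans ?_ (pullInv_smul (σ i) (h ⁻¹ᵁ U) (h.app U c) (f U n)).symm
      rw [pullInv_smul, hf, Scheme.Hom.comp_app]
      rfl)
    (fun U V hV n => H.section_ext σ fun i => by
      refine (hf V _ i).trans ?_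
      refine Eq.trans ?_ (pullInv_res (σ i) (h.preimage_mono hV) (f U n)).symm
      rw [pullInv_res, hf]
      rfl)
  obtain ⟨ρ', hρ'⟩ := exists_iso_of_isGenerator θ fun x => by
    obtain ⟨U, n, hx, hn⟩ := (isInvertible_iff N).1 hN (h x)
    obtain ⟨i, y, rfl⟩ := H.covers x
    have := H.isOpenImmersion i
    have hle : h ⁻¹ᵁ U ⊓ (j i).opensRange ≤ h ⁻¹ᵁ U := inf_le_left
    refine ⟨U, n, h ⁻¹ᵁ U ⊓ (j i).opensRange, hle, ⟨hx, y, rfl⟩, hn, ?_⟩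
    have h1 : (M' i).IsGenerator (pullInv (σ i) _ (M.res hle (f U n))) := by
      rw [pullInv_res, hf]
      exact (hn.pullInv (ρ i)).res ((j i).preimage_mono hle)
    exact (isGenerator_pullInv_iff (j i) (σ i) inf_le_right _).1 h1
  exact ⟨ρ', fun i U n => by rw [hρ']; exact hf U n i⟩

end IsDisjointCover

end AlgebraicGeometry

/-! ### Gluing and restricting roots -/

namespace AlgebraicGeometry

open Scheme.Modules

variable {X : Scheme.{u}} {L : X.Modules} {s : Γ(L, ⊤)} {r : ℕ}

section

variable {ι : Type u} {T : Scheme.{u}} {T' : ι → Scheme.{u}} {j : ∀ i, T' i ⟶ T}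

/-- Sections of `f^* L` on a disjoint union are determined by their pull-backs to the pieces. -/
theorem IsDisjointCover.pullback_section_ext (H : IsDisjointCover j) {f : T ⟶ X}
    {f' : ∀ i, T' i ⟶ X} (w : ∀ i, j i ≫ f = f' i) {V : T.Opens}
    {k k' : Γ((pullback f).obj L, V)}
    (h : ∀ i, (pullbackTrans (j i) f (f' i) (w i) L).hom.app (j i ⁻¹ᵁ V)
        (pullbackSection (j i) _ V k) =
      (pullbackTrans (j i) f (f' i) (w i) L).hom.app (j i ⁻¹ᵁ V)
        (pullbackSection (j i) _ V k')) : k = k' :=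
  H.section_ext (fun i => (pullbackTrans (j i) f (f' i) (w i) L).symm) h

end

/-- Arrows from the pieces of a disjoint union to a root glue to an arrow. -/
theorem RootHom.exists_glue {ι : Type u} {A : ι → RootObj L r} {B C : RootObj L r}
    (α : ∀ i, RootHom (A i) B) (H : IsDisjointCover fun i => (α i).h)
    (a : ∀ i, RootHom (A i) C) (h : B.T ⟶ C.T) (e : ∀ i, (α i).h ≫ h = (a i).h) :
    ∃ b : RootHom B C, b.h = h ∧ ∀ i, (α i).comp b = a i := by
  choose w ρ comm ha using fun i => (a i).exists_eq_mk (e i).symm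
  obtain ⟨ρ', hρ'⟩ := H.exists_glue_iso C.isInvertible (fun i => (α i).ρ) ρ
  have w' : h ≫ C.f = B.f := H.hom_ext fun i => by
    rw [← Category.assoc, w, (α i).w]
  refine ⟨⟨h, w', ρ', fun U n => ?_⟩, rfl, fun i => ?_⟩
  · refine H.pullback_section_ext (fun i => (α i).w) fun i => ?_
    refine ((α i).comm (h ⁻¹ᵁ U) _).symm.trans ?_
    refine Eq.trans ?_ (pullbackTrans_comp_section (α i).h h C.f B.f (A i).f w' (α i).w (w i) L U _)
    refine Eq.trans ?_ (comm i U n)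
    exact congr((A i).φ.hom.app _ ((A i).M.tprod r _ $(funext fun k => hρ' i U (n k))))
  · rw [ha]
    refine RootHom.ext_pull rfl fun U n => (map_eqToHom_self rfl _).trans ?_
    rw [RootHom.comp_pull]
    exact hρ' i U n

theorem RootStackHom.exists_glue {ι : Type u} {A : ι → RootStackObj L s r}
    {B C : RootStackObj L s r}
    (α : ∀ i, RootStackHom (A i) B) (H : IsDisjointCover fun i => (α i).hom.h)
    (a : ∀ i, RootStackHom (A i) C) (h : B.T ⟶ C.T) (e : ∀ i, (α i).hom.h ≫ h = (a i).hom.h) :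
    ∃ b : RootStackHom B C, b.hom.h = h ∧ ∀ i, (α i).comp b = a i := by
  obtain ⟨b, rfl, hb⟩ := RootHom.exists_glue (fun i => (α i).hom) H (fun i => (a i).hom) h e
  refine ⟨⟨b, ?_⟩, rfl, fun i => RootStackHom.ext (hb i)⟩
  rw [mapsSection_iff]
  refine H.section_ext (fun i => (α i).hom.ρ) fun i => ?_
  have h1 := (mapsSection_iff _ _ _).1 (α i).mapsSection
  have h2 := (mapsSection_iff _ _ _).1 (a i).mapsSection
  have h3 := RootHom.pullInv_congr (hb i) ⊤ C.t
  rw [RootHom.comp_pull] at h3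
  exact ((map_eqToHom_self rfl _).symm.trans h3).trans (h2.trans h1.symm)

/-- Arrows of roots are determined by their restrictions to the pieces of a disjoint union. -/
theorem RootHom.eq_of_glue {ι : Type u} {A : ι → RootObj L r} {B C : RootObj L r}
    (α : ∀ i, RootHom (A i) B) (H : IsDisjointCover fun i => (α i).h)
    {b b' : RootHom B C} (hh : b.h = b'.h) (e : ∀ i, (α i).comp b = (α i).comp b') : b = b' := by
  obtain ⟨w, ρ, comm, rfl⟩ := b.exists_eq_mk hh
  refine RootHom.ext_pull rfl fun U n => (map_eqToHom_self rfl _).trans ?_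
  refine H.section_ext (fun i => (α i).ρ) fun i => ?_
  have h1 := RootHom.pullInv_congr (e i) U n
  rw [RootHom.comp_pull, RootHom.comp_pull] at h1
  exact (map_eqToHom_self rfl _).symm.trans h1

theorem RootStackHom.eq_of_glue {ι : Type u} {A : ι → RootStackObj L s r} {B C : RootStackObj L s r}
    (α : ∀ i, RootStackHom (A i) B) (H : IsDisjointCover fun i => (α i).hom.h)
    {b b' : RootStackHom B C} (hh : b.hom.h = b'.hom.h)
    (e : ∀ i, (α i).comp b = (α i).comp b') : b = b' :=
  RootStackHom.ext (RootHom.eq_of_glue (fun i => (α i).hom) H hh fun i => congr(($(e i)).hom))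

/-- Objects of the root stack over the pieces of a disjoint union `T` glue to an object
over `T`. -/
theorem RootStackObj.exists_glue {ι : Type u} (A : ι → RootStackObj L s r) {T : Scheme.{u}}
    (j : ∀ i, (A i).T ⟶ T) (H : IsDisjointCover j) (f : T ⟶ X) (w : ∀ i, j i ≫ f = (A i).f) :
    ∃ (M : T.Modules) (hM : M.IsInvertible) (φ : M.tensorPower r ≅ (pullback f).obj L)
      (t : Γ(M, ⊤)) (ht : IsRootSection φ s t),
      ∃ α : ∀ i, RootStackHom (A i) ⟨⟨T, f, M, hM, φ⟩, t, ht⟩, ∀ i, (α i).hom.h = j i := by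
  obtain ⟨M, hM, ⟨σ⟩⟩ := H.exists_glue_modules (fun i => (A i).M) fun i => (A i).isInvertible
  let K := (pullback f).obj L
  let τ : ∀ i, (pullback (A i).f).obj L ≅ (pullback (j i)).obj K :=
    fun i => (pullbackTrans (j i) f (A i).f (w i) L).symm
  choose μ hμ using fun (V : T.Opens) (m : Fin r → Γ(M, V)) =>
    H.exists_section τ (V := V) fun i =>
      (A i).φ.hom.app _ ((A i).M.tprod r _ fun k => pullInv (σ i) V (m k))
  have upd : ∀ i V (m : Fin r → Γ(M, V)) (k : Fin r) (x : Γ(M, V)),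
      (fun k' => pullInv (σ i) V (Function.update m k x k')) =
        Function.update (fun k' => pullInv (σ i) V (m k')) k (pullInv (σ i) V x) := by
    intro i V m k x
    funext k'
    by_cases h : k' = k
    · subst h; simp
    · simp [h]
  let μ' : ∀ V, MultilinearMap Γ(T, V) (fun _ : Fin r => Γ(M, V)) Γ(K, V) := fun V =>
    { toFun := μ V
      map_update_add' := by
        intro inst m k x y
        obtain rfl : inst = instDecidableEqFin r := Subsingleton.elim _ _
        refine H.section_ext τ fun i => ?_
        rw [pullInv_add, hμ, hμ, hμ, upd, upd, upd, pullInv_add, MultilinearMap.map_update_add]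
        exact map_add _ _ _
      map_update_smul' := by
        intro inst m k c x
        obtain rfl : inst = instDecidableEqFin r := Subsingleton.elim _ _
        refine H.section_ext τ fun i => ?_
        rw [pullInv_smul, hμ, hμ, upd, upd, pullInv_smul, MultilinearMap.map_update_smul]
        exact Hom.app_smul _ _ _ }
  obtain ⟨a, ha⟩ := exists_tensorPower_desc μ' (fun U V h m => H.section_ext τ fun i => by
    refine (pullInv_res (τ i) h _).trans ?_
    refine Eq.trans ?_ (hμ V _ i).symm
    refine congr(((pullback (A i).f).obj L).res ((j i).preimage_mono h) $(hμ U m i)).trans ?_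
    rw [← app_res, res_tprod]
    simp only [pullInv_res])
  have ha' : ∀ i V (m : Fin r → Γ(M, V)), pullInv (τ i) V (a.app V (M.tprod r V m)) =
      (A i).φ.hom.app _ ((A i).M.tprod r _ fun k => pullInv (σ i) V (m k)) := by
    intro i V m
    rw [ha]
    exact hμ V m i
  have : IsIso a := isIso_of_isGenerator a fun x => by
    obtain ⟨i, y, hy⟩ := H.covers x
    have := H.isOpenImmersion i
    obtain ⟨U, m, hx, hm⟩ := (isInvertible_iff M).1 hM x
    have hle : U ⊓ (j i).opensRange ≤ U := inf_le_left
    refine ⟨U ⊓ (j i).opensRange, _, ⟨hx, y, hy⟩, (hm.res hle).tprod, ?_⟩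
    rw [← isGenerator_pullInv_iff (j i) (τ i) inf_le_right, ha']
    exact ((hm.res hle).pullInv (σ i)).tprod.map_iso (A i).φ
  obtain ⟨t, ht⟩ := H.exists_section σ (V := ⊤) fun i => (A i).t
  have hsec : IsRootSection (asIso a) s t := by
    refine H.section_ext τ fun i => (ha' i ⊤ _).trans ?_
    have h1 : (A i).φ.hom.app ⊤ ((A i).M.tprod r ⊤ fun _ => (A i).t) =
      pullbackSection (A i).f L ⊤ s := (A i).isRootSection
    refine Eq.trans ?_ (h1.trans (Eq.trans ?_ (pullbackTrans_section (j i) f (A i).f (w i) L ⊤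
        s).symm))
    · exact congr((A i).φ.hom.app ⊤ ((A i).M.tprod r ⊤ $(funext fun _ => ht i)))
    · exact (map_eqToHom_self rfl _).symm
  exact ⟨M, hM, asIso a, t, hsec, fun i => ⟨⟨j i, w i, σ i, fun U n => (ha' i U n).symm⟩,
    (mapsSection_iff _ _ _).2 (ht i)⟩, fun i => rfl⟩

end AlgebraicGeometry

namespace AlgebraicGeometry

open Scheme.Modules

variable {X : Scheme.{u}} {L : X.Modules} {s : Γ(L, ⊤)} {r : ℕ}

/-- The map `n₁, …, nᵣ ↦ j^* ψ (n₁ ⊗ ⋯ ⊗ nᵣ)` on the restriction of `N` along an open immersion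
`j`. -/
noncomputable def restrictMultilinear {T S : Scheme.{u}} (j : S ⟶ T) [IsOpenImmersion j]
    {N : T.Modules} {g : T ⟶ X} (ψ : N.tensorPower r ≅ (pullback g).obj L) (f : S ⟶ X)
    (w : j ≫ g = f) (V : S.Opens) :
    MultilinearMap Γ(S, V) (fun _ : Fin r => Γ(N.restrict j, V)) Γ((pullback f).obj L, V) where
  toFun n := ((pullback f).obj L).res (j.preimage_image_eq V).ge
    ((pullbackTrans j g f w L).hom.app _ (pullbackSection j _ (j ''ᵁ V)
      (ψ.hom.app _ (N.tprod r (j ''ᵁ V) n))))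
  map_update_add' := by
    intro inst n k x y
    obtain rfl : inst = instDecidableEqFin r := Subsingleton.elim _ _
    have h := (N.tprod r (j ''ᵁ V)).map_update_add n k x y
    refine congr(((pullback f).obj L).res (j.preimage_image_eq V).ge
      ((pullbackTrans j g f w L).hom.app _ (pullbackSection j _ (j ''ᵁ V)
        (ψ.hom.app _ $h)))).trans ?_
    rw [map_add, pullbackSection_add, map_add, map_add]
    rfl
  map_update_smul' := by
    intro inst n k c x
    obtain rfl : inst = instDecidableEqFin r := Subsingleton.elim _ _
    have h := (N.tprod r (j ''ᵁ V)).map_update_smul n k ((j.appIso V).inv c) x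
    refine congr(((pullback f).obj L).res (j.preimage_image_eq V).ge
      ((pullbackTrans j g f w L).hom.app _ (pullbackSection j _ (j ''ᵁ V)
        (ψ.hom.app _ $h)))).trans ?_
    rw [Hom.app_smul, pullbackSection_smul, Hom.app_smul, Scheme.Modules.res_smul]
    have h2 : S.res (j.preimage_image_eq V).ge (j.app (j ''ᵁ V) ((j.appIso V).inv c)) = c := by
      have h3 := congr($(j.appIso_inv_app V) c)
      refine congr(S.res (j.preimage_image_eq V).ge $h3).trans ?_
      have h4 := congr($(S.presheaf.map_comp (eqToHom (j.preimage_image_eq V)).op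
        (homOfLE (j.preimage_image_eq V).ge).op) c)
      refine h4.symm.trans ?_
      exact congr($(S.presheaf.map_id (op V)) c)
    rw [h2]
    rfl

/-- For the restriction `N.restrict j`, which is one of the choices of `j^* N`, pull-back of
sections over `U` is restriction to the intersection of `U` with the image of `j`. -/
theorem pullInv_restrict {T S : Scheme.{u}} (j : S ⟶ T) [IsOpenImmersion j] (N : T.Modules)
    (U : T.Opens) (n : Γ(N, U)) :
    pullInv ((restrictFunctorIsoPullback j).app N) U n = N.res (j.image_preimage_le U) n := by
  rw [pullInv, pullbackSection_eq_restrict]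
  exact congr(($((restrictFunctorIsoPullback j).hom_inv_id_app N)).app (j ⁻¹ᵁ U)
      (N.res (j.image_preimage_le U) n))

/-- The root stack is fibered: objects can be restricted along open immersions. -/
theorem RootStackObj.exists_restrict (B : RootStackObj L s r) {T : Scheme.{u}} (j : T ⟶ B.T)
    [IsOpenImmersion j] (f : T ⟶ X) (w : j ≫ B.f = f) :
    ∃ (M : T.Modules) (hM : M.IsInvertible) (φ : M.tensorPower r ≅ (pullback f).obj L)
      (t : Γ(M, ⊤)) (ht : IsRootSection φ s t),
      ∃ α : RootStackHom ⟨⟨T, f, M, hM, φ⟩, t, ht⟩ B, α.hom.h = j := by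
  let M := B.M.restrict j
  let σ : M ≅ (pullback j).obj B.M := (restrictFunctorIsoPullback j).app B.M
  obtain ⟨a, ha⟩ := exists_tensorPower_desc (restrictMultilinear j B.φ f w) (fun U V h m => by
    have hle : j ''ᵁ V ≤ j ''ᵁ U := j.image_mono h
    refine Eq.trans ?_ congr(((pullback f).obj L).res (j.preimage_image_eq V).ge
      ((pullbackTrans j B.f f w L).hom.app _ (pullbackSection j _ (j ''ᵁ V)
        (B.φ.hom.app _ $(res_tprod hle m)))))
    rw [app_res, pullbackSection_res, app_res, Scheme.Modules.res_res]
    exact Scheme.Modules.res_res _ _ _ _)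
  -- the compatibility of `σ` with the isomorphism induced by `a`
  have comm : ∀ (U : B.T.Opens) (n : Fin r → Γ(B.M, U)),
      a.app (j ⁻¹ᵁ U) (M.tprod r (j ⁻¹ᵁ U) fun i => pullInv σ U (n i)) =
        (pullbackTrans j B.f f w L).hom.app (j ⁻¹ᵁ U)
          (pullbackSection j _ U (B.φ.hom.app U (B.M.tprod r U n))) := by
    intro U n
    rw [ha]
    have hle := j.image_preimage_le U
    have h1 : ∀ i, pullInv σ U (n i) = B.M.res hle (n i) := fun i => pullInv_restrict j B.M U (n i)
    simp only [h1]
    refine congr(((pullback f).obj L).res (j.preimage_image_eq (j ⁻¹ᵁ U)).ge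
      ((pullbackTrans j B.f f w L).hom.app _ (pullbackSection j _ (j ''ᵁ j ⁻¹ᵁ U)
        (B.φ.hom.app _ $((res_tprod hle n).symm))))).trans ?_
    rw [app_res, pullbackSection_res, app_res, Scheme.Modules.res_res, Scheme.Modules.res_self]
  have gen : ∀ x : T, ∃ (U : B.T.Opens) (n : Γ(B.M, U)), j x ∈ U ∧ B.M.IsGenerator n :=
    fun x => B.exists_isGenerator (j x)
  have : IsIso a := isIso_of_isGenerator a fun x => by
    obtain ⟨U, n, hx, hn⟩ := gen x
    refine ⟨j ⁻¹ᵁ U, _, hx, (hn.pullInv σ).tprod, ?_⟩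
    rw [comm U fun _ => n]
    exact ((hn.tprod.map_iso B.φ).pullback j).map_iso (pullbackTrans j B.f f w L)
  have hM : M.IsInvertible := (isInvertible_iff M).2 fun x => by
    obtain ⟨U, n, hx, hn⟩ := gen x
    exact ⟨j ⁻¹ᵁ U, _, hx, hn.pullInv σ⟩
  have hsec : IsRootSection (asIso a) s (pullInv σ ⊤ B.t) := by
    refine (comm ⊤ fun _ => B.t).trans ?_
    have h1 : B.φ.hom.app ⊤ (B.M.tprod r ⊤ fun _ => B.t) = pullbackSection B.f L ⊤ s :=
      B.isRootSection
    rw [h1]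
    exact (pullbackTrans_section j B.f f w L ⊤ s).trans (map_eqToHom_self rfl _)
  exact ⟨M, hM, asIso a, pullInv σ ⊤ B.t, hsec, ⟨⟨j, w, σ, comm⟩, (mapsSection_iff _ _ _).2 rfl⟩,
      rfl⟩

end AlgebraicGeometry

/-! ### The zero locus of a section -/

namespace AlgebraicGeometry

open Scheme.Modules

variable {X : Scheme.{u}} {L : X.Modules} {s : Γ(L, ⊤)}

/-- If `s = a • e` on `U` with `e` a generator, the pull-back of `s` vanishes over `U` if and only
if that of `a` does. -/
theorem pullbackSection_res_eq_zero_iff {T : Scheme.{u}} (f : T ⟶ X) {U : X.Opens} {e : Γ(L, U)}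
    (he : L.IsGenerator e) {a : Γ(X, U)} (ha : L.res le_top s = a • e) :
    ((pullback f).obj L).res (le_top : f ⁻¹ᵁ U ≤ ⊤) (pullbackSection f L ⊤ s) = 0 ↔
      f.app U a = 0 := by
  have h1 : ((pullback f).obj L).res (le_top : f ⁻¹ᵁ U ≤ ⊤) (pullbackSection f L ⊤ s) =
      f.app U a • pullbackSection f L U e := by
    rw [← pullbackSection_smul, ← ha]
    exact (pullbackSection_res f L (le_top : U ≤ ⊤) s).symm
  rw [h1]
  constructor
  · intro h
    exact (he.pullback f).smul_injective (h.trans (zero_smul Γ(T, f ⁻¹ᵁ U) _).symm)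
  · intro h
    rw [h]
    exact zero_smul Γ(T, f ⁻¹ᵁ U) _

/-- If `f^* s` vanishes, so does the pull-back of each local equation of `s`. -/
theorem app_eq_zero_of_pullbackSection_eq_zero {T : Scheme.{u}} {f : T ⟶ X} {U : X.Opens}
    {e : Γ(L, U)} (he : L.IsGenerator e) {a : Γ(X, U)} (ha : L.res le_top s = a • e)
    (hf : pullbackSection f L ⊤ s = 0) : f.app U a = 0 :=
  (pullbackSection_res_eq_zero_iff f he ha).1
    (congr(((pullback f).obj L).res (le_top : f ⁻¹ᵁ U ≤ ⊤) $hf).trans (map_zero _))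

/-- The section `f^* s` vanishes if the local equations of `s` pull back to zero, for one equation
near each point. -/
theorem pullbackSection_eq_zero_of_locally {T : Scheme.{u}} (f : T ⟶ X)
    (H : ∀ z : T, ∃ (U : X.Opens) (e : Γ(L, U)) (a : Γ(X, U)), f z ∈ U ∧ L.IsGenerator e ∧
      L.res le_top s = a • e ∧ f.app U a = 0) : pullbackSection f L ⊤ s = 0 := by
  refine Scheme.Modules.eq_of_locally_eq (M := (pullback f).obj L) fun z _ => ?_
  obtain ⟨U, e, a, hz, he, ha, h0⟩ := H z
  exact ⟨f ⁻¹ᵁ U, le_top, hz,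
    ((pullbackSection_res_eq_zero_iff f he ha).2 h0).trans (map_zero _).symm⟩

/-- The closed subscheme of an affine open `U` defined by a function `a` on `U`. It is used only
through the kernel of restriction to it, which is the ideal generated by `a`. -/
theorem IsAffineOpen.exists_zeroLocus {U : X.Opens} (hU : IsAffineOpen U) (a : Γ(X, U)) :
    ∃ (Z : Scheme.{u}) (g : Z ⟶ U.toScheme), QuasiCompact g ∧
      ∀ c : Γ(X, U), (g ≫ U.ι).app U c = 0 ↔ a ∣ c := by
  have : IsAffine U.toScheme := hU
  let I := Scheme.IdealSheafData.ofIdealTop (Ideal.span {U.topIso.inv a})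
  refine ⟨I.subscheme, I.subschemeι, inferInstance, fun c => ?_⟩
  have hV : IsAffineOpen (U.ι ⁻¹ᵁ U) := U.ι_preimage_self ▸ isAffineOpen_top _
  have h1 : ∀ d : Γ(U.toScheme, U.ι ⁻¹ᵁ U),
      I.subschemeι.app (U.ι ⁻¹ᵁ U) d = 0 ↔ d ∈ I.ideal ⟨_, hV⟩ := fun d => by
    rw [← I.ker_subschemeι_app ⟨_, hV⟩]
    rfl
  have h2 : I.ideal ⟨_, hV⟩ = Ideal.span {U.ι.app U a} := by
    rw [Scheme.IdealSheafData.ofIdealTop_ideal, Ideal.map_span, Set.image_singleton]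
    congr 2
    rw [Scheme.Opens.ι_app]
    exact congr($(X.presheaf.map_comp (eqToHom (U.ι_image_top)).op _) a).symm
  have h3 : Function.Injective (U.ι.app U) := fun x y hxy => by
    have h4 : U.ι ''ᵁ U.ι ⁻¹ᵁ U = U := by simp
    rw [Scheme.Opens.ι_app] at hxy
    have h5 := congr(X.res h4.ge $hxy)
    have h6 : ∀ z : Γ(X, U), X.res h4.ge (X.res h4.le z) = z := fun z => by
      rw [Scheme.res_res, Scheme.res_self]
    exact (h6 x).symm.trans (h5.trans (h6 y))
  have h4 : Function.Surjective (U.ι.app U) := fun z => by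
    have h4 : U.ι ''ᵁ U.ι ⁻¹ᵁ U = U := by simp
    refine ⟨X.res h4.ge z, ?_⟩
    rw [Scheme.Opens.ι_app]
    exact (X.res_res h4.ge h4.le z).trans (X.res_self _ z)
  refine (h1 _).trans ?_
  rw [h2, Ideal.mem_span_singleton]
  constructor
  · rintro ⟨d, hd⟩
    obtain ⟨d, rfl⟩ := h4 d
    exact ⟨d, h3 (hd.trans (map_mul _ _ _).symm)⟩
  · exact fun h => map_dvd _ h

/-- Locally on `X` the section `s` is a function times a generator of `L`. -/
theorem exists_affine_generator (hL : L.IsInvertible) (s : Γ(L, ⊤)) {x : X} {W : X.Opens}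
    (hx : x ∈ W) :
    ∃ (U : X.Opens) (e : Γ(L, U)) (a : Γ(X, U)), IsAffineOpen U ∧ x ∈ U ∧ U ≤ W ∧ L.IsGenerator e ∧
      L.res le_top s = a • e := by
  obtain ⟨U, e, hU, he⟩ := (isInvertible_iff L).1 hL x
  obtain ⟨V, hV, hxV, hVU⟩ := exists_isAffineOpen_mem_and_subset (x := x) (U := U ⊓ W) ⟨hU, hx⟩
  have he' := he.res (hVU.trans inf_le_left)
  obtain ⟨a, ha⟩ := he'.exists_eq_smul (L.res le_top s)
  exact ⟨V, _, a, hV, hxV, hVU.trans inf_le_right, he', ha⟩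

/-- On a noetherian scheme there is an ideal sheaf `K` such that `s` vanishes on the closed
subscheme defined by `K`, and every morphism on which `s` vanishes factors through this closed
subscheme. Being a finite intersection of kernels of quasi-compact morphisms, `K` can be computed
on affine opens. -/
theorem exists_zeroLocus_ideal [IsNoetherian X] (hL : L.IsInvertible) (s : Γ(L, ⊤)) :
    ∃ K : X.IdealSheafData, pullbackSection K.subschemeι L ⊤ s = 0 ∧
      ∀ {T : Scheme.{u}} (f : T ⟶ X), pullbackSection f L ⊤ s = 0 → K ≤ f.ker := by
  choose U e a hU hxU _ he ha using fun x : X => exists_affine_generator hL s (Opens.mem_top x)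
  choose Z g hg hZ using fun x => (hU x).exists_zeroLocus (a x)
  obtain ⟨t, ht⟩ := CompactSpace.elim_nhds_subcover (fun x => (U x : Set X))
    fun x => (U x).isOpen.mem_nhds (hxU x)
  have hcover : ∀ y : X, ∃ x : t, y ∈ U x := fun y => by
    have hy : y ∈ ⋃ x ∈ t, (U x : Set X) := ht ▸ Set.mem_univ y
    obtain ⟨x, hx, hy⟩ := Set.mem_iUnion₂.1 hy
    exact ⟨⟨x, hx⟩, hy⟩
  have hqc : ∀ x, QuasiCompact (g x ≫ (U x).ι) := fun x => inferInstance
  let K : X.IdealSheafData := ⨅ x : t, (g x ≫ (U x).ι).ker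
  have hK : ∀ (V : X.affineOpens) (c : Γ(X, V)),
      c ∈ K.ideal V ↔ ∀ x : t, (g x ≫ (U x).ι).app V c = 0 := fun V c => by
    rw [Scheme.IdealSheafData.ideal_iInf, iInf_apply, Ideal.mem_iInf]
    refine forall_congr' fun x => ?_
    rw [Scheme.Hom.ker_apply]
    rfl
  -- the section vanishes on each of the closed subschemes of the `U x`
  have hs : ∀ x, pullbackSection (g x ≫ (U x).ι) L ⊤ s = 0 := fun x => by
    refine pullbackSection_eq_zero_of_locally _ fun z =>
      ⟨U x, e x, a x, ?_, he x, ha x, (hZ x (a x)).2 dvd_rfl⟩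
    rw [Scheme.Hom.comp_apply]
    exact (g x z).2
  refine ⟨K, ?_, fun {T} f hf => ?_⟩
  · refine pullbackSection_eq_zero_of_locally _ fun z => ?_
    obtain ⟨V, e', a', hV, hzV, _, he', ha'⟩ :=
      exists_affine_generator hL s (Opens.mem_top (K.subschemeι z))
    refine ⟨V, e', a', hzV, he', ha', ?_⟩
    have h1 : a' ∈ K.ideal ⟨V, hV⟩ :=
      (hK _ _).2 fun x => app_eq_zero_of_pullbackSection_eq_zero he' ha' (hs x)
    rw [← K.ker_subschemeι_app ⟨V, hV⟩] at h1
    exact h1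
  · refine Scheme.IdealSheafData.le_ofIdeals_iff.2 fun V c hc => ?_
    refine RingHom.mem_ker.2 (Scheme.eq_of_locally_eq fun z hz => ?_)
    obtain ⟨x, hx⟩ := hcover (f z)
    obtain ⟨W, hW, hzW, hWle⟩ := exists_isAffineOpen_mem_and_subset (x := f z) (U := V.1 ⊓ U x)
        ⟨hz, hx⟩
    have hWV : W ≤ V.1 := hWle.trans inf_le_left
    have hWU : W ≤ U x := hWle.trans inf_le_right
    refine ⟨f ⁻¹ᵁ W, f.preimage_mono hWV, hzW, ?_⟩
    have h1 : X.res hWV c ∈ K.ideal ⟨W, hW⟩ := by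
      rw [← K.map_ideal (U := ⟨W, hW⟩) (V := V) hWV]
      exact Ideal.mem_map_of_mem _ hc
    have h2 : K.ideal ⟨U x, hU x⟩ ≤ Ideal.span {a x} := fun d hd =>
      Ideal.mem_span_singleton.2 ((hZ x d).1 ((hK _ _).1 hd x))
    have h3 : K.ideal ⟨W, hW⟩ ≤ Ideal.span {X.res hWU (a x)} := by
      rw [← K.map_ideal (U := ⟨W, hW⟩) (V := ⟨U x, hU x⟩) hWU]
      refine (Ideal.map_mono h2).trans ?_
      rw [Ideal.map_span, Set.image_singleton]
      exact le_rfl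
    obtain ⟨d, hd⟩ := Ideal.mem_span_singleton.1 (h3 h1)
    have h4 : f.app (U x) (a x) = 0 :=
      app_eq_zero_of_pullbackSection_eq_zero (he x) (ha x) hf
    rw [map_zero]
    refine (f.app_res hWV c).symm.trans ?_
    rw [hd, map_mul, f.app_res hWU, h4, map_zero, zero_mul]

/-- The infimum defining the zero locus is attained: it is the ideal of
`exists_zeroLocus_ideal`. -/
theorem zeroLocusIdeal_spec [IsNoetherian X] (hL : L.IsInvertible) (s : Γ(L, ⊤)) :
    pullbackSection (zeroLocusι L s) L ⊤ s = 0 ∧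
      ∀ {T : Scheme.{u}} (f : T ⟶ X), pullbackSection f L ⊤ s = 0 → zeroLocusIdeal L s ≤ f.ker := by
  obtain ⟨K, hK, hK'⟩ := exists_zeroLocus_ideal hL s
  have h : zeroLocusIdeal L s = K := le_antisymm (sInf_le hK) (le_sInf fun I hI => by
    have := hK' I.subschemeι hI
    rwa [Scheme.IdealSheafData.ker_subschemeι] at this)
  have h2 : ∀ I : X.IdealSheafData, I = K → pullbackSection I.subschemeι L ⊤ s = 0 := by
    rintro _ rfl
    exact hK
  exact ⟨h2 _ h, fun f hf => h ▸ hK' f hf⟩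

theorem pullbackSection_zeroLocusι [IsNoetherian X] (hL : L.IsInvertible) (s : Γ(L, ⊤)) :
    pullbackSection (zeroLocusι L s) L ⊤ s = 0 :=
  (zeroLocusIdeal_spec hL s).1

instance (L : X.Modules) (s : Γ(L, ⊤)) : IsClosedImmersion (zeroLocusι L s) :=
  inferInstanceAs (IsClosedImmersion (zeroLocusIdeal L s).subschemeι)

/-- The universal property of the zero locus. -/
theorem exists_zeroLocus_lift [IsNoetherian X] (hL : L.IsInvertible) {T : Scheme.{u}} (f : T ⟶ X)
    (hf : pullbackSection f L ⊤ s = 0) : ∃ g : T ⟶ zeroLocus L s, g ≫ zeroLocusι L s = f := by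
  have h : (zeroLocusι L s).ker ≤ f.ker :=
    (zeroLocusIdeal L s).ker_subschemeι.le.trans ((zeroLocusIdeal_spec hL s).2 f hf)
  exact ⟨IsClosedImmersion.lift (zeroLocusι L s) f h, IsClosedImmersion.lift_fac _ _ _⟩

end AlgebraicGeometry

/-! ### Roots of unity -/

open Polynomial in
/-- If `w ^ r = 1` and `R` has all the `r`-th roots of unity, the product of the `w - z` over the
roots of unity `z` vanishes, and the sum of its partial products, being the value of the
derivative of `X ^ r - 1`, is `r w ^ (r - 1)`. -/
theorem IsPrimitiveRoot.prod_sum_eq_of_pow_eq_one {R B : Type*} [CommRing R] [IsDomain R]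
    [DecidableEq R] [CommRing B] {r : ℕ}
    (hr : 0 < r) {ω : R} (hω : IsPrimitiveRoot ω r) (σ : R →+* B) {w : B} (hw : w ^ r = 1) :
    ∏ z ∈ nthRootsFinset r (1 : R), (w - σ z) = 0 ∧
      ∑ z ∈ nthRootsFinset r (1 : R), ∏ z' ∈ (nthRootsFinset r (1 : R)).erase z, (w - σ z') =
        r * w ^ (r - 1) := by
  have h := X_pow_sub_one_eq_prod hr hω
  constructor
  · have h1 := congr(eval₂ σ w $h)
    rw [eval₂_finsetProd] at h1
    simpa [hw] using h1.symm
  · have h1 := congr(eval₂ σ w (derivative $h))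
    rw [derivative_prod_finset, eval₂_finsetSum] at h1
    simpa [eval₂_finsetProd, derivative_X_pow] using h1.symm

/-- For `z ≠ 1` an `r`-th root of unity, `r` is the sum of the `1 - z ^ k`, hence `1 - z` divides
`r`. -/
theorem isUnit_one_sub_of_pow_eq_one {R : Type*} [CommRing R] [IsDomain R] {r : ℕ}
    (hr : IsUnit (r : R)) {z : R} (hz : z ^ r = 1) (hz1 : z ≠ 1) : IsUnit (1 - z) := by
  have h1 : ∑ k ∈ Finset.range r, z ^ k = 0 := by
    have h := mul_neg_geom_sum z r
    rw [hz, sub_self] at h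
    exact (mul_eq_zero.1 h).resolve_left (sub_ne_zero.2 hz1.symm)
  have h2 : (r : R) = ∑ k ∈ Finset.range r, (1 - z ^ k) := by
    rw [Finset.sum_sub_distrib, h1]
    simp
  refine isUnit_of_dvd_unit ?_ hr
  rw [h2]
  exact Finset.dvd_sum fun k _ => one_sub_dvd_one_sub_pow z k

namespace AlgebraicGeometry

variable {S₀ : Scheme.{u}} {r : ℕ}

/-- The properties of `Spec ℤ[r⁻¹, ζ_r]` which matter: its ring of functions is a domain
containing a primitive `r`-th root of unity and `1 / r`. -/
structure HasRootsOfUnity (S₀ : Scheme.{u}) (r : ℕ) : Prop where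
  isDomain : IsDomain Γ(S₀, ⊤)
  isUnit : IsUnit (r : Γ(S₀, ⊤))
  exists_root : ∃ ω : Γ(S₀, ⊤), IsPrimitiveRoot ω r

theorem hasRootsOfUnity_baseScheme (r : ℕ) [NeZero r] : HasRootsOfUnity (baseScheme.{u} r) r := by
  let A := CyclotomicRing r ℤ ℚ
  let R := Localization.Away (r : A)
  have hr : (r : A) ≠ 0 := fun h => NeZero.ne r (by
    have h1 : algebraMap ℤ A r = algebraMap ℤ A 0 := by rw [map_natCast, map_zero, h]
    exact_mod_cast CyclotomicRing.algebraBase_injective r ℤ ℚ h1)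
  have hle : Submonoid.powers (r : A) ≤ nonZeroDivisors A :=
    powers_le_nonZeroDivisors_of_noZeroDivisors hr
  have : IsDomain R := IsLocalization.isDomain_of_le_nonZeroDivisors R hle
  have h1 : IsUnit (r : R) := by
    rw [← map_natCast (algebraMap A R) r]
    exact IsLocalization.Away.algebraMap_isUnit (S := R) (r : A)
  obtain ⟨ω, hω⟩ := IsCyclotomicExtension.exists_isPrimitiveRoot ℤ A (Set.mem_singleton r)
      (NeZero.ne r)
  have h2 : IsPrimitiveRoot (algebraMap A R ω) r :=
    hω.map_of_injective (IsLocalization.injective R hle)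
  let e : Γ(baseScheme.{u} r, ⊤) ≃+* R :=
    (Scheme.ΓSpecIso (.of (ULift.{u} R))).commRingCatIsoToRingEquiv.trans ULift.ringEquiv
  refine ⟨e.toMulEquiv.isDomain, ?_, e.symm _, h2.map_of_injective e.symm.injective⟩
  have := h1.map e.symm
  simpa using this

/-- Locally an `r`-th root of unity `w` is one of those of the base: by
`IsPrimitiveRoot.prod_sum_eq_of_pow_eq_one`, in the local ring at a point some product of all but
one of the factors `w - z` is a unit, whereas the product of all the factors is zero. -/
theorem HasRootsOfUnity.exists_eq_pullbackRoot [NeZero r] (H : HasRootsOfUnity S₀ r)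
    {T : Scheme.{u}} (q : T ⟶ S₀)
    {U : T.Opens} {w : Γ(T, U)} (hw : w ^ r = 1) {x : T} (hx : x ∈ U) :
    ∃ (ζ : rootsOfUnity r Γ(S₀, ⊤)) (V : T.Opens) (hV : V ≤ U), x ∈ V ∧
      T.res hV w = T.res le_top (pullbackRoot q ζ : Γ(T, ⊤)) := by
  classical
  have := H.isDomain
  obtain ⟨ω, hω⟩ := H.exists_root
  let σ : Γ(S₀, ⊤) →+* Γ(T, U) := (T.res le_top).comp q.appTop.hom
  obtain ⟨h1, h2⟩ := hω.prod_sum_eq_of_pow_eq_one (NeZero.pos r) σ hw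
  set P := Polynomial.nthRootsFinset r (1 : Γ(S₀, ⊤))
  have hu : IsUnit ((r : Γ(T, U)) * w ^ (r - 1)) := by
    refine IsUnit.mul ?_ ((IsUnit.of_pow_eq_one hw (NeZero.ne r)).pow _)
    simpa using H.isUnit.map σ
  rw [← h2] at hu
  have hu' := hu.map (T.presheaf.germ U x hx).hom
  rw [map_sum] at hu'
  obtain ⟨z, hz, hzu⟩ := IsLocalRing.exists_of_isUnit_sum hu'
  -- on the open set where the other factors are invertible, `w - z` vanishes
  let g := ∏ z' ∈ P.erase z, (w - σ z')
  have hV : T.basicOpen g ≤ U := T.basicOpen_le g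
  have hg : IsUnit (T.res hV g) := T.toRingedSpace.isUnit_res_basicOpen g
  have hw0 : T.res hV (w - σ z) = 0 := by
    have h3 := congr(T.res hV $h1)
    rw [← Finset.mul_prod_erase P _ hz, map_mul, map_zero] at h3
    exact (hg.mul_left_eq_zero).1 h3
  have hz1 : z ^ r = 1 := (Polynomial.mem_nthRootsFinset (NeZero.pos r) _).1 hz
  refine ⟨rootsOfUnity.mkOfPowEq z hz1, T.basicOpen g, hV, (T.mem_basicOpen g x hx).2 hzu, ?_⟩
  rw [map_sub, sub_eq_zero] at hw0
  exact hw0.trans (T.res_res _ _ _)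

theorem pullbackRoot_inv {T : Scheme.{u}} (q : T ⟶ S₀) (ζ : rootsOfUnity r Γ(S₀, ⊤)) :
    pullbackRoot q ζ⁻¹ = (pullbackRoot q ζ)⁻¹ :=
  map_inv (Units.map q.appTop.hom.toMonoidHom) _

theorem HasRootsOfUnity.isUnit_one_sub_pullbackRoot (H : HasRootsOfUnity S₀ r) {T : Scheme.{u}}
    (q : T ⟶ S₀)
    {ζ : rootsOfUnity r Γ(S₀, ⊤)} (hζ : ζ ≠ 1) : IsUnit (1 - (pullbackRoot q ζ : Γ(T, ⊤))) := by
  have := H.isDomain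
  have h1 : ((ζ : Γ(S₀, ⊤)ˣ) : Γ(S₀, ⊤)) ^ r = 1 := by
    have h : (ζ : Γ(S₀, ⊤)ˣ) ^ r = 1 := ζ.2
    rw [← Units.val_pow_eq_pow_val, h, Units.val_one]
  have h2 : ((ζ : Γ(S₀, ⊤)ˣ) : Γ(S₀, ⊤)) ≠ 1 := fun h => hζ (Subtype.ext (Units.ext h))
  have h3 := (isUnit_one_sub_of_pow_eq_one H.isUnit h1 h2).map q.appTop.hom
  rw [map_sub, map_one] at h3
  exact h3

/-- The difference of two roots of unity of the base is invertible. -/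
theorem HasRootsOfUnity.isUnit_pullbackRoot_sub (H : HasRootsOfUnity S₀ r) {T : Scheme.{u}}
    (q : T ⟶ S₀)
    {ζ ζ' : rootsOfUnity r Γ(S₀, ⊤)} (hζ : ζ ≠ ζ') :
    IsUnit ((pullbackRoot q ζ : Γ(T, ⊤)) - pullbackRoot q ζ') := by
  have h1 : ζ⁻¹ * ζ' ≠ 1 := fun h => hζ (inv_mul_eq_one.1 h)
  have h2 := (pullbackRoot q ζ).isUnit.mul (H.isUnit_one_sub_pullbackRoot q h1)
  have h3 : pullbackRoot q (ζ⁻¹ * ζ') = (pullbackRoot q ζ)⁻¹ * pullbackRoot q ζ' := by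
    rw [← pullbackRoot_inv]
    exact map_mul (Units.map q.appTop.hom.toMonoidHom) _ _
  rwa [h3, Units.val_mul, mul_sub, mul_one, Units.mul_inv_cancel_left] at h2

/-- Roots of unity of the base which agree on a nonempty open subset of `T` are equal. -/
theorem HasRootsOfUnity.eq_of_res_eq (H : HasRootsOfUnity S₀ r) {T : Scheme.{u}} (q : T ⟶ S₀)
    {ζ ζ' : rootsOfUnity r Γ(S₀, ⊤)} {V : T.Opens} {x : T} (hx : x ∈ V)
    (h : T.res (le_top : V ≤ ⊤) (pullbackRoot q ζ : Γ(T, ⊤)) =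
      T.res (le_top : V ≤ ⊤) (pullbackRoot q ζ' : Γ(T, ⊤))) : ζ = ζ' := by
  by_contra hne
  have h2 := (H.isUnit_pullbackRoot_sub q hne).map (T.res (le_top : V ≤ ⊤))
  rw [map_sub, h, sub_self] at h2
  have : Nontrivial Γ(T, V) := have : Nonempty V := ⟨⟨x, hx⟩⟩; inferInstance
  exact not_isUnit_zero h2

end AlgebraicGeometry

/-! ### Automorphisms of roots -/

namespace AlgebraicGeometry

open Scheme.Modules

variable {X S₀ : Scheme.{u}} {L : X.Modules} {s : Γ(L, ⊤)} {r : ℕ}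

/-- The automorphism `ρ` of `M`, given as an isomorphism with the pull-back along the identity,
acts on the sections of `M` over the open subsets of `U` by multiplication by `z`; more precisely,
this is the action of the inverse of `ρ`. -/
def ActsBy {T : Scheme.{u}} {M : T.Modules} (ρ : M ≅ (pullback (𝟙 T)).obj M) (z : Γ(T, ⊤))
    (U : T.Opens) : Prop :=
  ∀ (W : T.Opens), W ≤ U → ∀ n : Γ(M, W), pullInv ρ W n = T.res (le_top : W ≤ ⊤) z • n

/-- The action may be tested on a generator. -/
theorem ActsBy.of_isGenerator {T : Scheme.{u}} {M : T.Modules} {ρ : M ≅ (pullback (𝟙 T)).obj M}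
    {z : Γ(T, ⊤)}
    {U : T.Opens} {m : Γ(M, U)} (hm : M.IsGenerator m)
        (h : pullInv ρ U m = T.res (le_top : U ≤ ⊤) z • m) :
    ActsBy ρ z U := by
  intro W hW n
  obtain ⟨c, rfl⟩ := (hm.res hW).exists_eq_smul n
  refine (pullInv_smul ρ W c _).trans ?_
  have h1 : (pullInv ρ W (M.res hW m) : Γ(M, W)) = T.res (le_top : W ≤ ⊤) z • M.res hW m := by
    refine (pullInv_res ρ hW m).trans (congr(M.res hW $h).trans ((M.res_smul hW _ _).trans ?_))
    rw [Scheme.res_res]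
  exact (congrArg (fun k : Γ(M, W) => c • k) h1).trans (smul_comm c (T.res le_top z) (M.res hW m))

/-- There is a largest open set on which the automorphism acts by a given function. -/
theorem ActsBy.sSup {T : Scheme.{u}} {M : T.Modules} {ρ : M ≅ (pullback (𝟙 T)).obj M}
    {z : Γ(T, ⊤)} :
    ActsBy ρ z (sSup {U | ActsBy ρ z U}) := by
  intro W hW n
  refine Scheme.Modules.eq_of_locally_eq (M := M) fun x hx => ?_
  obtain ⟨U, hU, hxU⟩ := Opens.mem_sSup.1 (hW hx)
  have hWU : W ⊓ U ≤ W := inf_le_left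
  refine ⟨W ⊓ U, hWU, ⟨hx, hxU⟩, ?_⟩
  refine (pullInv_res ρ hWU n).symm.trans ((hU _ inf_le_right _).trans ?_)
  exact (congr($(T.res_res _ hWU z) • M.res hWU n)).symm.trans (M.res_smul hWU _ _).symm

/-- An automorphism of an `r`-th root acts locally by an `r`-th root of unity `c`: compatibility
with `φ` means that it fixes `m ⊗ ⋯ ⊗ m`, which it multiplies by `c ^ r`. -/
theorem RootObj.exists_scalar (A : RootObj L r) (w : 𝟙 A.T ≫ A.f = A.f)
    (ρ : A.M ≅ (pullback (𝟙 A.T)).obj A.M) (comm : RootCompat A.φ A.φ (𝟙 A.T) w ρ) {U : A.T.Opens}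
    {m : Γ(A.M, U)} (hm : A.M.IsGenerator m) : ∃ c : Γ(A.T, U), pullInv ρ U m = c • m ∧
      c ^ r = 1 := by
  obtain ⟨c, hc⟩ := hm.exists_eq_smul (pullInv ρ U m : Γ(A.M, U))
  refine ⟨c, hc, ?_⟩
  have h1 := comm U fun _ => m
  have h2 := RootCompat.id A.φ w U fun _ => m
  have h3 : A.φ.hom.app U (A.M.tprod r U fun _ => (pullInv ρ U m : Γ(A.M, U))) =
      A.φ.hom.app U (A.M.tprod r U fun _ => m) := by
    refine h1.trans (h2.symm.trans ?_)
    exact congr(A.φ.hom.app U (A.M.tprod r U $(funext fun _ => pullInv_id A.M U m)))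
  have h4 : (A.M.tprod r U fun _ => (pullInv ρ U m : Γ(A.M, U))) = A.M.tprod r U fun _ => m := by
    have h5 := congr(A.φ.inv.app U $h3)
    have h6 : ∀ y, A.φ.inv.app U (A.φ.hom.app U y) = y := fun y =>
        congr(($(A.φ.hom_inv_id)).app U y)
    rwa [h6, h6] at h5
  have h5 : c ^ r • (A.M.tprod r U fun _ => m) = (1 : Γ(A.T, U)) • A.M.tprod r U fun _ => m := by
    rw [← tprod_smul, one_smul, ← h4, hc]
  exact hm.tprod.smul_injective h5

/-- The base of an automorphism of an `r`-th root is the disjoint union of the open subschemes on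
which it is multiplication by a given root of unity. The inverse occurs because `ActsBy` describes
the inverse of `ρ`. -/
theorem RootObj.exists_decomposition [NeZero r] (H : HasRootsOfUnity S₀ r) (A : RootObj L r)
    (q : A.T ⟶ S₀)
    (w : 𝟙 A.T ≫ A.f = A.f)
    (ρ : A.M ≅ (pullback (𝟙 A.T)).obj A.M) (comm : RootCompat A.φ A.φ (𝟙 A.T) w ρ) :
    ∃ U : rootsOfUnity r Γ(S₀, ⊤) → A.T.Opens, (IsDisjointCover fun ζ => (U ζ).ι) ∧
      ∀ ζ, ActsBy ρ (↑(pullbackRoot q ζ)⁻¹ : Γ(A.T, ⊤)) (U ζ) := by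
  let U := fun ζ : rootsOfUnity r Γ(S₀, ⊤) => sSup
      {U | ActsBy ρ (↑(pullbackRoot q ζ)⁻¹ : Γ(A.T, ⊤)) U}
  have hU : ∀ ζ, ActsBy ρ (↑(pullbackRoot q ζ)⁻¹ : Γ(A.T, ⊤)) (U ζ) := fun ζ => ActsBy.sSup
  refine ⟨U, ⟨fun ζ => inferInstance, fun x => ?_, fun ζ ζ' y z hyz => ?_⟩, hU⟩
  · obtain ⟨V, m, hx, hm⟩ := A.exists_isGenerator x
    obtain ⟨c, hc, hcr⟩ := A.exists_scalar w ρ comm hm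
    obtain ⟨ζ, W, hW, hxW, h⟩ := H.exists_eq_pullbackRoot q hcr hx
    have h1 : ActsBy ρ (pullbackRoot q ζ : Γ(A.T, ⊤)) W := by
      refine ActsBy.of_isGenerator (hm.res hW) ((pullInv_res ρ hW m).trans ?_)
      rw [← h]
      exact congr(A.M.res hW $hc).trans (A.M.res_smul hW c m)
    refine ⟨ζ⁻¹, ⟨x, Opens.mem_sSup.2 ⟨W, ?_, hxW⟩⟩, rfl⟩
    change ActsBy ρ _ W
    rw [pullbackRoot_inv, inv_inv]
    exact h1
  · have hy : (U ζ).ι y ∈ U ζ := y.2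
    have hz : (U ζ).ι y ∈ U ζ' := by
      rw [hyz]
      exact z.2
    obtain ⟨V, m, hx, hm⟩ := A.exists_isGenerator ((U ζ).ι y)
    have hVV : V ⊓ (U ζ ⊓ U ζ') ≤ V := inf_le_left
    have h1 := hU ζ (V ⊓ (U ζ ⊓ U ζ')) (inf_le_right.trans inf_le_left) (A.M.res hVV m)
    have h2 := hU ζ' (V ⊓ (U ζ ⊓ U ζ')) (inf_le_right.trans inf_le_right) (A.M.res hVV m)
    have h3 := (hm.res hVV).smul_injective (h1.symm.trans h2)
    rw [← pullbackRoot_inv, ← pullbackRoot_inv] at h3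
    exact inv_injective (H.eq_of_res_eq q (show _ ∈ V ⊓ (U ζ ⊓ U ζ') from ⟨hx, hy, hz⟩) h3)

/-- The arrow `α` intertwines `ν` with multiplication by the root of unity by which `ν` acts on
the image of `α`. -/
theorem RootHom.comp_eq_scalar_comp {A B : RootObj L r} (α : RootHom A B) (ν : RootHom B B) (w)
    (ρ : B.M ≅ (pullback (𝟙 B.T)).obj B.M) (comm) (hν : ν = ⟨𝟙 B.T, w, ρ, comm⟩) (q : B.T ⟶ S₀)
        (q' : A.T ⟶ S₀)
    (hq : α.h ≫ q = q') (ζ : rootsOfUnity r Γ(S₀, ⊤)) {U : B.T.Opens}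
    (hU : ActsBy ρ (↑(pullbackRoot q ζ)⁻¹ : Γ(B.T, ⊤)) U) (hα : ∀ x, α.h x ∈ U) :
    α.comp ν = (RootHom.scalar A (pullbackRoot q' ζ) (pullbackRoot_pow q' ζ)).comp α := by
  subst hν
  refine RootHom.ext_pull ((Category.comp_id α.h).trans (Category.id_comp α.h).symm) fun V n => ?_
  rw [RootHom.comp_pull, RootHom.comp_pull]
  refine (map_eqToHom_self rfl _).trans ?_
  refine Eq.trans ?_ (pullInv_smulIso A.M (pullbackRoot q' ζ) (α.h ⁻¹ᵁ V) (pullInv α.ρ V n)).symm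
  have hV : V ⊓ U ≤ V := inf_le_left
  have hV' : α.h ⁻¹ᵁ V ≤ α.h ⁻¹ᵁ (V ⊓ U) := fun x hx => ⟨hx, hα x⟩
  have h1 : ∀ k : Γ(B.M, V), pullInv α.ρ V k = A.M.res hV' (pullInv α.ρ (V ⊓ U) (B.M.res hV k)) :=
      fun k => by
    rw [pullInv_res, Scheme.Modules.res_res, Scheme.Modules.res_self]
  have h2 : B.M.res hV (pullInv ρ V n) = B.T.res le_top (↑(pullbackRoot q ζ)⁻¹ : Γ(B.T, ⊤)) •
      B.M.res hV n :=
    (pullInv_res ρ hV n).symm.trans (hU _ inf_le_right _)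
  have h3 := pullbackRoot_comp α.h q q' hq ζ (V ⊓ U)
  refine (h1 _).trans ?_
  rw [h2, pullInv_smul, Scheme.Modules.res_smul, ← h1]
  refine congr(A.T.res hV' $h3 • pullInv α.ρ V n).trans ?_
  exact congr($(A.T.res_res _ hV' _) • pullInv α.ρ V n)

theorem RootHom.scalar_pullbackRoot_one (A : RootObj L r) (q : A.T ⟶ S₀) :
    RootHom.scalar A (pullbackRoot q 1) (pullbackRoot_pow q 1) = RootHom.id A := by
  refine RootHom.ext_pull rfl fun U n => (map_eqToHom_self rfl _).trans ?_
  rw [RootHom.id_pull]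
  refine (pullInv_smulIso A.M (pullbackRoot q 1) U n).trans ?_
  have : pullbackRoot q (1 : rootsOfUnity r Γ(S₀, ⊤)) = 1 := map_one
      (Units.map q.appTop.hom.toMonoidHom)
  rw [this, inv_one, Units.val_one, map_one, one_smul]

/-- A section which is fixed by multiplication by a root of unity `ζ ≠ 1` vanishes. -/
theorem eq_zero_of_scalar {A B : RootStackObj L s r} (H : HasRootsOfUnity S₀ r)
    (α : RootStackHom A B)
    (ν : RootStackHom B B) (q : A.T ⟶ S₀) {ζ : rootsOfUnity r Γ(S₀, ⊤)} (hζ : ζ ≠ 1)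
    (h : α.hom.comp ν.hom =
      (RootHom.scalar A.toRootObj (pullbackRoot q ζ) (pullbackRoot_pow q ζ)).comp α.hom) :
    A.t = 0 := by
  have h1 := (mapsSection_iff _ _ _).1 (α.comp ν).mapsSection
  have h2 : (pullInv α.hom.ρ ⊤ B.t : Γ(A.M, ⊤)) = A.t := (mapsSection_iff _ _ _).1 α.mapsSection
  have h3 := RootHom.pullInv_congr h ⊤ B.t
  rw [RootHom.comp_pull (RootHom.scalar A.toRootObj (pullbackRoot q ζ) (pullbackRoot_pow q ζ))
      α.hom] at h3
  have h4 := (pullInv_smulIso A.M (pullbackRoot q ζ) ⊤ (pullInv α.hom.ρ ⊤ B.t))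
  have h5 : A.t = A.T.res (le_top : (⊤ : A.T.Opens) ≤ ⊤) (↑(pullbackRoot q ζ)⁻¹ : Γ(A.T, ⊤)) •
      A.t := by
    refine Eq.trans ?_ (h4.trans (congrArg (fun m : Γ(A.M, ⊤) =>
      A.T.res (le_top : (⊤ : A.T.Opens) ≤ ⊤) (↑(pullbackRoot q ζ)⁻¹ : Γ(A.T, ⊤)) • m) h2))
    exact h1.symm.trans ((map_eqToHom_self rfl _).symm.trans h3)
  rw [Scheme.res_self, ← pullbackRoot_inv] at h5
  have h6 := H.isUnit_one_sub_pullbackRoot q (inv_ne_one.2 hζ)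
  have h7 : (1 - (pullbackRoot q ζ⁻¹ : Γ(A.T, ⊤))) • A.t = 0 := by
    rw [sub_smul, ← h5, one_smul, sub_self]
  exact (h6.smul_eq_zero).1 h7

end AlgebraicGeometry

/-! ### A criterion for a coproduct of stacks -/

namespace CategoryTheory

variable {𝒮 : Type (u + 1)} [Category.{u} 𝒮]

/-- An arrow lies over at most one morphism with given source and target. -/
theorem IsHomLift.eq_of_lift {𝒳 : Type*} [Category 𝒳] (p : 𝒳 ⥤ 𝒮) {R S : 𝒮} {a b : 𝒳} {f g : R ⟶ S}
    (φ : a ⟶ b) (hf : p.IsHomLift f φ) (hg : p.IsHomLift g φ) : f = g :=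
  (IsHomLift.fac p f φ).trans (IsHomLift.fac p g φ).symm

theorem nonempty_isColimit_of_iso {ι : Type u} {C : Type*} [Category C] {X Y : ι → C} {B : C}
    {j : ∀ i, X i ⟶ B}
    (h : Nonempty (Limits.IsColimit (Limits.Cofan.mk B j))) (e : ∀ i, Y i ≅ X i) :
    Nonempty (Limits.IsColimit (Limits.Cofan.mk B fun i => (e i).hom ≫ j i)) := by
  obtain ⟨h⟩ := h
  refine ⟨Limits.Cofan.IsColimit.mk _ (fun s => Limits.Cofan.IsColimit.desc h fun i => (e i).inv ≫
      s.inj i)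
    (fun s i => ?_) fun s m hm => Limits.Cofan.IsColimit.hom_ext h _ _ fun i => ?_⟩
  · have := Limits.Cofan.IsColimit.fac h (fun i => (e i).inv ≫ s.inj i) i
    change j i ≫ _ = _ at this
    change ((e i).hom ≫ j i) ≫ _ = _
    rw [Category.assoc, this, Iso.hom_inv_id_assoc]
  · rw [Limits.Cofan.IsColimit.fac, ← hm i]
    change j i ≫ m = (e i).inv ≫ ((e i).hom ≫ j i) ≫ m
    rw [Category.assoc, Iso.inv_hom_id_assoc]

section Criterion

variable {ι : Type u} {F : ι → BasedCategory.{u, u + 1} 𝒮} {𝒴 : BasedCategory.{u, u + 1} 𝒮}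

/-- The arrows `α i : y i ⟶ z` lie over the inclusions of the members of a decomposition of the
base of `z`. -/
def CoversBase {y : ι → 𝒴.obj} {z : 𝒴.obj} (α : ∀ i, y i ⟶ z) : Prop :=
  Nonempty (Limits.IsColimit (Limits.Cofan.mk (𝒴.p.obj z) fun i => 𝒴.p.map (α i)))

/-- The conditions under which functors `c i : F i ⥤ 𝒴` exhibit `𝒴` as the coproduct of the stacks
`F i`. -/
structure IsStackDecomposition (c : ∀ i, F i ⥤ᵇ 𝒴) : Prop where
  /-- Objects can be glued along a decomposition of the base. -/
  exists_glue : ∀ (y : ι → 𝒴.obj) (B : 𝒮) (j : ∀ i, 𝒴.p.obj (y i) ⟶ B),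
    Nonempty (Limits.IsColimit (Limits.Cofan.mk B j)) →
      ∃ (z : 𝒴.obj) (α : ∀ i, y i ⟶ z), 𝒴.p.obj z = B ∧ ∀ i, 𝒴.p.IsHomLift (j i) (α i)
  /-- Every object can be decomposed. -/
  exists_decomp : ∀ z : 𝒴.obj, ∃ (x : ∀ i, (F i).obj) (α : ∀ i, (c i).obj (x i) ⟶ z), CoversBase α
  /-- Arrows can be glued along a decomposition of the base. -/
  existsUnique_hom : ∀ {y : ι → 𝒴.obj} {z z' : 𝒴.obj} (α : ∀ i, y i ⟶ z) (β : ∀ i, y i ⟶ z')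
    (k : 𝒴.p.obj z ⟶ 𝒴.p.obj z'), CoversBase α → (∀ i, 𝒴.p.map (α i) ≫ k = 𝒴.p.map (β i)) →
      ∃! b : z ⟶ z', 𝒴.p.map b = k ∧ ∀ i, α i ≫ b = β i
  /-- Arrows respect the decompositions. -/
  existsUnique_piece : ∀ {x x' : ∀ i, (F i).obj} {z z' : 𝒴.obj} (α : ∀ i, (c i).obj (x i) ⟶ z)
    (β : ∀ i, (c i).obj (x' i) ⟶ z') (b : z ⟶ z'), CoversBase α → CoversBase β →
      ∀ i, ∃! φ : x i ⟶ x' i, α i ≫ b = (c i).map φ ≫ β i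

/-- An identification of the object `z` of `𝒴` with the object obtained from the object `A` of the
coproduct by means of the functors `c i`. -/
structure CoprodLink (c : ∀ i, F i ⥤ᵇ 𝒴) (A : StackCoprodObj F) (z : 𝒴.obj) : Type u where
  α : ∀ i, (c i).obj (A.x i) ⟶ z
  base : 𝒴.p.obj z = A.base
  isHomLift : ∀ i, 𝒴.p.IsHomLift (A.j i) (α i)

namespace CoprodLink

variable {c : ∀ i, F i ⥤ᵇ 𝒴} {A B : StackCoprodObj F} {z z' : 𝒴.obj}

theorem coversBase (l : CoprodLink c A z) : CoversBase l.α := by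
  obtain ⟨base, x, j, h⟩ := A
  obtain ⟨α, hb, hl⟩ := l
  dsimp only at hb
  subst hb
  dsimp only at α hl ⊢
  have h1 := nonempty_isColimit_of_iso h fun i => eqToIso ((c i).w_obj (x i))
  have h2 : (fun i => 𝒴.p.map (α i)) = fun i => (eqToIso ((c i).w_obj (x i))).hom ≫ j i := by
    funext i
    have := hl i
    have h3 := IsHomLift.fac' 𝒴.p (j i) (α i)
    rw [eqToHom_refl, Category.comp_id] at h3
    exact h3
  rw [CoversBase, h2]
  exact h1

/-- The arrow `b` of `𝒴` is the one obtained from the arrow `a` of the coproduct by means of the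
functors `c i`. -/
def Rel (l : CoprodLink c A z) (l' : CoprodLink c B z') (a : A ⟶ B) (b : z ⟶ z') : Prop :=
  𝒴.p.IsHomLift (StackCoprodHom.h a) b ∧
    ∀ i, l.α i ≫ b = (c i).map (StackCoprodHom.φ a i) ≫ l'.α i

theorem Rel.id (l : CoprodLink c A z) : Rel l l (𝟙 A) (𝟙 z) := by
  refine ⟨IsHomLift.id l.base, fun i => ?_⟩
  have h : (c i).map (StackCoprodHom.φ (𝟙 A) i) = 𝟙 _ := (c i).map_id _
  rw [h, Category.comp_id, Category.id_comp]

theorem Rel.comp {l : CoprodLink c A z} {l' : CoprodLink c B z'} {C : StackCoprodObj F} {w : 𝒴.obj}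
    {l'' : CoprodLink c C w} {a : A ⟶ B} {b : z ⟶ z'} {a' : B ⟶ C} {b' : z' ⟶ w}
    (h : Rel l l' a b) (h' : Rel l' l'' a' b') : Rel l l'' (a ≫ a') (b ≫ b') := by
  obtain ⟨h1, h2⟩ := h
  obtain ⟨h1', h2'⟩ := h'
  refine ⟨IsHomLift.comp 𝒴.p (StackCoprodHom.h a) (StackCoprodHom.h a') b b', fun i => ?_⟩
  have h3 : (c i).map (StackCoprodHom.φ (a ≫ a') i) =
      (c i).map (StackCoprodHom.φ a i) ≫ (c i).map (StackCoprodHom.φ a' i) := (c i).map_comp _ _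
  rw [h3, ← Category.assoc, h2, Category.assoc, h2', Category.assoc]

/-- An arrow of the coproduct induces an arrow of `𝒴`, by gluing. -/
theorem existsUnique_hom (H : IsStackDecomposition c) (l : CoprodLink c A z)
    (l' : CoprodLink c B z')
    (a : A ⟶ B) : ∃! b : z ⟶ z', Rel l l' a b := by
  unfold Rel
  have hl := l.coversBase
  obtain ⟨base, x, j, h⟩ := A
  obtain ⟨α, hb, hα⟩ := l
  obtain ⟨base', x', j', h'⟩ := B
  obtain ⟨β, hb', hβ⟩ := l'
  obtain ⟨k, φ, comm⟩ := a
  dsimp only at hb hb'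
  subst hb hb'
  dsimp only at *
  have h1 : ∀ i, 𝒴.p.IsHomLift (j i ≫ k) ((c i).map (φ i) ≫ β i) := fun i => by
    have := hβ i
    rw [← comm i]
    infer_instance
  obtain ⟨b, ⟨hb1, hb2⟩, hu⟩ := H.existsUnique_hom α (fun i => (c i).map (φ i) ≫ β i) k hl
      fun i => by
    have := hα i
    have := h1 i
    rw [IsHomLift.fac' 𝒴.p (j i) (α i), IsHomLift.fac' 𝒴.p (j i ≫ k) ((c i).map (φ i) ≫ β i)]
    simp
  refine ⟨b, ⟨hb1 ▸ inferInstance, hb2⟩, fun b' ⟨hb1', hb2'⟩ => hu b' ⟨?_, hb2'⟩⟩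
  exact (IsHomLift.eq_of_isHomLift 𝒴.p k b').symm

/-- An arrow of `𝒴` comes from an arrow of the coproduct, by restriction to the pieces. -/
theorem existsUnique_lift (H : IsStackDecomposition c) (l : CoprodLink c A z)
    (l' : CoprodLink c B z')
    (b : z ⟶ z') : ∃! a : A ⟶ B, Rel l l' a b := by
  unfold Rel
  have hl := l.coversBase
  have hl' := l'.coversBase
  obtain ⟨base, x, j, h⟩ := A
  obtain ⟨α, hb, hα⟩ := l
  obtain ⟨base', x', j', h'⟩ := B
  obtain ⟨β, hb', hβ⟩ := l'
  dsimp only at hb hb'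
  subst hb hb'
  dsimp only at *
  choose φ hφ hu using H.existsUnique_piece α β b hl hl'
  dsimp only at hφ hu
  refine ⟨⟨𝒴.p.map b, φ, fun i => ?_⟩, ⟨IsHomLift.map 𝒴.p b, hφ⟩, ?_⟩
  · have := hα i
    have := hβ i
    exact IsHomLift.eq_of_lift 𝒴.p ((c i).map (φ i) ≫ β i) inferInstance (hφ i ▸ inferInstance)
  · rintro ⟨k, φ', comm⟩ ⟨h1, h2⟩
    exact StackCoprodHom.ext (IsHomLift.eq_of_isHomLift 𝒴.p k b) (funext fun i => hu i _ (h2 i))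

theorem exists_iso_left (H : IsStackDecomposition c) (l : CoprodLink c A z)
    (l' : CoprodLink c B z) :
    ∃ u : A ≅ B, Rel l l' u.hom (𝟙 z) := by
  obtain ⟨a, ha, -⟩ := l.existsUnique_lift H l' (𝟙 z)
  obtain ⟨a', ha', -⟩ := l'.existsUnique_lift H l (𝟙 z)
  have h1 := ha.comp ha'
  have h2 := ha'.comp ha
  rw [Category.comp_id] at h1 h2
  exact ⟨⟨a, a', (l.existsUnique_lift H l (𝟙 z)).unique h1 (Rel.id l),
    (l'.existsUnique_lift H l' (𝟙 z)).unique h2 (Rel.id l')⟩, ha⟩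

theorem exists_iso_right (H : IsStackDecomposition c) (l : CoprodLink c A z)
    (l' : CoprodLink c A z') :
    ∃ u : z ≅ z', Rel l l' (𝟙 A) u.hom := by
  obtain ⟨b, hb, -⟩ := l.existsUnique_hom H l' (𝟙 A)
  obtain ⟨b', hb', -⟩ := l'.existsUnique_hom H l (𝟙 A)
  have h1 := hb.comp hb'
  have h2 := hb'.comp hb
  rw [Category.comp_id] at h1 h2
  exact ⟨⟨b, b', (l.existsUnique_hom H l (𝟙 A)).unique h1 (Rel.id l),
    (l'.existsUnique_hom H l' (𝟙 A)).unique h2 (Rel.id l')⟩, hb⟩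

end CoprodLink

/-- Every object of the coproduct is linked to an object of `𝒴`. -/
theorem IsStackDecomposition.exists_link_left {c : ∀ i, F i ⥤ᵇ 𝒴} (H : IsStackDecomposition c)
    (A : StackCoprodObj F) :
    ∃ z, Nonempty (CoprodLink c A z) := by
  obtain ⟨z, α, hb, hα⟩ := H.exists_glue (fun i => (c i).obj (A.x i)) A.base
    (fun i => (eqToIso ((c i).w_obj (A.x i))).hom ≫ A.j i) (nonempty_isColimit_of_iso A.isColimit _)
  refine ⟨z, ⟨α, hb, fun i => ?_⟩⟩
  have := hα i
  have h1 := IsHomLift.fac' 𝒴.p ((eqToIso ((c i).w_obj (A.x i))).hom ≫ A.j i) (α i)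
  refine IsHomLift.of_fac' 𝒴.p _ _ ((c i).w_obj (A.x i)) hb (h1.trans ?_)
  simp

/-- Every object of `𝒴` is linked to an object of the coproduct. -/
theorem IsStackDecomposition.exists_link_right {c : ∀ i, F i ⥤ᵇ 𝒴} (H : IsStackDecomposition c)
    (z : 𝒴.obj) :
    ∃ A : StackCoprodObj F, Nonempty (CoprodLink c A z) := by
  obtain ⟨x, α, hα⟩ := H.exists_decomp z
  refine ⟨⟨𝒴.p.obj z, x, fun i => (eqToIso ((c i).w_obj (x i)).symm).hom ≫ 𝒴.p.map (α i),
    nonempty_isColimit_of_iso hα _⟩, ⟨α, rfl, fun i => ?_⟩⟩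
  refine IsHomLift.of_fac' 𝒴.p _ _ ((c i).w_obj (x i)) rfl ?_
  simp

/-- Functors which exhibit `𝒴` as the coproduct of the stacks `F i` induce an equivalence. Both it
and its quasi-inverse are obtained by choosing links of objects of the coproduct with objects of
`𝒴`; `CoprodLink.existsUnique_hom` and `CoprodLink.existsUnique_lift` give the effect on arrows.
-/
theorem IsStackDecomposition.exists_equivalence {c : ∀ i, F i ⥤ᵇ 𝒴} (H : IsStackDecomposition c) :
    ∃ E : stackCoprod F ⥤ᵇ 𝒴, IsEquivalenceOver E ∧ RestrictsTo E c := by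
  choose e l using H.exists_link_left
  replace l := fun A => (l A).some
  choose g m using H.exists_link_right
  replace m := fun z => (m z).some
  choose eh ehl ehu using fun (A B : StackCoprodObj F) (a : A ⟶ B) => (l A).existsUnique_hom H
      (l B) a
  choose gh ghl ghu using fun (z z' : 𝒴.obj) (b : z ⟶ z') => (m z).existsUnique_lift H (m z') b
  let E : stackCoprod F ⥤ᵇ 𝒴 :=
    { obj := e
      map := fun {A B} a => eh A B a
      map_id := fun A => (ehu A A _ _ (CoprodLink.Rel.id (l A))).symm
      map_comp := fun {A B C} a b => (ehu A C _ _ ((ehl A B a).comp (ehl B C b))).symm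
      w := CategoryTheory.Functor.ext (fun A => (l A).base) fun A B a => by
        have := (ehl A B a).1
        exact IsHomLift.fac' 𝒴.p (StackCoprodHom.h a) (eh A B a) }
  let G : 𝒴 ⥤ᵇ stackCoprod F :=
    { obj := g
      map := fun {z z'} b => gh z z' b
      map_id := fun z => (ghu z z _ _ (CoprodLink.Rel.id (m z))).symm
      map_comp := fun {z z' z''} b b' => (ghu z z'' _ _ ((ghl z z' b).comp (ghl z' z'' b'))).symm
      w := CategoryTheory.Functor.ext (fun z => (m z).base.symm) fun z z' b => by
        have := (ghl z z' b).1
        exact IsHomLift.fac 𝒴.p (StackCoprodHom.h (gh z z' b)) b }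
  choose u hu using fun A => (m (e A)).exists_iso_left H (l A)
  choose v hv using fun z => (l (g z)).exists_iso_right H (m z)
  refine ⟨E, ⟨G, ⟨BasedNatIso.mkNatIso (NatIso.ofComponents (fun A => u A) fun {A B} a => ?_)
      fun A => ?_⟩,
    ⟨BasedNatIso.mkNatIso (NatIso.ofComponents (fun z => v z) fun {z z'} b => ?_) fun z => ?_⟩⟩,
        fun i => ?_⟩
  · have h1 := (ghl _ _ (eh A B a)).comp (hu B)
    have h2 := (hu A).comp (ehl A B a)
    rw [Category.comp_id] at h1
    rw [Category.id_comp] at h2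
    exact ((m (e A)).existsUnique_lift H (l B) (eh A B a)).unique h1 h2
  · have := (hu A).1
    have h1 := IsHomLift.fac 𝒴.p (StackCoprodHom.h (u A).hom) (𝟙 (e A))
    refine IsHomLift.of_fac' (stackCoprod F).p _ _ ((m (e A)).base.symm.trans (l A).base) rfl ?_
    refine h1.trans ?_
    rw [CategoryTheory.Functor.map_id, Category.id_comp, eqToHom_trans]
    exact ((congr(_ ≫ $(Category.id_comp (eqToHom _)))).trans (eqToHom_trans _ _)).symm
  · have h1 := (ehl _ _ (gh z z' b)).comp (hv z')
    have h2 := (hv z).comp (ghl z z' b)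
    rw [Category.comp_id] at h1
    rw [Category.id_comp] at h2
    exact ((l (g z)).existsUnique_hom H (m z') (gh z z' b)).unique h1 h2
  · have h1 : ∀ R, R = (g z).base → 𝒴.p.IsHomLift (𝟙 R) (v z).hom := by
      rintro _ rfl
      exact (hv z).1
    exact h1 _ (m z).base
  · exact ⟨{ app := fun A => (l A).α i, naturality := fun A B a => ((ehl A B a).2 i).symm },
      fun A => (l A).isHomLift i⟩

end Criterion

end CategoryTheory

/-! ### The inertia of the root stack -/

namespace AlgebraicGeometry

open Scheme.Modules

section Over

variable {S₀ : Scheme.{u}} {ι : Type u} {Y : ι → Over S₀} {B : Over S₀}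

/-- Coproduct decompositions in the category of `S₀`-schemes are disjoint unions of open
subschemes. -/
theorem nonempty_isColimit_over_iff (j : ∀ i, Y i ⟶ B) :
    Nonempty (Limits.IsColimit (Limits.Cofan.mk B j)) ↔ IsDisjointCover fun i => (j i).left := by
  constructor
  · rintro ⟨h⟩
    exact IsDisjointCover.of_isColimit (Limits.isColimitCofanMkObjOfIsColimit (Over.forget S₀) _ _
        h)
  · intro h
    obtain ⟨h⟩ := h.nonempty_isColimit
    exact ⟨Limits.isColimitOfIsColimitCofanMkObj (Over.forget S₀) _ _ h⟩

end Over

variable {X D S₀ : Scheme.{u}} {L : X.Modules} {s : Γ(L, ⊤)} {r : ℕ}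

theorem isDisjointCover_of_coversBase {π : X ⟶ S₀} {ι : Type u}
    {y : ι → (inertia (rootStack π L s r)).obj}
    {z : (inertia (rootStack π L s r)).obj} {α : ∀ i, y i ⟶ z} (h : CoversBase α) :
    IsDisjointCover fun i => (InertiaHom.u (α i)).hom.h :=
  (nonempty_isColimit_over_iff fun i => (inertia (rootStack π L s r)).p.map (α i)).1 h

/-- The base of the automorphism of an object of the inertia stack is the identity. -/
theorem inertia_hom_h {π : X ⟶ S₀} (z : InertiaObj (rootStack π L s r)) :
    (RootStackHom.hom z.ν).h = 𝟙 z.x.T :=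
  congr(($(z.map_ν)).left)

/-- Objects of the inertia stack glue along disjoint unions: the objects of the root stack glue,
and then their automorphisms do. -/
theorem inertia_exists_glue {π : X ⟶ S₀} {ι : Type u} (y : ι → InertiaObj (rootStack π L s r))
    {T : Scheme.{u}} (b : T ⟶ S₀) (j : ∀ i, (inertia (rootStack π L s r)).p.obj (y i) ⟶ Over.mk b)
    (H : Nonempty (Limits.IsColimit (Limits.Cofan.mk (Over.mk b) j))) :
    ∃ (z : (inertia (rootStack π L s r)).obj) (α : ∀ i, y i ⟶ z),
      (inertia (rootStack π L s r)).p.obj z = Over.mk b ∧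
        ∀ i, (inertia (rootStack π L s r)).p.IsHomLift (j i) (α i) := by
  have H' := (nonempty_isColimit_over_iff j).1 H
  obtain ⟨hc⟩ := H'.nonempty_isColimit
  obtain ⟨f, hf⟩ : ∃ f : T ⟶ X, ∀ i, (j i).left ≫ f = (y i).x.f :=
    ⟨Limits.Cofan.IsColimit.desc hc fun i => (y i).x.f,
      Limits.Cofan.IsColimit.fac hc fun i => (y i).x.f⟩
  obtain rfl : f ≫ π = b := H'.hom_ext fun i => by
    rw [← Category.assoc, hf]
    exact (Over.w (j i)).symm
  obtain ⟨M, hM, φ, t, ht, α, hα⟩ := RootStackObj.exists_glue (fun i => (y i).x)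
      (fun i => (j i).left) H' f hf
  have H'' : IsDisjointCover fun i => (α i).hom.h := by
    rw [funext hα]
    exact H'
  obtain ⟨ν, hν, hν'⟩ := RootStackHom.exists_glue α H'' (fun i => RootStackHom.comp (y i).ν (α i))
      (𝟙 T)
    fun i => by
      change (α i).hom.h ≫ 𝟙 T = (RootStackHom.hom (y i).ν).h ≫ (α i).hom.h
      rw [inertia_hom_h]
      exact (Category.comp_id _).trans (Category.id_comp _).symm
  let z : InertiaObj (rootStack π L s r) := ⟨⟨⟨T, f, M, hM, φ⟩, t, ht⟩, ν, Over.OverMorphism.ext hν⟩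
  let a : ∀ i, InertiaHom (y i) z := fun i => ⟨α i, hν' i⟩
  refine ⟨z, a, rfl, fun i => ?_⟩
  have h1 : j i = (inertia (rootStack π L s r)).p.map (X := y i) (Y := z) (a i) :=
    Over.OverMorphism.ext (hα i).symm
  rw [h1]
  exact IsHomLift.map (inertia (rootStack π L s r)).p _

/-- Arrows of the inertia stack glue along disjoint unions. -/
theorem inertia_existsUnique_hom {π : X ⟶ S₀} {ι : Type u}
    {y : ι → (inertia (rootStack π L s r)).obj}
    {z z' : (inertia (rootStack π L s r)).obj} (α : ∀ i, y i ⟶ z) (β : ∀ i, y i ⟶ z')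
    (k : (inertia (rootStack π L s r)).p.obj z ⟶ (inertia (rootStack π L s r)).p.obj z')
        (hα : CoversBase α)
    (hk : ∀ i, (inertia (rootStack π L s r)).p.map (α i) ≫ k = (inertia (rootStack π L s r)).p.map
        (β i)) :
    ∃! b : z ⟶ z', (inertia (rootStack π L s r)).p.map b = k ∧ ∀ i, α i ≫ b = β i := by
  have H := isDisjointCover_of_coversBase hα
  obtain ⟨b, hb, hb'⟩ := RootStackHom.exists_glue (fun i => InertiaHom.u (α i)) H
      (fun i => InertiaHom.u (β i))
    k.left fun i => congr(($(hk i)).left)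
  have comm : b.comp z'.ν = RootStackHom.comp z.ν b := by
    refine RootStackHom.eq_of_glue (fun i => InertiaHom.u (α i)) H ?_ fun i => ?_
    · change b.hom.h ≫ (RootStackHom.hom z'.ν).h = (RootStackHom.hom z.ν).h ≫ b.hom.h
      exact (congrArg (fun e => b.hom.h ≫ e) (inertia_hom_h z')).trans <|
          (Category.comp_id _).trans <|
        (Category.id_comp _).symm.trans (congrArg (fun e => e ≫ b.hom.h) (inertia_hom_h z)).symm
    · have h1 : InertiaHom.u (α i) ≫ z.ν = (y i).ν ≫ InertiaHom.u (α i) := InertiaHom.comm (α i)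
      have h2 : InertiaHom.u (β i) ≫ z'.ν = (y i).ν ≫ InertiaHom.u (β i) := InertiaHom.comm (β i)
      have h3 : InertiaHom.u (α i) ≫ (show z.x ⟶ z'.x from b) = InertiaHom.u (β i) := hb' i
      change InertiaHom.u (α i) ≫ (show z.x ⟶ z'.x from b) ≫ z'.ν =
        InertiaHom.u (α i) ≫ z.ν ≫ (show z.x ⟶ z'.x from b)
      rw [← Category.assoc, h3, h2, ← Category.assoc, h1, Category.assoc, h3]
  refine ⟨⟨b, comm⟩, ⟨Over.OverMorphism.ext hb, fun i => InertiaHom.ext (hb' i)⟩,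
      fun b' ⟨h1, h2⟩ => ?_⟩
  refine InertiaHom.ext (RootStackHom.eq_of_glue (fun i => InertiaHom.u (α i)) H ?_ fun i => ?_)
  · exact congr(($h1).left).trans hb.symm
  · exact congr(InertiaHom.u $(h2 i)).trans (hb' i).symm

section Gerbe

variable (i : D ⟶ X)

/-- The compatibility of `ρ` with isomorphisms to the pull-backs of `L|_D` may be checked after
composing with the identification of `g^* (L|_D)` with the pull-back of `L`. -/
theorem RootCompat.of_trans {S T : Scheme.{u}} {f : S ⟶ D} {M : S.Modules}
    {φ : M.tensorPower r ≅ (pullback f).obj ((pullback i).obj L)} {g : T ⟶ D} {N : T.Modules}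
    {ψ : N.tensorPower r ≅ (pullback g).obj ((pullback i).obj L)} {h : S ⟶ T} (w : h ≫ g = f)
    {ρ : M ≅ (pullback h).obj N} (w' : h ≫ g ≫ i = f ≫ i)
    (a : RootCompat (φ ≪≫ pullbackTrans f i (f ≫ i) rfl L) (ψ ≪≫ pullbackTrans g i (g ≫ i) rfl L)
      h w' ρ) : RootCompat φ ψ h w ρ := by
  intro U n
  have h1 := a U n
  rw [trans_app_apply, trans_app_apply] at h1
  have h2 := pullbackTrans_assoc_section h g i f (g ≫ i) (f ≫ i) w rfl w' rfl L U
    (ψ.hom.app U (N.tprod r U n))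
  have h3 := h1.trans h2.symm
  exact ((hom_app_eq_iff (pullbackTrans f i (f ≫ i) rfl L) (h ⁻¹ᵁ U) _ _).1 rfl).symm.trans
    ((hom_app_eq_iff (pullbackTrans f i (f ≫ i) rfl L) (h ⁻¹ᵁ U) _ _).1 h3.symm)

variable [NeZero r] (hs : pullbackSection i L ⊤ s = 0)

/-- An object of the root stack with `t = 0` whose base maps to `D` comes from the gerbe. -/
theorem exists_gerbeInclusionObj_eq (A : RootStackObj L s r) (ht : A.t = 0) (g : A.T ⟶ D)
    (w : g ≫ i = A.f) :
    ∃ x : RootObj ((pullback i).obj L) r, gerbeInclusionObj i hs x = A := by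
  obtain ⟨⟨T, f, M, hM, φ⟩, t, hts⟩ := A
  dsimp only at g w ht
  subst w
  refine ⟨⟨T, g, M, hM, φ ≪≫ (pullbackTrans g i (g ≫ i) rfl L).symm⟩, ?_⟩
  have h : (φ ≪≫ (pullbackTrans g i (g ≫ i) rfl L).symm) ≪≫ pullbackTrans g i (g ≫ i) rfl L =
      φ := by
    ext1
    simp
  have h2 : ∀ ψ t', ψ = φ → t' = t → ∀ h' : IsRootSection ψ s t',
      (⟨⟨T, g ≫ i, M, hM, ψ⟩, t', h'⟩ : RootStackObj L s r) = ⟨⟨T, g ≫ i, M, hM, φ⟩, t, hts⟩ := by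
    rintro _ _ rfl rfl _
    rfl
  exact h2 _ _ h ht.symm _

/-- The inclusion of the gerbe in the root stack is full if `D → X` is a monomorphism. -/
theorem gerbeInclusionHom_surjective [Mono i] {A B : RootObj ((pullback i).obj L) r}
    (a : RootStackHom (gerbeInclusionObj i hs A) (gerbeInclusionObj i hs B)) :
    ∃ b : RootHom A B, gerbeInclusionHom i hs b = a := by
  obtain ⟨⟨h, w, ρ, comm⟩, ha⟩ := a
  have w' : h ≫ B.f = A.f := (cancel_mono i).1 ((Category.assoc h B.f i).trans w)
  exact ⟨⟨h, w', ρ, comm.of_trans i w' w⟩, rfl⟩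

theorem gerbeInclusionHom_injective {A B : RootObj ((pullback i).obj L) r} {a b : RootHom A B}
    (h : gerbeInclusionHom i hs a = gerbeInclusionHom i hs b) : a = b :=
  RootHom.ext_pull congr(($h).hom.h) fun U n => RootHom.pullInv_congr congr(($h).hom) U n

end Gerbe

end AlgebraicGeometry

/-! ### The pieces of the inertia stack -/

namespace AlgebraicGeometry

open Scheme.Modules

variable {X : Scheme.{u}} {L : X.Modules} {s : Γ(L, ⊤)} {r : ℕ} [NeZero r]
    {π : X ⟶ baseScheme.{u} r}

/-- The root of unity by which the automorphism acts on the pieces with a given index. -/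
noncomputable def PieceIndex.root : PieceIndex.{u} r → rootsOfUnity r Γ(baseScheme.{u} r, ⊤)
  | none => 1
  | some ζ => ζ.1

theorem PieceIndex.root_injective : Function.Injective (PieceIndex.root (r := r)) := by
  rintro (_ | ζ) (_ | ζ') h
  · rfl
  · exact (ζ'.2 h.symm).elim
  · exact (ζ.2 h).elim
  · exact congrArg some (Subtype.ext h)

theorem PieceIndex.exists_root_eq (ζ : rootsOfUnity r Γ(baseScheme.{u} r, ⊤)) :
    ∃ k : PieceIndex.{u} r, k.root = ζ := by
  by_cases h : ζ = 1
  · exact ⟨none, h.symm⟩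
  · exact ⟨some ⟨ζ, h⟩, rfl⟩

variable (hD : pullbackSection (zeroLocusι L s) L ⊤ s = 0)

/-- The automorphism in the image of a piece is multiplication by the root of unity of its index.
For the root stack itself this is the identity, as `root` is then `1`. -/
theorem pieceToInertia_ν (k : PieceIndex.{u} r) (x : (piece π L s k).obj)
    (q : ((pieceToInertia π L s hD k).obj x : InertiaObj (rootStack π L s r)).x.T ⟶ baseScheme r)
    (hq : q = ((pieceToInertia π L s hD k).obj x : InertiaObj (rootStack π L s r)).x.f ≫ π) :
    (RootStackHom.hom ((pieceToInertia π L s hD k).obj x : InertiaObj (rootStack π L s r)).ν) =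
      RootHom.scalar _ (pullbackRoot q k.root) (pullbackRoot_pow q k.root) := by
  match k, x with
  | none, (x : RootStackObj L s r) => exact (RootHom.scalar_pullbackRoot_one x.toRootObj q).symm
  | some ζ, (x : RootObj _ r) =>
    obtain rfl : q = x.f ≫ zeroLocusι L s ≫ π := hq.trans (Category.assoc x.f (zeroLocusι L s) π)
    rfl

/-- The canonical functors to the inertia stack are fully faithful. For the gerbe the root of
unity is central, so only arrows of the root stack matter. -/
theorem pieceToInertia_map_bijective (k : PieceIndex.{u} r) (x x' : (piece π L s k).obj) :
    Function.Bijective fun a : x ⟶ x' => (pieceToInertia π L s hD k).map a := by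
  match k, x, x' with
  | none, (x : RootStackObj L s r), (x' : RootStackObj L s r) =>
    exact ⟨fun a b h => congrArg InertiaHom.u h, fun a => ⟨InertiaHom.u a, rfl⟩⟩
  | some ζ, (x : RootObj _ r), (x' : RootObj _ r) =>
    refine ⟨fun a b h => ?_, fun a => ?_⟩
    · exact gerbeInclusionHom_injective (zeroLocusι L s) hD (congrArg InertiaHom.u h)
    · obtain ⟨b, hb⟩ := gerbeInclusionHom_surjective (zeroLocusι L s) hD (InertiaHom.u a)
      exact ⟨b, InertiaHom.ext hb⟩

/-- If the automorphism of an object `z` of the inertia stack restricts to multiplication by `ζ`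
along an arrow `(A, ζ) → z`, its inverse is locally, near the image of `A`, multiplication by a
function which differs from `ζ⁻¹` by a function vanishing on the image. -/
theorem not_mem_basicOpen_of_comp_eq {A B : RootObj L r} (γ : RootHom A B) (ν : RootHom B B) (w)
    (ρ : B.M ≅ (pullback (𝟙 B.T)).obj B.M) (comm) (hν : ν = ⟨𝟙 B.T, w, ρ, comm⟩)
    (q : B.T ⟶ baseScheme r) (q' : A.T ⟶ baseScheme r) (hq : γ.h ≫ q = q')
    (ζ : rootsOfUnity r Γ(baseScheme.{u} r, ⊤))
    (h : γ.comp ν = (RootHom.scalar A (pullbackRoot q' ζ) (pullbackRoot_pow q' ζ)).comp γ)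
    {U : B.T.Opens} {m : Γ(B.M, U)} (hm : B.M.IsGenerator m) {c : Γ(B.T, U)}
        (hc : pullInv ρ U m = c • m)
    (x : A.T) :
    γ.h x ∉ B.T.basicOpen (c - B.T.res le_top (↑(pullbackRoot q ζ)⁻¹ : Γ(B.T, ⊤))) := by
  subst hν
  have h1 := RootHom.pullInv_congr h U m
  rw [RootHom.comp_pull, RootHom.comp_pull] at h1
  have h2 : pullInv γ.ρ U (pullInv ρ U m) = γ.h.app U c • pullInv γ.ρ U m :=
    congr(pullInv γ.ρ U $hc).trans (pullInv_smul γ.ρ U c m)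
  have h3 := pullInv_smulIso A.M (pullbackRoot q' ζ) (γ.h ⁻¹ᵁ U) (pullInv γ.ρ U m)
  have h4 : γ.h.app U c = A.T.res le_top (↑(pullbackRoot q' ζ)⁻¹ : Γ(A.T, ⊤)) :=
    (hm.pullInv γ.ρ).smul_injective (h2.symm.trans
        (((map_eqToHom_self rfl _).symm.trans h1).trans h3))
  have h5 : γ.h.app U (c - B.T.res le_top (↑(pullbackRoot q ζ)⁻¹ : Γ(B.T, ⊤))) = 0 := by
    rw [map_sub, h4, sub_eq_zero]
    exact (pullbackRoot_comp γ.h q q' hq ζ U).symm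
  intro hx
  have h6 : x ∈ γ.h ⁻¹ᵁ B.T.basicOpen (c - B.T.res le_top (↑(pullbackRoot q ζ)⁻¹ : Γ(B.T, ⊤))) := hx
  rw [Scheme.preimage_basicOpen, h5, Scheme.basicOpen_zero] at h6
  exact h6

/-- The images of pieces with different indices are disjoint: near a common point the automorphism
would be multiplication by a function with the same value as two different roots of unity, whose
difference is a unit. -/
theorem pieceIndex_eq {z : (inertia (rootStack π L s r)).obj} {k k' : PieceIndex.{u} r}
    {x : (piece π L s k).obj} {x' : (piece π L s k').obj}
        (γ : (pieceToInertia π L s hD k).obj x ⟶ z)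
    (γ' : (pieceToInertia π L s hD k').obj x' ⟶ z) (y y')
        (h : (InertiaHom.u γ).hom.h y = (InertiaHom.u γ').hom.h y') :
    k = k' := by
  have hr := hasRootsOfUnity_baseScheme.{u} r
  let B : RootStackObj L s r := (z : InertiaObj _).x
  let ν : RootStackHom B B := (z : InertiaObj _).ν
  obtain ⟨w, ρ, comm, hν⟩ := RootHom.exists_eq_mk ν.hom (inertia_hom_h z)
  have key : ∀ {k : PieceIndex.{u} r} {x : (piece π L s k).obj}
      (γ : (pieceToInertia π L s hD k).obj x ⟶ z) (y)
      {U : B.T.Opens} {m : Γ(B.M, U)} (hm : B.M.IsGenerator m) {c : Γ(B.T, U)}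
          (hc : pullInv ρ U m = c • m),
      (InertiaHom.u γ).hom.h y ∉
        B.T.basicOpen (c - B.T.res le_top (↑(pullbackRoot (B.f ≫ π) k.root)⁻¹ : Γ(B.T, ⊤))) := by
    intro k x γ y U m hm c hc
    have hq : (InertiaHom.u γ).hom.h ≫ B.f ≫ π =
        ((pieceToInertia π L s hD k).obj x : InertiaObj (rootStack π L s r)).x.f ≫ π :=
      (Category.assoc _ _ _).symm.trans congr($((InertiaHom.u γ).hom.w) ≫ π)
    refine not_mem_basicOpen_of_comp_eq (InertiaHom.u γ).hom ν.hom w ρ comm hν (B.f ≫ π) _ hq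
        k.root ?_ hm hc y
    rw [← pieceToInertia_ν hD k x _ rfl]
    exact congrArg RootStackHom.hom (InertiaHom.comm γ)
  obtain ⟨U, m, hU, hm⟩ := B.exists_isGenerator ((InertiaHom.u γ).hom.h y)
  obtain ⟨c, hc⟩ := hm.exists_eq_smul (pullInv ρ U m : Γ(B.M, U))
  have h1 := key γ y hm hc
  have h2 := key γ' y' hm hc
  rw [← h] at h2
  by_contra hne
  have h3 : k.root⁻¹ ≠ k'.root⁻¹ := fun e => hne (PieceIndex.root_injective (inv_injective e))
  have h4 := ((hr.isUnit_pullbackRoot_sub (B.f ≫ π) h3).map (B.T.res (le_top : U ≤ ⊤))).map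
    (B.T.presheaf.germ U _ hU).hom
  rw [B.T.mem_basicOpen _ _ hU] at h1 h2
  have h5 : B.T.res (le_top : U ≤ ⊤) ((pullbackRoot (B.f ≫ π) k.root⁻¹ : Γ(B.T, ⊤)) -
      pullbackRoot (B.f ≫ π) k'.root⁻¹) =
      (c - B.T.res le_top (↑(pullbackRoot (B.f ≫ π) k'.root)⁻¹ : Γ(B.T, ⊤))) +
        -(c - B.T.res le_top (↑(pullbackRoot (B.f ≫ π) k.root)⁻¹ : Γ(B.T, ⊤))) := by
    rw [pullbackRoot_inv, pullbackRoot_inv, map_sub]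
    ring
  rw [h5, map_add, map_neg] at h4
  rcases IsLocalRing.isUnit_or_isUnit_of_isUnit_add h4 with h6 | h6
  · exact h2 h6
  · exact h1 ((IsUnit.neg_iff _).1 h6)

theorem comp_comp_eq_of_comm {C : Type*} [Category C] {A B Z : C} {c : A ⟶ B} {μ : A ⟶ A}
    {μ' : B ⟶ B}
    {ν : Z ⟶ Z} {β : B ⟶ Z} {γ : A ⟶ Z} (h : c ≫ β = γ) (hβ : β ≫ ν = μ' ≫ β) (hγ : γ ≫ ν = μ ≫ γ) :
    (c ≫ μ') ≫ β = (μ ≫ c) ≫ β := by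
  rw [Category.assoc, ← hβ, ← Category.assoc, h, hγ, Category.assoc, h]

/-- Arrows of the inertia stack respect the pieces, as these are distinguished by the roots of
unity by which the automorphisms act. -/
theorem inertia_existsUnique_piece {x x' : ∀ k : PieceIndex.{u} r, (piece π L s k).obj}
    {z z' : (inertia (rootStack π L s r)).obj} (α : ∀ k, (pieceToInertia π L s hD k).obj (x k) ⟶ z)
    (β : ∀ k, (pieceToInertia π L s hD k).obj (x' k) ⟶ z') (b : z ⟶ z') (hβ : CoversBase β)
    (k : PieceIndex.{u} r) :
    ∃! φ : x k ⟶ x' k, α k ≫ b = (pieceToInertia π L s hD k).map φ ≫ β k := by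
  have H := isDisjointCover_of_coversBase hβ
  have := H.isOpenImmersion k
  have hrange : Set.range (InertiaHom.u (α k ≫ b)).hom.h ⊆ Set.range
      (InertiaHom.u (β k)).hom.h := by
    rintro _ ⟨y, rfl⟩
    obtain ⟨k', y', hy⟩ := H.covers ((InertiaHom.u (α k ≫ b)).hom.h y)
    obtain rfl := pieceIndex_eq hD (α k ≫ b) (β k') y y' hy.symm
    exact ⟨y', hy⟩
  let l := IsOpenImmersion.lift (InertiaHom.u (β k)).hom.h (InertiaHom.u (α k ≫ b)).hom.h hrange
  obtain ⟨c, hc, hc'⟩ := RootStackHom.exists_lift (InertiaHom.u (α k ≫ b)) (InertiaHom.u (β k)) l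
    (IsOpenImmersion.lift_fac _ _ _)
  have comm : RootStackHom.comp c ((pieceToInertia π L s hD k).obj (x' k) : InertiaObj
      (rootStack π L s r)).ν =
      RootStackHom.comp ((pieceToInertia π L s hD k).obj (x k) : InertiaObj (rootStack π L s r)).ν
          c := by
    refine RootStackHom.eq_of_comp_eq (InertiaHom.u (β k)) ?_ ?_
    · exact (congrArg (fun e => c.hom.h ≫ e) (inertia_hom_h
          ((pieceToInertia π L s hD k).obj (x' k)))).trans <|
        (Category.comp_id _).trans <| (Category.id_comp _).symm.trans
          (congrArg (fun e => e ≫ c.hom.h) (inertia_hom_h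
              ((pieceToInertia π L s hD k).obj (x k)))).symm
    · exact comp_comp_eq_of_comm (C := RootStackObj L s r) hc' (InertiaHom.comm (β k))
          (InertiaHom.comm (α k ≫ b))
  obtain ⟨φ, hφ⟩ := (pieceToInertia_map_bijective hD k (x k) (x' k)).2 ⟨c, comm⟩
  have hφ' : α k ≫ b = (pieceToInertia π L s hD k).map φ ≫ β k := by
    refine InertiaHom.ext (hc'.symm.trans ?_)
    exact congrArg (fun a => RootStackHom.comp a (InertiaHom.u (β k))) congr(InertiaHom.u $hφ).symm
  refine ⟨φ, hφ', fun φ' h' => (pieceToInertia_map_bijective hD k (x k) (x' k)).1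
      (InertiaHom.ext ?_)⟩
  have h1 := h'.symm.trans hφ'
  refine RootStackHom.eq_of_comp_eq (InertiaHom.u (β k))
      ((cancel_mono (InertiaHom.u (β k)).hom.h).1 ?_)
    congr(InertiaHom.u $h1)
  exact congr((InertiaHom.u $h1).hom.h)

variable (s) in
/-- A piece of an object of the inertia stack, on which the automorphism is multiplication by a
given root of unity. If this is not `1`, the section `t` vanishes on the piece, hence so does `s`,
and the piece maps to the zero locus. -/
theorem inertia_exists_piece [IsNoetherian X] (hL : L.IsInvertible)
    (z : InertiaObj (rootStack π L s r)) (w)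
    (ρ : z.x.M ≅ (pullback (𝟙 z.x.T)).obj z.x.M) (comm)
        (hν : (RootStackHom.hom z.ν) = ⟨𝟙 z.x.T, w, ρ, comm⟩)
    (k : PieceIndex.{u} r) {U : z.x.T.Opens}
    (hU : ActsBy ρ (↑(pullbackRoot (z.x.f ≫ π) k.root)⁻¹ : Γ(z.x.T, ⊤)) U) :
    ∃ (x : (piece π L s k).obj) (α : (pieceToInertia π L s hD k).obj x ⟶ z),
      IsOpenImmersion (InertiaHom.u α).hom.h ∧ Set.range (InertiaHom.u α).hom.h = U := by
  obtain ⟨A, α, hα, hαU⟩ : ∃ (A : RootStackObj L s r) (α : RootStackHom A z.x), IsOpenImmersion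
      α.hom.h ∧
      Set.range α.hom.h = U := by
    obtain ⟨M, hM, φ, t, ht, α, hα⟩ := RootStackObj.exists_restrict z.x U.ι _ rfl
    refine ⟨_, α, ?_, ?_⟩
    · rw [hα]
      infer_instance
    · rw [hα]
      exact U.range_ι
  have hq : α.hom.h ≫ z.x.f ≫ π = A.f ≫ π :=
    (Category.assoc _ _ _).symm.trans congr($(α.hom.w) ≫ π)
  have h1 := RootHom.comp_eq_scalar_comp α.hom (RootStackHom.hom z.ν) w ρ comm hν (z.x.f ≫ π)
      (A.f ≫ π) hq k.root hU
    fun y => hαU.le ⟨y, rfl⟩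
  match k with
  | none =>
    refine ⟨A, ⟨α, RootStackHom.ext (h1.trans ?_)⟩, hα, hαU⟩
    exact congrArg (fun a => RootHom.comp a α.hom)
        (RootHom.scalar_pullbackRoot_one A.toRootObj (A.f ≫ π))
  | some ζ =>
    have ht : A.t = 0 := eq_zero_of_scalar (hasRootsOfUnity_baseScheme r) α z.ν (A.f ≫ π) ζ.2 h1
    have hs : pullbackSection A.f L ⊤ s = 0 := by
      have h2 := A.isRootSection
      rw [IsRootSection, ht, tprod_zero, map_zero] at h2
      exact h2.symm
    obtain ⟨g, hg⟩ := exists_zeroLocus_lift hL A.f hs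
    obtain ⟨x, rfl⟩ := exists_gerbeInclusionObj_eq (zeroLocusι L s) hD A ht g hg
    have h3 := pieceToInertia_ν (π := π) hD (some ζ) x _ rfl
    refine ⟨x, ⟨α, RootStackHom.ext (h1.trans ?_)⟩, hα, hαU⟩
    exact congrArg (fun a => RootHom.comp a α.hom) h3.symm

/-- Every object of the inertia stack decomposes: by `RootObj.exists_decomposition` its base is a
disjoint union of open subschemes on which the automorphism is a root of unity, and by
`inertia_exists_piece` each of these comes from the stack with the corresponding index. -/
theorem inertia_exists_decomp [IsNoetherian X] (hL : L.IsInvertible)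
    (z : InertiaObj (rootStack π L s r)) :
    ∃ (x : ∀ k : PieceIndex.{u} r, (piece π L s k).obj)
      (α : ∀ k, (pieceToInertia π L s hD k).obj (x k) ⟶ z), CoversBase α := by
  obtain ⟨w, ρ, comm, hν⟩ := RootHom.exists_eq_mk (RootStackHom.hom z.ν) (inertia_hom_h z)
  obtain ⟨U, hU, hU'⟩ := z.x.exists_decomposition (hasRootsOfUnity_baseScheme r) (z.x.f ≫ π) w ρ
      comm
  choose x α hα hαU using fun k : PieceIndex.{u} r => inertia_exists_piece s hD hL z w ρ comm hν k
      (hU' k.root)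
  refine ⟨x, α, (nonempty_isColimit_over_iff fun k => (inertia (rootStack π L s r)).p.map (α k)).2
    ⟨hα, fun p => ?_, fun k k' y y' h => pieceIndex_eq hD (α k) (α k') y y' h⟩⟩
  obtain ⟨ζ, y, hy⟩ := hU.covers p
  obtain ⟨k, rfl⟩ := PieceIndex.exists_root_eq ζ
  have hp : p ∈ (U k.root : Set z.x.T) := hy ▸ y.2
  rw [← hαU k] at hp
  obtain ⟨y', hy'⟩ := hp
  exact ⟨k, y', hy'⟩

/-- The canonical functors exhibit the inertia stack as a coproduct. -/
theorem isStackDecomposition_pieceToInertia [IsNoetherian X] (hL : L.IsInvertible) :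
    IsStackDecomposition (pieceToInertia π L s hD) where
  exists_glue y B j H := inertia_exists_glue y B.hom j H
  exists_decomp z := inertia_exists_decomp hD hL z
  existsUnique_hom α β k hα hk := inertia_existsUnique_hom α β k hα hk
  existsUnique_piece α β b _ hβ k := inertia_existsUnique_piece hD α β b hβ k

end AlgebraicGeometry

theorem mainTheorem6 (r : ℕ) [NeZero r] (X : Scheme.{u}) [AlgebraicGeometry.IsNoetherian X]
    (π : X ⟶ baseScheme r) (L : X.Modules) (hL : L.IsInvertible) (s : Γ(L, ⊤)) :
    ∃ hD : Scheme.Modules.pullbackSection (zeroLocusι L s) L ⊤ s = 0,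
      ∃ E : stackCoprod (piece π L s) ⥤ᵇ inertia (rootStack π L s r),
        IsEquivalenceOver E ∧ RestrictsTo E (pieceToInertia π L s hD) :=
  ⟨pullbackSection_zeroLocusι hL s,
    (isStackDecomposition_pieceToInertia (pullbackSection_zeroLocusι hL s) hL).exists_equivalence⟩
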